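/- **Model.** A network is a strongly connected directed graph with $n\ge 2$ nodes; $D$ (its eccentricity) is the maximum directed distance between two nodes. Nodes know only $n$ and $D$. Time is synchronous. In each step a node either transmits a bit string of $O(\log n)$ bits to all its out-neighbours or listens; a listening node receives a message if and only if exactly one of its in-neighbours transmits, and otherwise it receives nothing (no collision detection). Nodes use private independent random coins. Logarithms are binary, $\log n$ and $\sqrt{\log n}$ stand for $\lceil\log n\rceil$ and $\lceil\sqrt{\lceil\log n\rceil}\,\rceil$ where integers are needed, probabilities are capped at $1$, and bit strings of equal length are compared as binary numbers. Put $T_{BC}=D\log\frac{2n}{D}+\log^2 n$ (so $T_{BC}=\Theta(D\log\frac nD+\log^2 n)$ when $D\le n/2$). **Procedures.** All of them take a predetermined number of steps. - *Partial Multi-Broadcast*$(S,f,l)$, where $l=O(\log n)$ and each source $s\in S$ has a string $f(s)\in\{0,1\}^l$: every node $v$ ends with a string $m(v)$, where $m(v)=\varepsilon$ for all $v$ if $S=\emptyset$, and otherwise each $m(v)$ is $f(s)$ for some $s\in S$. - *Decay*: in step $i=1,\dots,\log n$ each participant transmits its current string with probability $2^{-i}$; the other nodes listen. - *Selection*$(S)$,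 for sources with $l$-bit IDs: $m\gets$ Partial Multi-Broadcast$(S,\mathrm{ID},l)$. A node with $m(v)=\varepsilon$ outputs $(\varepsilon,0)$. Otherwise, for $i=1,\dots,l$: the nodes with $m(v)_i=1$ perform four rounds of Decay with their strings $m(v)$; a node with $m(v)_i=0$ that receives something becomes a witness and replaces $m(v)$ by the maximum of $m(v)$ and the received strings. Then $p\gets$ Partial Multi-Broadcast$(W,m,l)$, where $W$ is the set of witnesses; $v$ outputs $(m(v),1)$ if $p(v)=\varepsilon$ and $(p(v),0)$ otherwise. - *Search*$(C,k)$: for $i=1,\dots,k$, the nodes of $C$ whose ID agrees with the bits $m(v)_1\dots m(v)_{i-1}$ found so far and has $i$-th bit $1$ are the sources of a Partial Multi-Broadcast of the one-bit string $1$; $v$ sets $m(v)_i=0$ if it interprets $\varepsilon$, and $m(v)_i=1$ otherwise. **Algorithm** with constants $(\alpha,\beta,\gamma)$. Each node independently joins the candidate set $C$ with probability $\alpha\log n/n$, and each candidate chooses a uniformly random ID of $\beta\log n$ bits. Then $m\gets$ Search$(C,\sqrt{\log n})$, and candidates whose first $\sqrt{\log n}$ ID bits differ from $m(v)$ leave $C$.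 Then, $\gamma\sqrt{\log n}$ times: $(p,b)\gets$ Selection$(C)$; a node with $b=1$ outputs $p(v)$ and stops; otherwise a candidate with $p(v)>\mathrm{ID}(v)$ leaves $C$. **Theorem.** Say that the algorithm with constants $(\alpha,\beta,\gamma)$ *works with exponent $c$ for $n\ge n_0$* if there are a constant $K$ and a Partial Multi-Broadcast procedure which, on every network with $n\ge n_0$ nodes and for all lengths $l\le\beta\log n$, takes a fixed time of at most $K\,T_{BC}$ steps and is correct with probability at least $1-n^{-c}$, such that on every network with $n\ge n_0$ nodes the algorithm run with this procedure always stops within a fixed time $T(n,D)\le K\,T_{BC}\sqrt{\log n}$, uses messages of at most $K\log n$ bits, and with probability at least $1-n^{-c}$ all of the following hold: 1. all nodes output the same ID, and precisely one node has this ID as its own; 2. after Search, at least $1$ and at most $\gamma\sqrt{\log n}$ candidates remain; 3. each iteration of Selection that starts with more than one candidate removes the candidate with the minimum ID, and leaves at least one candidate. Then (i) for some $n_0\ge 2$ the algorithm with constants $(4,16,3)$ works with exponent $1$ for $n\ge n_0$; and (ii) for every $c\ge1$ there are constants $(\alpha,\beta,\gamma)$ with which the algorithm works with exponent $c$ for $n\ge2$.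 -/

import Mathlib

namespace RadioNetwork

open scoped ENNReal NNReal

/-! ### Probability: independent families of discrete random variables -/

theorem tsum_fin_prod {β : Type} : ∀ (n : ℕ) (p : Fin n → β → ℝ≥0∞),
    ∑' f : Fin n → β, ∏ i, p i (f i) = ∏ i, ∑' b, p i b
  | 0, p => by
      rw [tsum_eq_single (fun i => i.elim0)
        (fun f hf => absurd (funext fun i => i.elim0) hf)]
      simp
  | n + 1, p => by
      rw [← (Fin.consEquiv fun _ : Fin (n + 1) => β).tsum_eq, ENNReal.tsum_prod',
        Fin.prod_univ_succ, ← tsum_fin_prod n (fun i => p i.succ), ← ENNReal.tsum_mul_right]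
      refine tsum_congr fun b => ?_
      rw [← ENNReal.tsum_mul_left]
      refine tsum_congr fun f => ?_
      simp [Fin.consEquiv, Fin.prod_univ_succ]

theorem tsum_pi_prod {V β : Type} [Fintype V] (p : V → β → ℝ≥0∞) :
    ∑' f : V → β, ∏ v, p v (f v) = ∏ v, ∑' b, p v b := by
  let e := (Fintype.equivFin V).symm
  rw [← (Equiv.arrowCongr e (Equiv.refl β)).tsum_eq, ← e.prod_comp,
    ← tsum_fin_prod _ (fun i => p (e i))]
  refine tsum_congr fun f => ?_
  rw [← e.prod_comp]
  simp [Equiv.arrowCongr]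

/-- The law of a family of independent random variables, the `v`-th one with law `p v`. -/
noncomputable def indep {V β : Type} [Fintype V] (p : V → PMF β) : PMF (V → β) :=
  ⟨fun f => ∏ v, p v (f v), by
    have h : ∑' f : V → β, ∏ v, p v (f v) = 1 := by
      rw [tsum_pi_prod (fun v b => p v b)]
      simp [PMF.tsum_coe]
    exact h ▸ ENNReal.summable.hasSum⟩

/-- A biased coin: `true` with probability `p`. -/
noncomputable def coinPMF (p : ℝ≥0) (h : p ≤ 1) : PMF Bool :=
  PMF.ofFintype (fun b => if b then (p : ℝ≥0∞) else ((1 - p : ℝ≥0) : ℝ≥0∞)) (by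
    simp only [Fintype.univ_bool, Finset.mem_singleton, Bool.true_eq_false, not_false_eq_true,
      Finset.sum_insert, Finset.sum_singleton, if_true, Bool.false_eq_true, if_false]
    rw [← ENNReal.coe_add, add_tsub_cancel_of_le h, ENNReal.coe_one])

/-! ### Directed networks -/

/-- There is a directed walk with exactly `k` edges from `u` to `v`. -/
def ReachIn {V : Type} (G : Digraph V) : ℕ → V → V → Prop
  | 0, u, v => u = v
  | k + 1, u, v => ∃ w, ReachIn G k u w ∧ G.Adj w v

/-- `G` is strongly connected and the maximum directed distance between any pair of nodes (the
eccentricity of the network) is exactly `D`. -/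
def HasEccentricity {V : Type} (G : Digraph V) (D : ℕ) : Prop :=
  (∀ u v, ∃ k ≤ D, ReachIn G k u v) ∧ ∃ u v, ∀ k < D, ¬ ReachIn G k u v

/-! ### Node programs and their synchronous execution without collision detection -/

/-- Bit strings, most significant bit first. The order on them is the lexicographic one, which for
strings of equal length is the order of the numbers they denote. -/
abbrev Bits := List Bool

/-- A randomized program of a single node: it stops with an output, or flips a private biased coin,
or spends one time step. In a time step `step (some x) k` it transmits `x`; in a time step
`step none k` it listens, and it goes on with `k r` where `r` is what it received. -/
inductive Prog (α : Type) : Type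
  | done (a : α) : Prog α
  | coin (p : ℝ≥0) (hp : p ≤ 1) (k : Bool → Prog α) : Prog α
  | step (x : Option Bits) (k : Option Bits → Prog α) : Prog α

namespace Prog

/-- Sequential composition. -/
def bind {α β : Type} : Prog α → (α → Prog β) → Prog β
  | done a, f => f a
  | coin p hp k, f => coin p hp fun b => (k b).bind f
  | step x k, f => step x fun r => (k r).bind f

instance : Monad Prog where
  pure := done
  bind := bind

/-- A coin that shows `true` with probability `min 1 p`. -/
noncomputable def flip (p : ℝ≥0) : Prog Bool := coin (min 1 p) (min_le_left 1 p) done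

/-- One time step; the result is the received message, if any. -/
def act (x : Option Bits) : Prog (Option Bits) := step x done

/-- Stay silent for `t` time steps. -/
def idle : ℕ → Prog Unit
  | 0 => done ()
  | t + 1 => step none fun _ => idle t

/-- On every branch, the program takes exactly `t` time steps. -/
def HasDuration {α : Type} : Prog α → ℕ → Prop
  | done _, t => t = 0
  | coin _ _ k, t => ∀ b, (k b).HasDuration t
  | step _ k, t => ∃ s, t = s + 1 ∧ ∀ r, (k r).HasDuration s

/-- On every branch, the program takes at most `t` time steps. -/
def StepsLE {α : Type} : Prog α → ℕ → Prop
  | done _, _ => True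
  | coin _ _ k, t => ∀ b, (k b).StepsLE t
  | step _ k, t => ∃ s, t = s + 1 ∧ ∀ r, (k r).StepsLE s

/-- Every message sent by the program has at most `M` bits, provided that those which it receives
have at most `M` bits. -/
def MsgLE {α : Type} (M : ℕ) : Prog α → Prop
  | done _ => True
  | coin _ _ k => ∀ b, (k b).MsgLE M
  | step x k => (∀ y ∈ x, y.length ≤ M) ∧
      ∀ r : Option Bits, (∀ y ∈ r, y.length ≤ M) → (k r).MsgLE M

/-- Flip the coins that come before the next time step. -/
noncomputable def settle {α : Type} : Prog α → PMF (Prog α)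
  | done a => PMF.pure (done a)
  | coin p hp k => (coinPMF p hp).bind fun b => (k b).settle
  | step x k => PMF.pure (step x k)

/-- The message that a settled program transmits now. -/
def sends {α : Type} : Prog α → Option Bits
  | step x _ => x
  | _ => none

/-- Continue a settled program after a time step in which `r` arrives at the node; a transmitting
node hears nothing. -/
def resume {α : Type} (r : Option Bits) : Prog α → Prog α
  | step none k => k r
  | step (some _) k => k none
  | done a => done a
  | coin p hp k => coin p hp k

/-- The output, once the program has stopped. -/
def output {α : Type} : Prog α → Option α
  | done a => some a
  | _ => none

end Prog

open Classical in
/-- What arrives at `v`: if exactly one in-neighbour transmits, its message; otherwise nothing. -/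
noncomputable def heard {V : Type} (G : Digraph V) (x : V → Option Bits) (v : V) : Option Bits :=
  if h : ∃! u, G.Adj u v ∧ x u ≠ none then x h.choose else none

/-- The random configuration after `t` synchronous time steps, when every node `v` runs `P v` with
private independent coins. -/
noncomputable def exec {V α : Type} [Fintype V] (G : Digraph V) :
    ℕ → (V → Prog α) → PMF (V → Prog α)
  | 0, P => indep fun v => (P v).settle
  | t + 1, P => (indep fun v => (P v).settle).bind fun Q =>
      exec G t fun v => (Q v).resume (heard G (fun u => (Q u).sends) v)

/-- The probability that within `t` time steps all nodes have stopped, with outputs that satisfy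
`E`. -/
noncomputable def prob {V α : Type} [Fintype V] (G : Digraph V) (t : ℕ) (P : V → Prog α)
    (E : (V → α) → Prop) : ℝ≥0∞ :=
  (exec G t P).toOuterMeasure {Q | ∃ a : V → α, (∀ v, (Q v).output = some (a v)) ∧ E a}

/-! ### Parameters -/

/-- `⌈log₂ n⌉`. -/
def lg (n : ℕ) : ℕ := Nat.clog 2 n

/-- `⌈√⌈log₂ n⌉⌉`. -/
noncomputable def sqrtLg (n : ℕ) : ℕ := ⌈Real.sqrt (lg n)⌉₊

/-- `D log (2n/D) + log² n = D log (n/D) + D + log² n`, with binary logarithms. -/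
noncomputable def bcastTime (n D : ℕ) : ℝ :=
  D * Real.logb 2 (2 * n / D) + Real.logb 2 n ^ 2

/-! ### Partial Multi-Broadcast -/

/-- A family of programs for multi-source broadcast, which know only `n`, `D` and the message length
`l`. The input of a node is `some` of its message if it is a source and `none` otherwise; the output
is the string that the node interprets, `none` being the empty string `ε`. -/
structure MultiBroadcast where
  /-- the predetermined number of time steps -/
  time : ℕ → ℕ → ℕ
  /-- the program of a node -/
  run : (n D l : ℕ) → Option Bits → Prog (Option Bits)

/-- What Partial Multi-Broadcast with input `f` has to achieve: without sources, all nodes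
interpret `ε`; otherwise every node interprets the string of some source. -/
def MultiBroadcast.Correct {V : Type} (f m : V → Option Bits) : Prop :=
  ((∀ v, f v = none) → ∀ v, m v = none) ∧
  ((∃ s, f s ≠ none) → ∀ v, ∃ s, f s ≠ none ∧ m v = f s)

/-- On the network `G` with `n` nodes and eccentricity `D`, and for all strings of at most `lmax`
bits, `B` performs Partial Multi-Broadcast with probability at least `1 - n ^ (-c)`, in its fixed
time, which is at most `K (D log (2n/D) + log² n)`, and with messages of at most `K log n` bits. -/
def MultiBroadcast.Works (B : MultiBroadcast) {V : Type} [Fintype V] (G : Digraph V)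
    (n D lmax : ℕ) (c K : ℝ) : Prop :=
  (B.time n D : ℝ) ≤ K * bcastTime n D ∧
  ∀ l ≤ lmax,
    (∀ x : Option Bits, (B.run n D l x).HasDuration (B.time n D)) ∧
    (∀ x : Option Bits, (∀ y ∈ x, y.length = l) →
      (B.run n D l x).MsgLE ⌊K * Real.logb 2 n⌋₊) ∧
    ∀ f : V → Option Bits, (∀ v, ∀ y ∈ f v, y.length = l) →
      ENNReal.ofReal (1 - (n : ℝ) ^ (-c)) ≤
        prob G (B.time n D) (fun v => B.run n D l (f v)) (MultiBroadcast.Correct f)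

/-! ### Decay -/

/-- One round of Decay at a node: `x` is `some` of the node's message if it takes part and `none`
otherwise. For `i = 1, …, log n`, in time step `i`, a participant transmits with probability
`2 ^ (-i)`. The result is the list of the received messages. -/
noncomputable def decay (n : ℕ) (x : Option Bits) : Prog (List Bits) :=
  (List.range (lg n)).foldlM (fun got i => do
    let b ← Prog.flip ((2 : ℝ≥0)⁻¹ ^ (i + 1))
    let r ← Prog.act (if b then x else none)
    pure (got ++ r.toList)) []

/-- Four rounds of Decay. -/
noncomputable def decay4 (n : ℕ) (x : Option Bits) : Prog (List Bits) := do
  let r₁ ← decay n x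
  let r₂ ← decay n x
  let r₃ ← decay n x
  let r₄ ← decay n x
  pure (r₁ ++ r₂ ++ r₃ ++ r₄)

/-! ### Selection -/

/-- The middle part of Selection. For each bit position `i` below `l`, the nodes whose string `m`
has `i`-th bit `1` do four rounds of Decay with message `m`; a node with `i`-th bit `0` that
receives something becomes a witness and raises `m` to the maximum of `m` and what it received.
The result is the final `m` and whether the node is a witness. -/
noncomputable def findWitnesses (n l : ℕ) (m : Bits) : Prog (Bits × Bool) :=
  (List.range l).foldlM (fun (s : Bits × Bool) i => do
    let bit := s.1.getD i false
    let got ← decay4 n (if bit then some s.1 else none)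
    pure (if bit = false ∧ got ≠ [] then (got.foldl max s.1, true) else s)) (m, false)

/-- Selection with IDs of `l` bits: `x` is `some` of the node's ID if it is a source. -/
noncomputable def selection (B : MultiBroadcast) (n D l : ℕ) (x : Option Bits) :
    Prog (Option Bits × Bool) := do
  let m ← B.run n D l x
  match m with
  | none =>
    -- the rest of the fixed time of the procedure
    Prog.idle (l * (4 * lg n) + B.time n D)
    pure (none, false)
  | some m₀ =>
    let (m₁, witness) ← findWitnesses n l m₀
    let p ← B.run n D l (if witness then some m₁ else none)
    match p with
    | none => pure (some m₁, true)
    | some q => pure (some q, false)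

/-! ### Search -/

/-- Binary search for the first `k` bits of the highest ID in use; `id` is the node's ID if it is a
source. -/
noncomputable def search (B : MultiBroadcast) (n D k : ℕ) (id : Option Bits) : Prog Bits :=
  (List.range k).foldlM (fun (m : Bits) i => do
    let source := id.any fun x => decide (x.take i = m) && x.getD i false
    let p ← B.run n D 1 (if source then some [true] else none)
    pure (m ++ [p.isSome])) []

/-! ### Leader election -/

/-- The constants of the algorithm: nodes become candidates with probability `cand · log n / n`,
IDs have `bits · log n` bits, and there are `rounds · √log n` iterations of Selection. -/
structure Constants where
  cand : ℕ
  bits : ℕ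
  rounds : ℕ

/-- What a node holds at the end: its own ID (if it was a candidate), the ID it outputs as the
leader's (if any), and a record of its membership in the candidate set `C`; entry `0` is the
membership right after the Search phase, and entry `j` the membership after `j` iterations of
Selection. The record does not influence the execution. -/
structure Outcome where
  id : Option Bits
  leader : Option Bits
  record : List Bool

/-- A uniformly random string of `l` bits. -/
noncomputable def randomBits : ℕ → Prog Bits
  | 0 => pure []
  | l + 1 => do
    let b ← Prog.flip 2⁻¹
    let x ← randomBits l
    pure (b :: x)

/-- The loop of the algorithm with `k` iterations of Selection left, at a node with ID `id`;
`inC` says whether the node is in `C`. The result is the output and the record of membership. -/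
noncomputable def selectionLoop (B : MultiBroadcast) (n D l : ℕ) (id : Option Bits) :
    ℕ → Bool → Prog (Option Bits × List Bool)
  | 0, inC => pure (none, [inC])
  | k + 1, inC => do
    let (p, b) ← selection B n D l (if inC then id else none)
    if b then
      pure (p, List.replicate (k + 2) inC)
    else
      let higher := id.any fun x => p.any fun y => decide (x < y)
      let (out, rec) ← selectionLoop B n D l id k (inC && !higher)
      pure (out, inC :: rec)

/-- High-probability leader election, at a node of a network with `n` nodes and eccentricity `D`. -/
noncomputable def leaderElection (κ : Constants) (B : MultiBroadcast) (n D : ℕ) :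
    Prog Outcome := do
  let candidate ← Prog.flip ((κ.cand * lg n : ℝ≥0) / n)
  let id ← if candidate then some <$> randomBits (κ.bits * lg n) else pure none
  let m ← search B n D (sqrtLg n) id
  let inC := id.any fun x => decide (x.take (sqrtLg n) = m)
  let (out, rec) ← selectionLoop B n D (κ.bits * lg n) id (κ.rounds * sqrtLg n) inC
  pure ⟨id, out, rec⟩

/-- All nodes output the same ID, and this is the ID of precisely one node. -/
def LeaderElected {V : Type} (ω : V → Outcome) : Prop :=
  ∃ x : Bits, (∀ v, (ω v).leader = some x) ∧ ∃! v, (ω v).id = some x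

/-- The candidates after the Search phase and `j` iterations of Selection. -/
def candidates {V : Type} (ω : V → Outcome) (j : ℕ) : Set V :=
  {v | (ω v).record.getD j false = true}

/-- After the Search phase there is at least one candidate and there are at most `N`. -/
def SearchNarrows {V : Type} (N : ℕ) (ω : V → Outcome) : Prop :=
  1 ≤ (candidates ω 0).ncard ∧ (candidates ω 0).ncard ≤ N

/-- As long as there are several candidates, each of the `N` iterations of Selection removes the
candidate with the minimum ID and keeps some other candidate. -/
def SelectionEliminates {V : Type} (N : ℕ) (ω : V → Outcome) : Prop :=
  ∀ j < N, 1 < (candidates ω j).ncard →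
    (candidates ω (j + 1)).Nonempty ∧ candidates ω (j + 1) ⊆ candidates ω j ∧
    ∀ v ∈ candidates ω j, (∀ u ∈ candidates ω j, ∀ x ∈ (ω v).id, ∀ y ∈ (ω u).id, x ≤ y) →
      v ∉ candidates ω (j + 1)

/-- With the constants `κ`, on all directed networks with at least `n₀` nodes and with a suitable
Partial Multi-Broadcast procedure, the algorithm elects a leader with probability at least
`1 - n ^ (-c)`, and always stops within a fixed time that is at most
`K (D log (2n/D) + log² n) √log n`. -/
def ElectsLeader (κ : Constants) (c : ℝ) (n₀ : ℕ) : Prop :=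
  ∃ (B : MultiBroadcast) (T : ℕ → ℕ → ℕ) (K : ℝ),
    ∀ (n D : ℕ), n₀ ≤ n → ∀ (V : Type) [Fintype V] (G : Digraph V),
      Fintype.card V = n → HasEccentricity G D →
      B.Works G n D (κ.bits * lg n) c K ∧
      (T n D : ℝ) ≤ K * (bcastTime n D * Real.sqrt (Real.logb 2 n)) ∧
      (leaderElection κ B n D).StepsLE (T n D) ∧
      (leaderElection κ B n D).MsgLE ⌊K * Real.logb 2 n⌋₊ ∧
      ENNReal.ofReal (1 - (n : ℝ) ^ (-c)) ≤
        prob G (T n D) (fun _ => leaderElection κ B n D) (fun ω =>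
          LeaderElected ω ∧
          SearchNarrows (κ.rounds * sqrtLg n) ω ∧
          SelectionEliminates (κ.rounds * sqrtLg n) ω)

end RadioNetwork

namespace RadioNetwork

open scoped ENNReal NNReal

/-! The proof has two halves: an analysis of the election over any procedure that is `Reliable`
(correct, and with every source keeping its own string, up to an error probability), and the
construction of such a procedure within the required time.

Election with fixed IDs. Search finds a prefix of the largest ID, because an ID that continues the
prefix found with 1 where the largest one continues with 0 would be larger still
(`failure_search_le`). In Selection every node holds the ID of some candidate. If there is only one
ID, no witness can arise and all nodes stop together (`failure_selection_single`). If two candidates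
have IDs that differ at some position, a directed walk between them crosses an edge from a node with
bit 1 to a node with bit 0. A round of Decay gets a message to the head of this edge with
probability at least 1/8, so the position is missed with probability at most (7/8)^4, and the misses
multiply (`failure_findWitnesses_witness`). The string of a witness strictly exceeds the ID of some
candidate, so the broadcast answer beats the minimum ID but never the maximum. Hence every iteration
loses a candidate and keeps one, and N iterations suffice for N candidates
(`failure_selectionLoop_le`).

Random IDs. There are three defects: no candidate at all, N + 1 candidates that share their first s
bits, and pairs of IDs that agree in too many positions. `idsRisk` dominates the failure probability
for each choice of IDs, and independence bounds its mean (`mean_idsRisk_le`). The second defect has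
probability at most (α log n)^(N+1) 2^(-sN). For s about √log n and N = γ s this is a power of 1/n,
up to a factor 2^(O(s log s)); so √log n bits of Search and as many iterations balance each other.

Broadcast. Informed nodes transmit with probability 2^(-level), the level being given by a schedule.
Fix a walk of length at most D from a source to a target, and rank each node by the last node of the
walk to which it has an edge. If i is the highest informed rank, then the informed in-neighbours of
the i-th node of the walk all have rank i, so a step whose level fits the number of those taking
part informs that node with probability at least 1/8 (`RankedWalk.mean_step_le`). The layers of
equal rank are disjoint, so few of them are much larger than n/D. Half of the schedule therefore
favours low levels: a layer of m nodes gets a window of O(p (1 + m / 2^p)) steps with p about log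
(2n/D), which sums to O(p D) (`sum_layerTime_le`). The other half cycles through all levels and caps
every window at O(log n). An exponential moment bound (`RankedWalk.mean_uninformed_mul_le`) then
makes the error polynomially small at the price of O(log² n) further steps, and a union bound over
the targets finishes (`reliable_layeredBroadcast`). -/

/-! ### Expectations over discrete laws -/

/-- The expectation of a nonnegative function. -/
noncomputable def mean {α : Type} (p : PMF α) (φ : α → ℝ≥0∞) : ℝ≥0∞ := ∑' a, p a * φ a

section Mean

variable {α β : Type}

theorem mean_pure (a : α) (φ : α → ℝ≥0∞) : mean (PMF.pure a) φ = φ a := by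
  unfold mean
  rw [tsum_eq_single a]
  · simp
  · intro b hb; simp [PMF.pure_apply, hb]

theorem mean_bind (p : PMF α) (f : α → PMF β) (φ : β → ℝ≥0∞) :
    mean (p.bind f) φ = mean p fun a => mean (f a) φ := by
  simp only [mean, PMF.bind_apply, ← ENNReal.tsum_mul_right, ← ENNReal.tsum_mul_left]
  rw [ENNReal.tsum_comm]
  simp only [mul_assoc]

theorem mean_map (p : PMF α) (f : α → β) (φ : β → ℝ≥0∞) :
    mean (p.map f) φ = mean p fun a => φ (f a) := by
  rw [← PMF.bind_pure_comp, mean_bind]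
  simp [mean_pure]

theorem mean_mono_support {p : PMF α} {φ ψ : α → ℝ≥0∞} (h : ∀ a ∈ p.support, φ a ≤ ψ a) :
    mean p φ ≤ mean p ψ := by
  refine ENNReal.tsum_le_tsum fun a => ?_
  by_cases ha : p a = 0
  · simp [ha]
  · exact mul_le_mul_right (h a ((PMF.mem_support_iff _ _).2 ha)) _

theorem mean_mono {p : PMF α} {φ ψ : α → ℝ≥0∞} (h : ∀ a, φ a ≤ ψ a) : mean p φ ≤ mean p ψ :=
  mean_mono_support fun a _ => h a

theorem mean_congr_support {p : PMF α} {φ ψ : α → ℝ≥0∞} (h : ∀ a ∈ p.support, φ a = ψ a) :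
    mean p φ = mean p ψ :=
  le_antisymm (mean_mono_support fun a ha => (h a ha).le)
    (mean_mono_support fun a ha => (h a ha).ge)

theorem mean_const (p : PMF α) (c : ℝ≥0∞) : mean p (fun _ => c) = c := by
  simp [mean, ENNReal.tsum_mul_right, p.tsum_coe]

theorem mean_le_of_le {p : PMF α} {φ : α → ℝ≥0∞} {c : ℝ≥0∞} (h : ∀ a, φ a ≤ c) :
    mean p φ ≤ c :=
  (mean_mono h).trans (mean_const p c).le

theorem mean_add (p : PMF α) (φ ψ : α → ℝ≥0∞) :
    mean p (fun a => φ a + ψ a) = mean p φ + mean p ψ := by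
  simp [mean, mul_add, ENNReal.tsum_add]

theorem mean_const_mul (p : PMF α) (c : ℝ≥0∞) (φ : α → ℝ≥0∞) :
    mean p (fun a => c * φ a) = c * mean p φ := by
  simp only [mean, ← ENNReal.tsum_mul_left]
  exact tsum_congr fun a => by ring

theorem mean_finset_sum {ι : Type} (s : Finset ι) (p : PMF α) (φ : ι → α → ℝ≥0∞) :
    mean p (fun a => ∑ i ∈ s, φ i a) = ∑ i ∈ s, mean p (φ i) := by
  classical
  induction s using Finset.induction_on with
  | empty => simp [mean]
  | insert i s hi ih => simp [Finset.sum_insert hi, mean_add, ih]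

theorem mean_tsum {ι : Type} (p : PMF α) (φ : ι → α → ℝ≥0∞) :
    mean p (fun a => ∑' i, φ i a) = ∑' i, mean p (φ i) := by
  simp only [mean, ← ENNReal.tsum_mul_left]
  exact ENNReal.tsum_comm

theorem bind_congr_support {p : PMF α} {f g : α → PMF β} (h : ∀ a ∈ p.support, f a = g a) :
    p.bind f = p.bind g := by
  ext b
  simp only [PMF.bind_apply]
  refine tsum_congr fun a => ?_
  by_cases ha : p a = 0
  · simp [ha]
  · rw [h a ((PMF.mem_support_iff _ _).2 ha)]

theorem mean_coin (p : ℝ≥0) (h : p ≤ 1) (φ : Bool → ℝ≥0∞) :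
    mean (coinPMF p h) φ = p * φ true + ((1 - p : ℝ≥0) : ℝ≥0∞) * φ false := by
  simp [mean, coinPMF]

end Mean

/-! ### Independent families -/

section Indep

variable {V α β : Type} [Fintype V]

theorem indep_apply (p : V → PMF β) (f : V → β) : indep p f = ∏ v, p v (f v) := rfl

theorem mem_support_of_indep {p : V → PMF β} {f : V → β} (h : f ∈ (indep p).support) (v : V) :
    f v ∈ (p v).support := by
  rw [PMF.mem_support_iff, indep_apply, Finset.prod_ne_zero_iff] at h
  exact (PMF.mem_support_iff _ _).2 (h v (Finset.mem_univ v))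

/-- The distributive law `tsum_pi_prod`, read as a statement about sampling: the private coins of
all nodes may be drawn jointly, before any of the continuations. `exec_coin` and `exec_bind` rest on
this. -/
theorem indep_bind (p : V → PMF α) (f : V → α → PMF β) :
    (indep fun v => (p v).bind (f v)) = (indep p).bind fun b => indep fun v => f v (b v) := by
  ext g
  simp only [indep_apply, PMF.bind_apply]
  rw [← tsum_pi_prod (fun v b => p v b * f v b (g v))]
  simp only [Finset.prod_mul_distrib]

theorem indep_pure (a : V → β) : (indep fun v => PMF.pure (a v)) = PMF.pure a := by
  classical
  ext g
  rw [indep_apply, PMF.pure_apply]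
  split_ifs with h
  · subst h; simp
  · obtain ⟨v, hv⟩ := Function.ne_iff.1 h
    exact Finset.prod_eq_zero (Finset.mem_univ v) (by simp [PMF.pure_apply, hv])

theorem indep_map (p : V → PMF α) (f : V → α → β) :
    (indep fun v => (p v).map (f v)) = (indep p).map fun a v => f v (a v) := by
  simp only [← PMF.bind_pure_comp, Function.comp_def]
  rw [indep_bind]
  simp only [indep_pure]

theorem mean_indep_prod (p : V → PMF β) (φ : V → β → ℝ≥0∞) :
    mean (indep p) (fun f => ∏ v, φ v (f v)) = ∏ v, mean (p v) (φ v) := by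
  simp only [mean, indep_apply, ← Finset.prod_mul_distrib]
  exact tsum_pi_prod fun v b => p v b * φ v b

theorem mean_indep_prod_finset (s : Finset V) (p : V → PMF β) (φ : V → β → ℝ≥0∞) :
    mean (indep p) (fun f => ∏ v ∈ s, φ v (f v)) = ∏ v ∈ s, mean (p v) (φ v) := by
  classical
  have h := mean_indep_prod p fun v b => if v ∈ s then φ v b else 1
  have h1 : ∀ f : V → β, (∏ v, if v ∈ s then φ v (f v) else 1) = ∏ v ∈ s, φ v (f v) := fun f => by
    rw [Finset.prod_ite_mem, Finset.univ_inter]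
  have h2 : ∀ v, mean (p v) (fun b => if v ∈ s then φ v b else 1) =
      if v ∈ s then mean (p v) (φ v) else 1 := fun v => by
    split_ifs <;> simp [mean_const]
  simp only [h1, h2] at h
  rw [h, Finset.prod_ite_mem, Finset.univ_inter]

end Indep

/-! ### Programs -/

namespace Prog

variable {α β γ : Type}

theorem monad_pure_eq (a : α) : (pure a : Prog α) = done a := rfl

theorem monad_bind_eq (P : Prog α) (F : α → Prog β) : P >>= F = P.bind F := rfl

theorem bind_done (P : Prog α) : P.bind done = P := by
  induction P with
  | done a => rfl
  | coin p hp k ih => simp [bind, ih]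
  | step x k ih => simp [bind, ih]

theorem bind_assoc (P : Prog α) (F : α → Prog β) (H : β → Prog γ) :
    (P.bind F).bind H = P.bind fun a => (F a).bind H := by
  induction P with
  | done a => rfl
  | coin p hp k ih => simp [bind, ih]
  | step x k ih => simp [bind, ih]

instance : LawfulMonad Prog := LawfulMonad.mk'
  (id_map := fun P => bind_done P)
  (pure_bind := fun _ _ => rfl)
  (bind_assoc := bind_assoc)

theorem settle_bind (P : Prog α) (F : α → Prog β) :
    (P.bind F).settle = P.settle.bind fun Q => (Q.bind F).settle := by
  induction P with
  | done a => simp [bind, settle]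
  | coin p hp k ih => simp [bind, settle, ih]
  | step x k ih => simp [bind, settle]

/-- A settled program has no coin before its next time step, so there is nothing left to settle. -/
theorem settle_settle (P : Prog α) : P.settle.bind settle = P.settle := by
  have h := settle_bind P done
  simpa only [bind_done] using h.symm

theorem HasDuration.bind {P : Prog α} {F : α → Prog β} {s t : ℕ} (hP : P.HasDuration s)
    (hF : ∀ a, (F a).HasDuration t) : (P.bind F).HasDuration (s + t) := by
  induction P generalizing s with
  | done a => cases hP; simpa [Prog.bind] using hF a
  | coin p hp k ih => exact fun b => ih b (hP b)
  | step x k ih =>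
    obtain ⟨s, rfl, h⟩ := hP
    exact ⟨s + t, by omega, fun r => ih r (h r)⟩

theorem HasDuration.stepsLE {P : Prog α} {t : ℕ} (h : P.HasDuration t) : P.StepsLE t := by
  induction P generalizing t with
  | done a => trivial
  | coin p hp k ih => exact fun b => ih b (h b)
  | step x k ih =>
    obtain ⟨s, rfl, h⟩ := h
    exact ⟨s, rfl, fun r => ih r (h r)⟩

theorem StepsLE.mono {P : Prog α} {s t : ℕ} (h : P.StepsLE s) (hst : s ≤ t) : P.StepsLE t := by
  induction P generalizing s t with
  | done a => trivial
  | coin p hp k ih => exact fun b => ih b (h b) hst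
  | step x k ih =>
    obtain ⟨s, rfl, h⟩ := h
    exact ⟨t - 1, by omega, fun r => ih r (h r) (by omega)⟩

theorem StepsLE.bind {P : Prog α} {F : α → Prog β} {s t : ℕ} (hP : P.StepsLE s)
    (hF : ∀ a, (F a).StepsLE t) : (P.bind F).StepsLE (s + t) := by
  induction P generalizing s with
  | done a => exact (hF a).mono (by omega)
  | coin p hp k ih => exact fun b => ih b (hP b)
  | step x k ih =>
    obtain ⟨s, rfl, h⟩ := hP
    exact ⟨s + t, by omega, fun r => ih r (h r)⟩

/-- Every message sent has at most `M` bits and every output satisfies `A`, provided that the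
messages received have at most `M` bits. -/
def Bounded (M : ℕ) (A : α → Prop) : Prog α → Prop
  | done a => A a
  | coin _ _ k => ∀ b, (k b).Bounded M A
  | step x k => (∀ y ∈ x, y.length ≤ M) ∧
      ∀ r : Option Bits, (∀ y ∈ r, y.length ≤ M) → (k r).Bounded M A

theorem Bounded.msgLE {M : ℕ} {A : α → Prop} {P : Prog α} (h : P.Bounded M A) : P.MsgLE M := by
  induction P with
  | done a => trivial
  | coin p hp k ih => exact fun b => ih b (h b)
  | step x k ih => exact ⟨h.1, fun r hr => ih r (h.2 r hr)⟩

theorem Bounded.bind {M : ℕ} {A : α → Prop} {B : β → Prop} {P : Prog α} {F : α → Prog β}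
    (h : P.Bounded M A) (hF : ∀ a, A a → (F a).Bounded M B) : (P.bind F).Bounded M B := by
  induction P with
  | done a => exact hF a h
  | coin p hp k ih => exact fun b => ih b (h b)
  | step x k ih => exact ⟨h.1, fun r hr => ih r (h.2 r hr)⟩

theorem bounded_foldlM {M : ℕ} {ι : Type} {A : α → Prop} (f : α → ι → Prog α) (l : List ι)
    (hf : ∀ a i, A a → (f a i).Bounded M A) : ∀ a, A a → (l.foldlM f a).Bounded M A := by
  induction l with
  | nil => intro a ha; exact ha
  | cons i l ih =>
    intro a ha
    rw [List.foldlM_cons]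
    exact (hf a i ha).bind ih

theorem hasDuration_foldlM {ι : Type} (f : α → ι → Prog α) (l : List ι) {d : ℕ}
    (hf : ∀ a i, (f a i).HasDuration d) : ∀ a, (l.foldlM f a).HasDuration (l.length * d) := by
  induction l with
  | nil => intro a; simp [monad_pure_eq, HasDuration]
  | cons i l ih =>
    intro a
    rw [List.foldlM_cons, List.length_cons, Nat.succ_mul, add_comm]
    exact (hf a i).bind ih

theorem hasDuration_idle : ∀ t, (idle t).HasDuration t
  | 0 => rfl
  | t + 1 => ⟨t, rfl, fun _ => hasDuration_idle t⟩

theorem hasDuration_done (a : α) : (done a).HasDuration 0 := rfl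

theorem hasDuration_flip (p : ℝ≥0) : (flip p).HasDuration 0 := fun _ => rfl

theorem HasDuration.settle_zero {P : Prog α} (h : P.HasDuration 0) :
    ∀ Q ∈ P.settle.support, ∃ a, Q = done a := by
  induction P with
  | done a => intro Q hQ; exact ⟨a, by simpa [settle] using hQ⟩
  | coin p hp k ih =>
    intro Q hQ
    obtain ⟨b, _, hb⟩ := (PMF.mem_support_bind_iff _ _ _).1 hQ
    exact ih b (h b) Q hb
  | step x k ih => obtain ⟨s, hs, _⟩ := h; omega

theorem HasDuration.settle_succ {P : Prog α} {t : ℕ} (h : P.HasDuration (t + 1)) :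
    ∀ Q ∈ P.settle.support, ∃ x k, Q = step x k ∧ ∀ r, (k r).HasDuration t := by
  induction P with
  | done a => cases h
  | coin p hp k ih =>
    intro Q hQ
    obtain ⟨b, _, hb⟩ := (PMF.mem_support_bind_iff _ _ _).1 hQ
    exact ih b (h b) Q hb
  | step x k ih =>
    obtain ⟨s, hs, hk⟩ := h
    obtain rfl : t = s := by omega
    intro Q hQ
    exact ⟨x, k, by simpa [settle] using hQ, hk⟩

end Prog

/-! ### Execution -/

section Exec

variable {V α β : Type} (G : Digraph V)

/-- What a node receives when the nodes transmit `x`; a transmitting node receives nothing. -/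
noncomputable def received (x : V → Option Bits) (v : V) : Option Bits :=
  if x v = none then heard G x v else none

theorem resume_step (x : V → Option Bits) (k : V → Option Bits → Prog α) (v : V) :
    (Prog.step (x v) (k v)).resume (heard G (fun u => (Prog.step (x u) (k u)).sends) v) =
      k v (received G x v) := by
  unfold received
  cases h : x v <;> simp [Prog.resume, Prog.sends]

open Classical in
/-- The value of `φ` at the outputs, or `1` if some node has not stopped. -/
noncomputable def outcomeValue (φ : (V → α) → ℝ≥0∞) (Q : V → Prog α) : ℝ≥0∞ :=
  if h : ∃ a : V → α, ∀ v, (Q v).output = some (a v) then φ h.choose else 1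

theorem outcomeValue_eq (φ : (V → α) → ℝ≥0∞) {Q : V → Prog α} {a : V → α}
    (h : ∀ v, (Q v).output = some (a v)) : outcomeValue φ Q = φ a := by
  have hex : ∃ a : V → α, ∀ v, (Q v).output = some (a v) := ⟨a, h⟩
  rw [outcomeValue, dif_pos hex]
  congr 1
  funext v
  exact Option.some_injective _ ((hex.choose_spec v).symm.trans (h v))

variable [Fintype V]

/-- As settling is idempotent, pending coins may be flipped before the execution starts without
changing its law. -/
theorem exec_settle (t : ℕ) (P : V → Prog α) :
    exec G t P = (indep fun v => (P v).settle).bind fun Q => exec G t Q := by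
  have h : (indep fun v => (P v).settle) =
      (indep fun v => (P v).settle).bind fun Q => indep fun v => (Q v).settle := by
    rw [← indep_bind]
    simp only [Prog.settle_settle]
  cases t with
  | zero => exact h
  | succ t =>
    simp only [exec]
    conv_lhs => rw [h]
    rw [PMF.bind_bind]

theorem exec_done (t : ℕ) (a : V → α) :
    exec G t (fun v => Prog.done (a v)) = PMF.pure fun v => Prog.done (a v) := by
  induction t with
  | zero => simp [exec, Prog.settle, indep_pure]
  | succ t ih => simp [exec, Prog.settle, indep_pure, Prog.resume, ih]

theorem exec_coin (t : ℕ) (p : V → ℝ≥0) (hp : ∀ v, p v ≤ 1) (k : V → Bool → Prog α) :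
    exec G t (fun v => Prog.coin (p v) (hp v) (k v)) =
      (indep fun v => coinPMF (p v) (hp v)).bind fun b => exec G t fun v => k v (b v) := by
  cases t <;> simp only [exec, Prog.settle, indep_bind, PMF.bind_bind]

theorem exec_step (t : ℕ) (x : V → Option Bits) (k : V → Option Bits → Prog α) :
    exec G (t + 1) (fun v => Prog.step (x v) (k v)) =
      exec G t fun v => k v (received G x v) := by
  simp only [exec, Prog.settle, indep_pure, PMF.pure_bind, resume_step]

/-- The fixed duration is essential: all nodes leave the first program after the same time step, so
the second one again starts synchronously. Coins at the boundary are settled twice, which is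
harmless by `exec_settle`. -/
theorem exec_bind (F : V → α → Prog β) (t' : ℕ) : ∀ (t : ℕ) (P : V → Prog α),
    (∀ v, (P v).HasDuration t) →
    exec G (t + t') (fun v => (P v).bind (F v)) =
      (exec G t P).bind fun Q => exec G t' fun v => (Q v).bind (F v)
  | 0, P, _ => by
    rw [zero_add, exec_settle]
    simp only [exec, Prog.settle_bind (P _)]
    rw [indep_bind, PMF.bind_bind]
    congr 1
    funext Q
    rw [← exec_settle]
  | t + 1, P, hP => by
    rw [exec_settle]
    simp only [exec, Prog.settle_bind (P _)]
    rw [indep_bind, PMF.bind_bind, PMF.bind_bind]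
    refine bind_congr_support fun Q hQ => ?_
    rw [← exec_settle]
    have h := fun v => (hP v).settle_succ (Q v) (mem_support_of_indep hQ v)
    choose x k hk hd using h
    obtain rfl : Q = fun v => Prog.step (x v) (k v) := funext hk
    simp only [Prog.bind, resume_step]
    rw [show t + 1 + t' = (t + t') + 1 by omega, exec_step,
      ← exec_bind F t' t _ fun v => hd v _]

/-- No fixed duration is needed here, since relabelling outputs affects neither coins nor
transmissions. This matters for the loop of Selections, which may stop early. -/
theorem exec_map (f : V → α → β) : ∀ (t : ℕ) (P : V → Prog α),
    exec G t (fun v => (P v).bind fun a => Prog.done (f v a)) =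
      (exec G t P).map fun Q v => (Q v).bind fun a => Prog.done (f v a) := by
  have h0 : ∀ (v : V) (P : Prog α), (P.bind fun a => Prog.done (f v a)).settle =
      P.settle.map fun Q => Q.bind fun a => Prog.done (f v a) := by
    intro v P
    induction P with
    | done a => simp [Prog.bind, Prog.settle, PMF.pure_map]
    | coin p hp k ih => simp [Prog.bind, Prog.settle, PMF.map_bind, ih]
    | step x k ih => simp [Prog.bind, Prog.settle, PMF.pure_map]
  intro t
  induction t with
  | zero => intro P; simp only [exec, h0, indep_map]
  | succ t ih =>
    intro P
    simp only [exec, h0, indep_map, PMF.bind_map, PMF.map_bind]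
    congr 1
    funext Q
    simp only [Function.comp]
    rw [← ih]
    have hs : ∀ v, ((Q v).bind fun a => Prog.done (f v a)).sends = (Q v).sends := fun v => by
      cases Q v <;> rfl
    simp only [hs]
    congr 1
    funext v
    cases h : Q v with
    | done a => rfl
    | coin p hp k => rfl
    | step x k => cases x <;> rfl

/-! ### Expected value of the outputs -/

/-- The expectation of `φ` at the outputs after `t` time steps, an unfinished execution
counting `1`. -/
noncomputable def expect (t : ℕ) (P : V → Prog α) (φ : (V → α) → ℝ≥0∞) : ℝ≥0∞ :=
  mean (exec G t P) (outcomeValue φ)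

theorem expect_done (t : ℕ) (a : V → α) (φ : (V → α) → ℝ≥0∞) :
    expect G t (fun v => Prog.done (a v)) φ = φ a := by
  rw [expect, exec_done, mean_pure]
  exact outcomeValue_eq φ fun v => rfl

theorem expect_coin (t : ℕ) (p : V → ℝ≥0) (hp : ∀ v, p v ≤ 1) (k : V → Bool → Prog α)
    (φ : (V → α) → ℝ≥0∞) :
    expect G t (fun v => Prog.coin (p v) (hp v) (k v)) φ =
      mean (indep fun v => coinPMF (p v) (hp v)) fun b => expect G t (fun v => k v (b v)) φ := by
  rw [expect, exec_coin, mean_bind]; rfl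

theorem expect_step (t : ℕ) (x : V → Option Bits) (k : V → Option Bits → Prog α)
    (φ : (V → α) → ℝ≥0∞) :
    expect G (t + 1) (fun v => Prog.step (x v) (k v)) φ =
      expect G t (fun v => k v (received G x v)) φ := by
  rw [expect, exec_step]; rfl

theorem finished_of_hasDuration : ∀ {t : ℕ} {P : V → Prog α}, (∀ v, (P v).HasDuration t) →
    ∀ Q ∈ (exec G t P).support, ∃ a : V → α, Q = fun v => Prog.done (a v)
  | 0, P, hP, Q, hQ => by
    have h := fun v => (hP v).settle_zero (Q v) (mem_support_of_indep hQ v)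
    choose a ha using h
    exact ⟨a, funext ha⟩
  | t + 1, P, hP, Q, hQ => by
    obtain ⟨R, hR, hQ⟩ := (PMF.mem_support_bind_iff _ _ _).1 hQ
    have h := fun v => (hP v).settle_succ (R v) (mem_support_of_indep hR v)
    choose x k hk hd using h
    obtain rfl : R = fun v => Prog.step (x v) (k v) := funext hk
    simp only [resume_step] at hQ
    exact finished_of_hasDuration (fun v => hd v _) Q hQ

theorem expect_bind {t t' : ℕ} {P : V → Prog α} (F : V → α → Prog β)
    (hP : ∀ v, (P v).HasDuration t) (φ : (V → β) → ℝ≥0∞) :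
    expect G (t + t') (fun v => (P v).bind (F v)) φ =
      expect G t P fun a => expect G t' (fun v => F v (a v)) φ := by
  rw [expect, exec_bind G F t' t P hP, mean_bind, expect]
  refine mean_congr_support fun Q hQ => ?_
  obtain ⟨a, rfl⟩ := finished_of_hasDuration G hP Q hQ
  rw [outcomeValue_eq _ (a := a) fun v => rfl]
  rfl

theorem expect_map (t : ℕ) (P : V → Prog α) (f : V → α → β) (φ : (V → β) → ℝ≥0∞) :
    expect G t (fun v => (P v).bind fun a => Prog.done (f v a)) φ =
      expect G t P fun a => φ fun v => f v (a v) := by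
  rw [expect, exec_map, mean_map, expect]
  congr 1
  funext Q
  by_cases h : ∃ a : V → α, ∀ v, (Q v).output = some (a v)
  · obtain ⟨a, ha⟩ := h
    rw [outcomeValue_eq _ ha]
    refine outcomeValue_eq _ (a := fun v => f v (a v)) fun v => ?_
    have := ha v
    cases hQ : Q v with
    | done b =>
      rw [hQ] at this
      simp only [Prog.output, Option.some.injEq] at this
      simp [Prog.bind, Prog.output, this]
    | coin p hp k => rw [hQ] at this; cases this
    | step x k => rw [hQ] at this; cases this
  · rw [outcomeValue, outcomeValue, dif_neg h, dif_neg]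
    rintro ⟨b, hb⟩
    suffices hs : ∀ v, ∃ a, (Q v).output = some a by
      choose a ha using hs
      exact h ⟨a, ha⟩
    intro v
    have := hb v
    cases hQ : Q v with
    | done a => exact ⟨a, rfl⟩
    | coin p hp k => rw [hQ] at this; cases this
    | step x k => rw [hQ] at this; cases this

theorem expect_mono {t : ℕ} {P : V → Prog α} {φ ψ : (V → α) → ℝ≥0∞} (h : ∀ a, φ a ≤ ψ a) :
    expect G t P φ ≤ expect G t P ψ := by
  refine mean_mono fun Q => ?_
  unfold outcomeValue
  split_ifs
  · exact h _
  · exact le_rfl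

theorem expect_le_one {t : ℕ} {P : V → Prog α} {φ : (V → α) → ℝ≥0∞} (h : ∀ a, φ a ≤ 1) :
    expect G t P φ ≤ 1 := by
  refine mean_le_of_le fun Q => ?_
  unfold outcomeValue
  split_ifs
  · exact h _
  · exact le_rfl

theorem expect_add_le (t : ℕ) (P : V → Prog α) (φ ψ : (V → α) → ℝ≥0∞) :
    expect G t P (fun a => φ a + ψ a) ≤ expect G t P φ + expect G t P ψ := by
  rw [expect, expect, expect, ← mean_add]
  refine mean_mono fun Q => ?_
  unfold outcomeValue
  split_ifs
  · exact le_rfl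
  · exact le_self_add

/-- A run that always finishes never meets the default value `1` of `outcomeValue`, so `expect` is a
genuine mean and hence linear. In general it is only subadditive, because the default is counted
once for each summand. -/
theorem expect_eq_mean_of_hasDuration {t : ℕ} {P : V → Prog α} (hP : ∀ v, (P v).HasDuration t) :
    ∃ p : PMF (V → α), ∀ φ, expect G t P φ = mean p φ := by
  classical
  rcases isEmpty_or_nonempty (V → α) with hE | ⟨⟨a₀⟩⟩
  · obtain ⟨Q, hQ⟩ := (exec G t P).support_nonempty
    obtain ⟨a, -⟩ := finished_of_hasDuration G hP Q hQ
    exact hE.elim a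
  · refine ⟨(exec G t P).map fun Q => if h : ∃ a : V → α, ∀ v, (Q v).output = some (a v)
      then h.choose else a₀, fun φ => ?_⟩
    rw [mean_map, expect]
    refine mean_congr_support fun Q hQ => ?_
    obtain ⟨a, rfl⟩ := finished_of_hasDuration G hP Q hQ
    have hex : ∃ b : V → α, ∀ v, ((Prog.done (a v)).output) = some (b v) := ⟨a, fun v => rfl⟩
    rw [dif_pos hex, outcomeValue, dif_pos hex]

theorem expect_const_mul {t : ℕ} {P : V → Prog α} (hP : ∀ v, (P v).HasDuration t) (c : ℝ≥0∞)
    (φ : (V → α) → ℝ≥0∞) :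
    expect G t P (fun a => c * φ a) = c * expect G t P φ := by
  obtain ⟨p, hp⟩ := expect_eq_mean_of_hasDuration G hP
  simp only [hp, mean_const_mul]

theorem expect_const {t : ℕ} {P : V → Prog α} (hP : ∀ v, (P v).HasDuration t) (c : ℝ≥0∞) :
    expect G t P (fun _ => c) = c := by
  obtain ⟨p, hp⟩ := expect_eq_mean_of_hasDuration G hP
  simp only [hp, mean_const]

open Classical in
/-- The probability that some node does not stop within `t` time steps or that the outputs violate
`E`. -/
noncomputable def failure (t : ℕ) (P : V → Prog α) (E : (V → α) → Prop) : ℝ≥0∞ :=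
  expect G t P fun a => if E a then 0 else 1

theorem failure_le_one (t : ℕ) (P : V → Prog α) (E : (V → α) → Prop) : failure G t P E ≤ 1 :=
  expect_le_one G fun a => by split_ifs <;> simp

/-- An unfinished run counts `1` in `outcomeValue` precisely in order that failure be the complement
of `prob`. -/
theorem prob_add_failure (t : ℕ) (P : V → Prog α) (E : (V → α) → Prop) :
    prob G t P E + failure G t P E = 1 := by
  classical
  rw [prob, PMF.toOuterMeasure_apply, failure, expect, mean, ← ENNReal.tsum_add,
    ← (exec G t P).tsum_coe]
  refine tsum_congr fun Q => ?_
  by_cases h : ∃ a : V → α, ∀ v, (Q v).output = some (a v)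
  · obtain ⟨a, ha⟩ := h
    rw [outcomeValue_eq _ ha]
    have hiff : (Q ∈ {Q : V → Prog α | ∃ a : V → α, (∀ v, (Q v).output = some (a v)) ∧ E a}) ↔
        E a := by
      constructor
      · rintro ⟨b, hb, hE⟩
        obtain rfl : b = a := funext fun v =>
          Option.some_injective _ ((hb v).symm.trans (ha v))
        exact hE
      · exact fun hE => ⟨a, ha, hE⟩
    by_cases hE : E a
    · rw [Set.indicator_of_mem (hiff.2 hE)]; simp [hE]
    · rw [Set.indicator_of_notMem (fun h => hE (hiff.1 h))]; simp [hE]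
  · rw [outcomeValue, dif_neg h, Set.indicator_of_notMem]
    · simp
    · rintro ⟨a, ha, _⟩
      exact h ⟨a, ha⟩

theorem le_prob_of_failure_le {t : ℕ} {P : V → Prog α} {E : (V → α) → Prop} {x : ℝ}
    (hx : 0 ≤ x) (h : failure G t P E ≤ ENNReal.ofReal x) :
    ENNReal.ofReal (1 - x) ≤ prob G t P E := by
  rw [ENNReal.ofReal_sub _ hx, ENNReal.ofReal_one, tsub_le_iff_right, ← prob_add_failure G t P E]
  gcongr

theorem failure_mono {t : ℕ} {P : V → Prog α} {A B : (V → α) → Prop} (h : ∀ a, A a → B a) :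
    failure G t P B ≤ failure G t P A := by
  classical
  refine expect_mono G fun a => ?_
  split_ifs with h1 h2 h2 <;> first | exact (h1 (h a h2)).elim | simp

theorem expect_le_failure_add {t : ℕ} {P : V → Prog α} {A : (V → α) → Prop}
    {φ ψ : (V → α) → ℝ≥0∞} (h1 : ∀ a, φ a ≤ 1) (h : ∀ a, A a → φ a ≤ ψ a) :
    expect G t P φ ≤ failure G t P A + expect G t P ψ := by
  classical
  refine le_trans (expect_mono G fun a => ?_) (expect_add_le G t P _ _)
  split_ifs with hA
  · simpa using h a hA
  · exact (h1 a).trans le_self_add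

theorem failure_and {t : ℕ} {P : V → Prog α} {A B : (V → α) → Prop} :
    failure G t P (fun a => A a ∧ B a) ≤ failure G t P A + failure G t P B := by
  classical
  refine expect_le_failure_add G (fun a => by split_ifs <;> simp) fun a ha => ?_
  simp [ha]

theorem failure_bind {t t' : ℕ} {P : V → Prog α} {F : V → α → Prog β}
    (hP : ∀ v, (P v).HasDuration t) {A : (V → α) → Prop} {E : (V → β) → Prop} {ε ε' : ℝ≥0∞}
    (h : failure G t P A ≤ ε) (hF : ∀ a, A a → failure G t' (fun v => F v (a v)) E ≤ ε') :
    failure G (t + t') (fun v => (P v).bind (F v)) E ≤ ε + ε' := by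
  rw [failure, expect_bind G F hP]
  refine (expect_le_failure_add G (A := A) (ψ := fun _ => ε')
    (fun a => failure_le_one G t' _ E) hF).trans ?_
  rw [expect_const G hP]
  gcongr

/-- Errors add up in `failure_bind`; here they multiply, because success in the first stage already
decides the outcome and so both stages have to fail. -/
theorem failure_bind_mul {t t' : ℕ} {P : V → Prog α} {F : V → α → Prog β}
    (hP : ∀ v, (P v).HasDuration t) {A : (V → α) → Prop} {E : (V → β) → Prop} {ε ε' : ℝ≥0∞}
    (h : failure G t P A ≤ ε) (hA : ∀ a, A a → failure G t' (fun v => F v (a v)) E = 0)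
    (hF : ∀ a, ¬ A a → failure G t' (fun v => F v (a v)) E ≤ ε') :
    failure G (t + t') (fun v => (P v).bind (F v)) E ≤ ε * ε' := by
  classical
  rw [failure, expect_bind G F hP]
  have hpt : ∀ a, failure G t' (fun v => F v (a v)) E ≤ ε' * (if A a then 0 else 1) := by
    intro a
    split_ifs with h1
    · exact (hA a h1).le.trans bot_le
    · simpa using hF a h1
  refine (expect_mono G hpt).trans ?_
  rw [expect_const_mul G hP, mul_comm]
  refine mul_le_mul_left (le_trans (expect_mono G fun a => ?_) h) _
  split_ifs <;> simp

theorem failure_done {t : ℕ} {a : V → α} {E : (V → α) → Prop} (h : E a) :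
    failure G t (fun v => Prog.done (a v)) E = 0 := by
  rw [failure, expect_done, if_pos h]

/-- A union bound over the passes of a loop with invariant `E`; with `ε = 0` the invariant holds
almost surely. -/
theorem failure_foldlM {ι : Type} {f : V → α → ι → Prog α} {d : ℕ}
    (hf : ∀ v a i, (f v a i).HasDuration d) {ε : ℝ≥0∞} {E : (V → α) → Prop}
    (l : List ι) (hstep : ∀ i ∈ l, ∀ a, E a → failure G d (fun v => f v (a v) i) E ≤ ε) :
    ∀ a, E a → failure G (l.length * d) (fun v => l.foldlM (f v) (a v)) E ≤ l.length * ε := by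
  induction l with
  | nil => intro a ha; simp [Prog.monad_pure_eq, failure_done G ha]
  | cons i l ih =>
    intro a ha
    simp only [List.foldlM_cons, Prog.monad_bind_eq, List.length_cons]
    rw [Nat.succ_mul, add_comm]
    refine (failure_bind G (fun v => hf v (a v) i) (hstep i (by simp) a ha)
      (ih fun j hj => hstep j (by simp [hj]))).trans (le_of_eq ?_)
    push_cast
    ring

end Exec

/-! ### Exactly one of many coins -/

section ExactlyOne

variable {V : Type} [Fintype V]

/-- Bernoulli's inequality is applied to half of the exponent, where it still gives 1/2 because `k *
q ≤ 1`. Squaring gives 1/4, and twice the rounded half is at least `k - 1`. -/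
theorem le_mul_one_sub_pow {k : ℕ} {q : ℝ≥0} (hq : q ≤ 1) (h1 : 1 / 2 ≤ k * q) (h2 : k * q ≤ 1) :
    1 / 8 ≤ k * (q * (1 - q) ^ (k - 1)) := by
  have h1' : (1 / 2 : ℝ) ≤ k * (q : ℝ) := by exact_mod_cast h1
  have h2' : k * (q : ℝ) ≤ 1 := by exact_mod_cast h2
  have hq' : (q : ℝ) ≤ 1 := by exact_mod_cast hq
  have hq0 : (0 : ℝ) ≤ q := q.2
  rw [← NNReal.coe_le_coe]
  push_cast [NNReal.coe_sub hq]
  have hb : (1 / 2 : ℝ) ≤ (1 - (q : ℝ)) ^ (k / 2) := by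
    have h := one_add_mul_le_pow (a := -(q : ℝ)) (by linarith) (k / 2)
    have hk : ((k / 2 : ℕ) : ℝ) ≤ k / 2 := Nat.cast_div_le
    have : ((k / 2 : ℕ) : ℝ) * q ≤ k / 2 * q := mul_le_mul_of_nonneg_right hk hq0
    rw [← sub_eq_add_neg] at h
    linarith
  have hc : (1 / 4 : ℝ) ≤ (1 - (q : ℝ)) ^ (k - 1) := by
    calc (1 / 4 : ℝ) ≤ ((1 - (q : ℝ)) ^ (k / 2)) ^ 2 := by nlinarith
      _ = (1 - (q : ℝ)) ^ (k / 2 * 2) := by rw [pow_mul]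
      _ ≤ (1 - (q : ℝ)) ^ (k - 1) :=
        pow_le_pow_of_le_one (by linarith) (by linarith) (by omega)
  calc (1 / 8 : ℝ) = 1 / 2 * (1 / 4) := by norm_num
    _ ≤ (k * (q : ℝ)) * (1 - (q : ℝ)) ^ (k - 1) :=
      mul_le_mul h1' hc (by norm_num) (by linarith)
    _ = _ := by ring

open Classical in
/-- If the expected number of heads among the coins in `A` is between `1/2` and `1`, then with
probability at least `1/8` there is exactly one. -/
theorem mean_not_existsUnique_le (A : Finset V) {q : ℝ≥0} (hq : q ≤ 1)
    (h1 : 1 / 2 ≤ A.card * q) (h2 : A.card * q ≤ 1) :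
    mean (indep fun _ : V => coinPMF q hq)
      (fun b => if ∃! u, u ∈ A ∧ b u = true then 0 else 1) ≤ 7 / 8 := by
  set p := indep fun _ : V => coinPMF q hq
  have hsum : mean p (fun b => if ∃! u, u ∈ A ∧ b u = true then 0 else 1) +
      mean p (fun b => if ∃! u, u ∈ A ∧ b u = true then 1 else 0) = 1 := by
    rw [← mean_add]
    calc _ = mean p (fun _ => 1) := by
          congr 1; funext b; split_ifs <;> simp
      _ = 1 := mean_const _ _
  have hlow : (1 / 8 : ℝ≥0∞) ≤
      mean p (fun b => if ∃! u, u ∈ A ∧ b u = true then 1 else 0) := by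
    -- The product of `f u w` over `w ∈ A` is the indicator of `u` being the only head in `A`. These
    -- events are disjoint, and each one factorises over the independent coins.
    let f : V → V → Bool → ℝ≥0∞ := fun u w c => if c = decide (w = u) then 1 else 0
    have hpt : ∀ b : V → Bool, ∑ u ∈ A, ∏ w ∈ A, f u w (b w) ≤
        if ∃! u, u ∈ A ∧ b u = true then 1 else 0 := by
      intro b
      have hz : ∀ u ∈ A, (∏ w ∈ A, f u w (b w)) ≠ 0 → ∀ w ∈ A, b w = decide (w = u) := by
        intro u _ hne w hw
        have := Finset.prod_ne_zero_iff.1 hne w hw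
        by_contra hc
        simp [f, hc] at this
      split_ifs with hE
      · obtain ⟨u, ⟨huA, hub⟩, huu⟩ := hE
        rw [Finset.sum_eq_single_of_mem u huA]
        · refine Finset.prod_le_one' fun w _ => ?_
          simp only [f]; split_ifs <;> simp
        · intro u' hu' hne
          by_contra hc
          have := hz u' hu' hc u huA
          rw [hub] at this
          exact hne (by simpa using this.symm : u = u').symm
      · refine (Finset.sum_eq_zero fun u hu => ?_).le
        by_contra hc
        have h := hz u hu hc
        refine hE ⟨u, ⟨hu, by simp [h u hu]⟩, fun w hw => ?_⟩
        have := h w hw.1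
        rw [hw.2] at this
        simpa using this.symm
    refine le_trans ?_ (mean_mono hpt)
    rw [mean_finset_sum]
    have hterm : ∀ u ∈ A, mean p (fun b => ∏ w ∈ A, f u w (b w)) =
        ((q * (1 - q) ^ (A.card - 1) : ℝ≥0) : ℝ≥0∞) := by
      intro u hu
      rw [mean_indep_prod_finset, ← Finset.mul_prod_erase A _ hu]
      have h3 : mean (coinPMF q hq) (f u u) = q := by simp [mean_coin, f]
      have h4 : ∀ w ∈ A.erase u, mean (coinPMF q hq) (f u w) = ((1 - q : ℝ≥0) : ℝ≥0∞) := by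
        intro w hw
        simp [mean_coin, f, (Finset.mem_erase.1 hw).1]
      rw [h3, Finset.prod_congr rfl h4, Finset.prod_const, Finset.card_erase_of_mem hu]
      push_cast
      rfl
    rw [Finset.sum_congr rfl hterm, Finset.sum_const, nsmul_eq_mul]
    have := le_mul_one_sub_pow hq h1 h2
    calc (1 / 8 : ℝ≥0∞) = ((1 / 8 : ℝ≥0) : ℝ≥0∞) := by
          rw [ENNReal.coe_div (by norm_num)]; rfl
      _ ≤ ((A.card * (q * (1 - q) ^ (A.card - 1)) : ℝ≥0) : ℝ≥0∞) := by exact_mod_cast this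
      _ = _ := by push_cast; rfl
  have h78 : (7 / 8 : ℝ≥0∞) + 1 / 8 = 1 := by
    rw [ENNReal.div_add_div_same]
    norm_num
    exact ENNReal.div_self (by norm_num) (by norm_num)
  refine (ENNReal.add_le_add_iff_right (a := 1 / 8) (by simp)).1 ?_
  exact ((add_le_add_right hlow _).trans hsum.le).trans h78.ge

/-- For `j = Nat.clog 2 k` the power `2 ^ j` lies between `k` and `2 * k`. The second alternative
serves Decay, whose first transmission probability is 1/2 and not 1, in the case of a single
participant. -/
theorem half_le_card_mul {k : ℕ} (hk : 0 < k) {j : ℕ} (hj : j = Nat.clog 2 k ∨ k = 1 ∧ j = 1) :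
    (1 / 2 : ℝ≥0) ≤ k * (2 : ℝ≥0)⁻¹ ^ j ∧ k * (2 : ℝ≥0)⁻¹ ^ j ≤ 1 := by
  rcases hj with rfl | ⟨rfl, rfl⟩
  · have hp : (0 : ℝ≥0) < 2 ^ Nat.clog 2 k := by positivity
    rw [inv_pow, ← div_eq_mul_inv]
    constructor
    · rw [div_le_div_iff₀ (by norm_num) hp]
      rcases Nat.lt_or_ge 1 k with h | h
      · have h1 : 2 ^ (Nat.clog 2 k - 1) < k := by
          simpa using Nat.pow_pred_clog_lt_self (by norm_num) h
        have h2 : 1 ≤ Nat.clog 2 k := Nat.clog_pos (by norm_num) h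
        have h3 : 2 ^ Nat.clog 2 k = 2 * 2 ^ (Nat.clog 2 k - 1) := by
          rw [← pow_succ']; congr 1; omega
        have h4 : 1 * 2 ^ Nat.clog 2 k ≤ k * 2 := by omega
        exact_mod_cast h4
      · obtain rfl : k = 1 := by omega
        simp
    · rw [div_le_one hp]
      exact_mod_cast Nat.le_pow_clog (by norm_num) k
  · norm_num

end ExactlyOne

/-! ### Receiving -/

section Heard

variable {V : Type} (G : Digraph V)

theorem heard_eq_of_unique {x : V → Option Bits} {u v : V} (huv : G.Adj u v) (hu : x u ≠ none)
    (h : ∀ w, G.Adj w v → x w ≠ none → w = u) : heard G x v = x u := by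
  have hex : ∃! u, G.Adj u v ∧ x u ≠ none := ⟨u, ⟨huv, hu⟩, fun w hw => h w hw.1 hw.2⟩
  rw [heard, dif_pos hex]
  rw [h _ hex.choose_spec.1.1 hex.choose_spec.1.2]

theorem exists_of_heard {x : V → Option Bits} {v : V} {y : Bits} (h : heard G x v = some y) :
    ∃ u, G.Adj u v ∧ x u = some y := by
  unfold heard at h
  split_ifs at h with hex
  exact ⟨_, hex.choose_spec.1.1, h⟩

theorem exists_of_received {x : V → Option Bits} {v : V} {y : Bits}
    (h : received G x v = some y) : ∃ u, G.Adj u v ∧ x u = some y := by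
  unfold received at h
  split_ifs at h
  exact exists_of_heard G h

/-- A walk that begins in `P` and ends outside has to leave `P` along some edge. This is used for
bits that change along a walk and for the growth of balls. -/
theorem exists_edge_of_reachIn {P : V → Prop} {u : V} (hu : P u) :
    ∀ {k : ℕ} {v : V}, ReachIn G k u v → ¬ P v → ∃ a b, P a ∧ ¬ P b ∧ G.Adj a b
  | 0, v, h, hv => by cases h; exact (hv hu).elim
  | k + 1, v, ⟨w, hw, hwv⟩, hv => by
    by_cases hP : P w
    · exact ⟨w, v, hP, hv, hwv⟩
    · exact exists_edge_of_reachIn hu hw hP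

end Heard

/-! ### Decay -/

/-- The `i`-th time step of a round of Decay. -/
noncomputable def decayStep (x : Option Bits) (got : List Bits) (i : ℕ) : Prog (List Bits) := do
  let b ← Prog.flip ((2 : ℝ≥0)⁻¹ ^ (i + 1))
  let r ← Prog.act (if b then x else none)
  pure (got ++ r.toList)

theorem decay_eq (n : ℕ) (x : Option Bits) :
    decay n x = (List.range (lg n)).foldlM (decayStep x) [] := rfl

theorem hasDuration_decayStep (x : Option Bits) (got : List Bits) (i : ℕ) :
    (decayStep x got i).HasDuration 1 := fun _ => ⟨0, rfl, fun _ => rfl⟩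

theorem hasDuration_decay (n : ℕ) (x : Option Bits) : (decay n x).HasDuration (lg n) := by
  simpa [decay_eq] using
    Prog.hasDuration_foldlM (decayStep x) (List.range (lg n)) (hasDuration_decayStep x) []

theorem hasDuration_decay4 (n : ℕ) (x : Option Bits) : (decay4 n x).HasDuration (4 * lg n) := by
  have h := hasDuration_decay n x
  have := h.bind fun r₁ => h.bind fun r₂ => h.bind fun r₃ => h.bind fun r₄ =>
    Prog.hasDuration_done (r₁ ++ r₂ ++ r₃ ++ r₄)
  rw [show 4 * lg n = lg n + (lg n + (lg n + (lg n + 0))) by ring]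
  exact this

section Decay

variable {V : Type} [Fintype V] (G : Digraph V)

theorem expect_decayStep (x : V → Option Bits) (got : V → List Bits) (i : ℕ)
    (φ : (V → List Bits) → ℝ≥0∞) :
    expect G 1 (fun v => decayStep (x v) (got v) i) φ =
      mean (indep fun _ : V => coinPMF (min 1 ((2 : ℝ≥0)⁻¹ ^ (i + 1))) (min_le_left _ _)) fun b =>
        φ fun v => got v ++ (received G (fun u => if b u then x u else none) v).toList := by
  change expect G 1 (fun v => Prog.coin _ _ fun b => Prog.step (if b then x v else none) fun r =>
    Prog.done (got v ++ r.toList)) φ = _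
  rw [expect_coin]
  congr 1
  funext b
  rw [expect_step, expect_done]

/-- Every received string was sent by an in-neighbour. -/
def ReceivedFrom (G : Digraph V) (x : V → Option Bits) (got : V → List Bits) : Prop :=
  ∀ v, ∀ y ∈ got v, ∃ u, G.Adj u v ∧ x u = some y

theorem failure_decay_receivedFrom (n : ℕ) (x : V → Option Bits) :
    failure G (lg n) (fun v => decay n (x v)) (ReceivedFrom G x) = 0 := by
  classical
  have h := failure_foldlM G (f := fun v => decayStep (x v)) (ε := 0) (E := ReceivedFrom G x)
    (fun v => hasDuration_decayStep (x v)) (List.range (lg n)) (fun i _ a ha => ?_)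
    (fun _ => []) (fun v y hy => by simp at hy)
  · simpa [← decay_eq] using h
  · rw [failure, expect_decayStep]
    refine mean_le_of_le fun b => ?_
    rw [if_pos]
    intro v y hy
    rcases List.mem_append.1 hy with hy | hy
    · exact ha v y hy
    · rw [Option.mem_toList] at hy
      obtain ⟨u, huv, hu⟩ := exists_of_received G hy
      refine ⟨u, huv, ?_⟩
      split_ifs at hu
      exact hu

open Classical in
-- Since `v` takes no part it listens, and a single head among its participating in-neighbours gets
-- through. The hypotheses place the expected number of heads in the range of
-- `mean_not_existsUnique_le`.
theorem expect_decayStep_nil_le (x : V → Option Bits) {v : V} (hv : x v = none)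
    (got : V → List Bits) {i : ℕ}
    (h1 : 1 / 2 ≤ (Finset.univ.filter fun u => G.Adj u v ∧ x u ≠ none).card *
      (2 : ℝ≥0)⁻¹ ^ (i + 1))
    (h2 : (Finset.univ.filter fun u => G.Adj u v ∧ x u ≠ none).card * (2 : ℝ≥0)⁻¹ ^ (i + 1) ≤ 1) :
    expect G 1 (fun v => decayStep (x v) (got v) i) (fun r => if r v = [] then 1 else 0) ≤
      7 / 8 := by
  have hq : min 1 ((2 : ℝ≥0)⁻¹ ^ (i + 1)) = (2 : ℝ≥0)⁻¹ ^ (i + 1) :=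
    min_eq_right (pow_le_one₀ (by simp) (by norm_num))
  rw [expect_decayStep]
  refine le_trans (mean_mono fun b => ?_) (mean_not_existsUnique_le
    (Finset.univ.filter fun u => G.Adj u v ∧ x u ≠ none) (min_le_left 1 _)
    (by rw [hq]; exact h1) (by rw [hq]; exact h2))
  split_ifs with h3 h4 <;> try simp
  obtain ⟨u, ⟨huA, hub⟩, huu⟩ := h4
  simp only [Finset.mem_filter, Finset.mem_univ, true_and] at huA huu
  have hh : heard G (fun u => if b u then x u else none) v = x u := by
    have := heard_eq_of_unique G (x := fun u => if b u then x u else none) huA.1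
      (by simpa [hub] using huA.2) fun w hw hwx => huu w (by
        by_cases hb : b w = true
        · exact ⟨⟨hw, by simpa [hb] using hwx⟩, hb⟩
        · simp [hb] at hwx)
    simpa [hub] using this
  obtain ⟨y, hy⟩ := Option.ne_none_iff_exists'.1 huA.2
  simp [received, hv, hh, hy] at h3

open Classical in
theorem expect_foldlM_decayStep_nil (x : V → Option Bits) (v : V) (l : List ℕ) :
    ∀ got : V → List Bits, expect G (l.length * 1) (fun v => l.foldlM (decayStep (x v)) (got v))
      (fun r => if r v = [] then 1 else 0) ≤ if got v = [] then 1 else 0 := by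
  intro got
  by_cases h : got v = []
  · rw [if_pos h]
    exact expect_le_one G fun r => by split_ifs <;> simp
  · have := failure_foldlM G (f := fun v => decayStep (x v)) (ε := 0) (E := fun r => r v ≠ [])
      (fun v => hasDuration_decayStep (x v)) l (fun i _ a ha => ?_) got h
    · rw [mul_zero] at this
      rw [if_neg h]
      refine le_trans (expect_mono G fun r => ?_) this
      by_cases hr : r v = [] <;> simp [hr]
    · rw [failure, expect_decayStep]
      refine mean_le_of_le fun b => ?_
      rw [if_pos]
      simp [ha]

open Classical in
-- One step of the round has a transmission probability that fits the number of participating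
-- in-neighbours. The steps before it do no harm, and those after it cannot lose what was received.
theorem expect_decay_nil_le (n : ℕ) (hn : Fintype.card V = n) (x : V → Option Bits) {u v : V}
    (huv : G.Adj u v) (hv : x v = none) (hu : x u ≠ none) :
    expect G (lg n) (fun v => decay n (x v)) (fun r => if r v = [] then 1 else 0) ≤ 7 / 8 := by
  set A := Finset.univ.filter fun u => G.Adj u v ∧ x u ≠ none with hA
  have hApos : 0 < A.card := Finset.card_pos.2 ⟨u, by simp [hA, huv, hu]⟩
  have hAn : A.card ≤ n := hn ▸ Finset.card_le_univ A
  have hn2 : 2 ≤ n := by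
    have huv' : u ≠ v := fun h => hu (h ▸ hv)
    rw [← hn]
    exact Fintype.one_lt_card_iff.2 ⟨u, v, huv'⟩
  have hlg : 1 ≤ lg n := Nat.clog_pos (by norm_num) hn2
  obtain ⟨i, hi, hi1, hi2⟩ : ∃ i ∈ List.range (lg n), (1 / 2 : ℝ≥0) ≤ A.card * (2 : ℝ≥0)⁻¹ ^ (i + 1)
      ∧ A.card * (2 : ℝ≥0)⁻¹ ^ (i + 1) ≤ 1 := by
    rcases Nat.lt_or_ge 1 A.card with h | h
    · have hc : 1 ≤ Nat.clog 2 A.card := Nat.clog_pos (by norm_num) h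
      have hc' : Nat.clog 2 A.card ≤ lg n := Nat.clog_mono_right 2 hAn
      exact ⟨Nat.clog 2 A.card - 1, by simp; omega, half_le_card_mul hApos (Or.inl (by omega))⟩
    · exact ⟨0, by simp; omega, half_le_card_mul hApos (Or.inr ⟨by omega, rfl⟩)⟩
  have key : ∀ l : List ℕ, i ∈ l → ∀ got : V → List Bits,
      expect G (l.length * 1) (fun v => l.foldlM (decayStep (x v)) (got v))
        (fun r => if r v = [] then 1 else 0) ≤ 7 / 8 := by
    intro l
    induction l with
    | nil => simp
    | cons j l ih =>
      intro hmem got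
      simp only [List.foldlM_cons, Prog.monad_bind_eq, List.length_cons]
      rw [Nat.succ_mul, add_comm, expect_bind G _ fun v => hasDuration_decayStep _ _ _]
      rcases List.mem_cons.1 hmem with rfl | hmem
      · exact (expect_mono G fun a => expect_foldlM_decayStep_nil G x v l a).trans
          (expect_decayStep_nil_le G x hv got hi1 hi2)
      · refine (expect_mono G fun a => ih hmem a).trans ?_
        rw [expect_const G fun v => hasDuration_decayStep _ _ _]
  simpa [decay_eq] using key _ hi fun _ => []

theorem failure_decay4_receivedFrom (n : ℕ) (x : V → Option Bits) :
    failure G (4 * lg n) (fun v => decay4 n (x v)) (ReceivedFrom G x) = 0 := by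
  have hd := fun v => hasDuration_decay n (x v)
  have h0 := (failure_decay_receivedFrom G n x).le
  refine le_antisymm ?_ bot_le
  have key := failure_bind G hd (F := fun v r₁ => (decay n (x v)).bind fun r₂ =>
      (decay n (x v)).bind fun r₃ => (decay n (x v)).bind fun r₄ =>
        Prog.done (r₁ ++ r₂ ++ r₃ ++ r₄)) (E := ReceivedFrom G x)
    (t' := lg n + (lg n + (lg n + 0))) (ε' := 0 + (0 + (0 + 0))) h0 fun r₁ h₁ =>
    failure_bind G hd h0 fun r₂ h₂ => failure_bind G hd h0 fun r₃ h₃ =>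
    failure_bind G hd h0 fun r₄ h₄ => (failure_done G ?_).le
  · rw [show lg n + (lg n + (lg n + (lg n + 0))) = 4 * lg n by ring] at key
    simp only [add_zero] at key
    exact key
  · intro v y hy
    simp only [List.mem_append] at hy
    rcases hy with ((hy | hy) | hy) | hy
    exacts [h₁ v y hy, h₂ v y hy, h₃ v y hy, h₄ v y hy]

open Classical in
-- The indicator of hearing nothing factorises over the four rounds, and each round flips fresh
-- coins.
theorem expect_decay4_nil_le (n : ℕ) (hn : Fintype.card V = n) (x : V → Option Bits) {u v : V}
    (huv : G.Adj u v) (hv : x v = none) (hu : x u ≠ none) :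
    expect G (4 * lg n) (fun v => decay4 n (x v)) (fun r => if r v = [] then 1 else 0) ≤
      (7 / 8) ^ 4 := by
  have hd := fun v => hasDuration_decay n (x v)
  have h1 := expect_decay_nil_le G n hn x huv hv hu
  let Z : (V → List Bits) → ℝ≥0∞ := fun r => if r v = [] then 1 else 0
  have hmul : ∀ c φ, expect G (lg n) (fun v => decay n (x v)) (fun a => c * φ a) =
    c * expect G (lg n) (fun v => decay n (x v)) φ := expect_const_mul G hd
  have hmul' : ∀ c φ, expect G (lg n) (fun v => decay n (x v)) (fun a => φ a * c) =
    expect G (lg n) (fun v => decay n (x v)) φ * c := fun c φ => by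
    simp only [mul_comm _ c, hmul]
  rw [show 4 * lg n = lg n + (lg n + (lg n + (lg n + 0))) by ring]
  change expect G _ (fun v => (decay n (x v)).bind fun r₁ => (decay n (x v)).bind fun r₂ =>
      (decay n (x v)).bind fun r₃ => (decay n (x v)).bind fun r₄ =>
        Prog.done (r₁ ++ r₂ ++ r₃ ++ r₄)) _ ≤ _
  simp only [expect_bind G _ hd, expect_done]
  have hZ : ∀ r₁ r₂ r₃ r₄ : V → List Bits,
      (if r₁ v ++ r₂ v ++ r₃ v ++ r₄ v = [] then (1 : ℝ≥0∞) else 0) =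
        Z r₁ * (Z r₂ * (Z r₃ * Z r₄)) := by
    intro r₁ r₂ r₃ r₄
    by_cases e1 : r₁ v = [] <;> by_cases e2 : r₂ v = [] <;> by_cases e3 : r₃ v = [] <;>
      by_cases e4 : r₄ v = [] <;> simp [Z, e1, e2, e3, e4]
  simp only [hZ, hmul, hmul']
  calc _ ≤ (7 / 8 : ℝ≥0∞) * (7 / 8 * (7 / 8 * (7 / 8))) := by gcongr
    _ = _ := by ring

end Decay

/-! ### Comparing bit strings -/

/-- The probability bound for missing all positions below `l` in which `x` and `y` differ, if each
of them is missed with probability `(7/8)^4`. -/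
noncomputable def missWeight (l : ℕ) (x y : Bits) : ℝ≥0∞ :=
  ∏ i ∈ Finset.range l, if x.getD i false = y.getD i false then 1 else (7 / 8) ^ 4

theorem missWeight_self (l : ℕ) (x : Bits) : missWeight l x x = 1 := by simp [missWeight]

theorem lt_of_take_eq {x z : Bits} {i : ℕ} (hx : i < x.length) (hz : i < z.length)
    (h : x.take i = z.take i) (hxi : x.getD i false = true) (hzi : z.getD i false = false) :
    z < x := by
  rw [List.lt_iff_exists]
  refine Or.inr ⟨i, hz, hx, fun j hj => ?_, ?_⟩
  · have : (x.take i)[j]? = (z.take i)[j]? := by rw [h]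
    rw [List.getElem?_take_of_lt hj, List.getElem?_take_of_lt hj,
      List.getElem?_eq_getElem (by omega), List.getElem?_eq_getElem (by omega)] at this
    exact (Option.some_injective _ this).symm
  · rw [List.getD_eq_getElem _ _ hx] at hxi
    rw [List.getD_eq_getElem _ _ hz] at hzi
    rw [hxi, hzi]
    exact Bool.false_lt_true

theorem take_succ_eq {z : Bits} {i : ℕ} (hz : i < z.length) :
    z.take (i + 1) = z.take i ++ [z.getD i false] := by
  rw [List.take_add_one, List.getElem?_eq_getElem hz, List.getD_eq_getElem _ _ hz]
  rfl

theorem foldl_max_mem (l : List Bits) (x : Bits) : l.foldl max x = x ∨ l.foldl max x ∈ l := by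
  induction l generalizing x with
  | nil => simp
  | cons y l ih =>
    rw [List.foldl_cons]
    rcases ih (max x y) with h | h
    · rcases max_choice x y with h' | h'
      · left; rw [h, h']
      · right; rw [h, h']; simp
    · right; simp [h]

theorem le_foldl_max (l : List Bits) (x : Bits) :
    x ≤ l.foldl max x ∧ ∀ y ∈ l, y ≤ l.foldl max x := by
  induction l generalizing x with
  | nil => simp
  | cons y l ih =>
    rw [List.foldl_cons]
    obtain ⟨h1, h2⟩ := ih (max x y)
    refine ⟨(le_max_left x y).trans h1, fun w hw => ?_⟩
    rcases List.mem_cons.1 hw with rfl | hw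
    · exact (le_max_right x w).trans h1
    · exact h2 w hw

/-! ### Finding witnesses -/

/-- The treatment of bit position `i` when looking for witnesses. -/
noncomputable def witnessStep (n : ℕ) (s : Bits × Bool) (i : ℕ) : Prog (Bits × Bool) :=
  (decay4 n (if s.1.getD i false then some s.1 else none)).bind fun got => Prog.done
    (if s.1.getD i false = false ∧ got ≠ [] then (got.foldl max s.1, true) else s)

theorem findWitnesses_eq (n l : ℕ) (m : Bits) :
    findWitnesses n l m = (List.range l).foldlM (witnessStep n) (m, false) := rfl

theorem hasDuration_witnessStep (n : ℕ) (s : Bits × Bool) (i : ℕ) :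
    (witnessStep n s i).HasDuration (4 * lg n) :=
  (hasDuration_decay4 n _).bind fun _ => Prog.hasDuration_done _

theorem hasDuration_findWitnesses (n l : ℕ) (m : Bits) :
    (findWitnesses n l m).HasDuration (l * (4 * lg n)) := by
  simpa [findWitnesses_eq] using
    Prog.hasDuration_foldlM (witnessStep n) (List.range l) (hasDuration_witnessStep n) (m, false)

section Witnesses

variable {V : Type} [Fintype V] (G : Digraph V)

/-- The possible states in the search for witnesses, from the strings `m` on. -/
def WitnessInvariant (m : V → Bits) (s : V → Bits × Bool) : Prop :=
  (∀ v, ∃ u, (s v).1 = m u) ∧ (∀ v, (s v).2 = false → (s v).1 = m v) ∧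
    ∀ v, (s v).2 = true → ∃ u, m u < (s v).1

theorem failure_map {α β : Type} (t : ℕ) (P : V → Prog α) (f : V → α → β) (E : (V → β) → Prop) :
    failure G t (fun v => (P v).bind fun a => Prog.done (f v a)) E =
      failure G t P fun a => E fun v => f v (a v) :=
  expect_map G t P f _

theorem failure_witnessStep_invariant (n i : ℕ) (m : V → Bits) (s : V → Bits × Bool)
    (hs : WitnessInvariant m s) :
    failure G (4 * lg n) (fun v => witnessStep n (s v) i) (WitnessInvariant m) = 0 := by
  refine le_antisymm ?_ bot_le
  rw [← failure_decay4_receivedFrom G n fun v =>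
    if (s v).1.getD i false then some (s v).1 else none]
  simp only [witnessStep]
  rw [failure_map]
  refine failure_mono G fun got hgot => ?_
  have hrec : ∀ v, ∀ y ∈ got v, y.getD i false = true ∧ ∃ u, y = m u := by
    intro v y hy
    obtain ⟨u, -, hu⟩ := hgot v y hy
    dsimp only at hu
    split_ifs at hu with hb
    obtain rfl := Option.some_injective _ hu
    exact ⟨hb, hs.1 u⟩
  refine ⟨fun v => ?_, fun v => ?_, fun v => ?_⟩
  · dsimp only
    split_ifs with h
    · rcases foldl_max_mem (got v) (s v).1 with h' | h'
      · rw [h']; exact hs.1 v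
      · exact (hrec v _ h').2
    · exact hs.1 v
  · dsimp only
    split_ifs with h
    · simp
    · exact hs.2.1 v
  · dsimp only
    split_ifs with h
    · intro _
      obtain ⟨hbit, hne⟩ := h
      obtain ⟨y, hy⟩ := List.exists_mem_of_ne_nil _ hne
      obtain ⟨hyb, u, hu⟩ := hrec v y hy
      obtain ⟨w, hw⟩ := hs.1 v
      have hle := le_foldl_max (got v) (s v).1
      -- At position `i` the received `y` has a 1 and the old string a 0, so the two differ. The new
      -- maximum strictly exceeds the smaller of them, and both are initial strings.
      have hyne : y ≠ (s v).1 := fun h => by rw [h, hbit] at hyb; cases hyb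
      rcases lt_or_gt_of_ne hyne with h | h
      · exact ⟨u, hu ▸ h.trans_le hle.1⟩
      · exact ⟨w, hw ▸ lt_of_lt_of_le h (hle.2 y hy)⟩
    · exact hs.2.2 v

theorem failure_findWitnesses_invariant (n l : ℕ) (m : V → Bits) :
    failure G (l * (4 * lg n)) (fun v => findWitnesses n l (m v)) (WitnessInvariant m) = 0 := by
  have h := failure_foldlM G (f := fun _ => witnessStep n) (ε := 0) (E := WitnessInvariant m)
    (fun _ => hasDuration_witnessStep n) (List.range l)
    (fun i _ s hs => (failure_witnessStep_invariant G n i m s hs).le)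
    (fun v => (m v, false)) ⟨fun v => ⟨v, rfl⟩, fun v _ => rfl, fun v h => by cases h⟩
  simpa [← findWitnesses_eq] using h

theorem failure_foldlM_witnessStep_of_witness (n : ℕ) (l : List ℕ) (s : V → Bits × Bool)
    (hs : ∃ v, (s v).2 = true) :
    failure G (l.length * (4 * lg n)) (fun v => l.foldlM (witnessStep n) (s v))
      (fun s => ∃ v, (s v).2 = true) = 0 := by
  have h := failure_foldlM G (f := fun _ => witnessStep n) (ε := 0)
    (E := fun s : V → Bits × Bool => ∃ v, (s v).2 = true)
    (fun _ => hasDuration_witnessStep n) l (fun i _ s hs => ?_) s hs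
  · simpa using h
  · simp only [witnessStep]
    rw [failure_map, ← failure_decay4_receivedFrom G n fun v =>
      if (s v).1.getD i false then some (s v).1 else none]
    refine failure_mono G fun got _ => ?_
    obtain ⟨v, hv⟩ := hs
    exact ⟨v, by dsimp only; split_ifs <;> simp [hv]⟩

open Classical in
-- While there is no witness all strings are still the initial ones, so each position offers a new
-- chance. Where the strings of `u` and `v` differ, some edge leads from a node with bit 1 to a node
-- with bit 0, and its head becomes a witness unless all four rounds of Decay fail there. For no
-- witness to appear, every differing position has to be missed.
theorem failure_findWitnesses_witness (n l : ℕ) (hn : Fintype.card V = n)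
    (hG : ∀ u v, ∃ k, ReachIn G k u v) (m : V → Bits) (u v : V) :
    failure G (l * (4 * lg n)) (fun v => findWitnesses n l (m v)) (fun s => ∃ v, (s v).2 = true) ≤
      missWeight l (m u) (m v) := by
  have key : ∀ L : List ℕ,
      failure G (L.length * (4 * lg n)) (fun v => L.foldlM (witnessStep n) (m v, false))
        (fun s => ∃ v, (s v).2 = true) ≤
      (L.map fun i => if (m u).getD i false = (m v).getD i false then (1 : ℝ≥0∞)
        else (7 / 8) ^ 4).prod := by
    intro L
    induction L with
    | nil => simpa using failure_le_one G _ _ _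
    | cons i L ih =>
      simp only [List.foldlM_cons, Prog.monad_bind_eq, List.length_cons, List.map_cons,
        List.prod_cons]
      rw [Nat.succ_mul, add_comm]
      simp only [witnessStep, Prog.bind_assoc, Prog.bind]
      -- `A` says that position `i` produces a witness, which decides the matter because witnesses
      -- remain witnesses. Otherwise no state has changed, and the induction hypothesis covers the
      -- remaining positions.
      refine failure_bind_mul G (fun v => hasDuration_decay4 n _)
        (A := fun got => ∃ v, (m v).getD i false = false ∧ got v ≠ []) ?_
        (fun got hw => ?_) fun got hw => ?_
      rotate_left
      · refine failure_foldlM_witnessStep_of_witness G n L _ ?_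
        obtain ⟨v, hv⟩ := hw
        exact ⟨v, by rw [if_pos hv]⟩
      · push Not at hw
        have : ∀ v, ¬ ((m v).getD i false = false ∧ got v ≠ []) := fun v h => h.2 (hw v h.1)
        simp only [if_neg (this _)]
        exact ih
      by_cases hbit : (m u).getD i false = (m v).getD i false
      · rw [if_pos hbit]
        exact failure_le_one G _ _ _
      · rw [if_neg hbit]
        obtain ⟨a, b, ha, hb, hab⟩ : ∃ a b, (m a).getD i false = true ∧
            ¬ (m b).getD i false = true ∧ G.Adj a b := by
          -- The walk has to start at whichever of `u` and `v` has the bit 1, so connectivity is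
          -- needed in both directions.
          by_cases hu : (m u).getD i false = true
          · obtain ⟨k, hk⟩ := hG u v
            exact exists_edge_of_reachIn G (P := fun w => (m w).getD i false = true) hu hk
              fun hv => hbit (hu.trans hv.symm)
          · obtain ⟨k, hk⟩ := hG v u
            refine exists_edge_of_reachIn G (P := fun w => (m w).getD i false = true) ?_ hk hu
            by_contra hv
            simp only [Bool.not_eq_true] at hu hv
            exact hbit (hu.trans hv.symm)
        have hb' : (m b).getD i false = false := by simpa using hb
        refine le_trans (expect_mono G fun got => ?_) (expect_decay4_nil_le G n hn
          (fun v => if (m v).getD i false then some (m v) else none) hab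
          (by simp only [hb']; rfl) (by simp only [ha]; simp))
        by_cases h2 : got b = []
        · rw [if_pos h2]
          split_ifs <;> simp
        · rw [if_neg h2, if_pos ⟨b, hb', h2⟩]
  have h := key (List.range l)
  rw [List.length_range] at h
  refine h.trans (le_of_eq ?_)
  rw [missWeight, ← List.prod_toFinset _ List.nodup_range, List.toFinset_range]

end Witnesses

/-! ### Selection -/

/-- On the network `G` the procedure `B` takes its fixed time and, except with probability `ε`, it
is correct and lets every source keep its own string. -/
structure Reliable (B : MultiBroadcast) {V : Type} [Fintype V] (G : Digraph V) (n D lmax : ℕ)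
    (ε : ℝ≥0∞) : Prop where
  hasDuration : ∀ l x, (B.run n D l x).HasDuration (B.time n D)
  failure_le : ∀ l ≤ lmax, ∀ f : V → Option Bits, (∀ v, ∀ y ∈ f v, y.length = l) →
    failure G (B.time n D) (fun v => B.run n D l (f v))
      (fun m => MultiBroadcast.Correct f m ∧ ∀ v, f v ≠ none → m v = f v) ≤ ε

/-- The part of Selection after the first broadcast. -/
noncomputable def selectionTail (B : MultiBroadcast) (n D l : ℕ) :
    Option Bits → Prog (Option Bits × Bool)
  | none => (Prog.idle (l * (4 * lg n) + B.time n D)).bind fun _ => Prog.done (none, false)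
  | some m₀ => (findWitnesses n l m₀).bind fun s =>
      (B.run n D l (if s.2 then some s.1 else none)).bind fun p =>
        Prog.done (p.elim (some s.1, true) fun q => (some q, false))

theorem selection_eq (B : MultiBroadcast) (n D l : ℕ) (x : Option Bits) :
    selection B n D l x = (B.run n D l x).bind (selectionTail B n D l) := by
  unfold selection
  rw [Prog.monad_bind_eq]
  congr 1
  funext m
  cases m with
  | none => rfl
  | some m₀ =>
    change (findWitnesses n l m₀).bind _ = (findWitnesses n l m₀).bind _
    congr 1
    funext s
    change (B.run n D l _).bind _ = (B.run n D l _).bind _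
    congr 1
    funext p
    cases p <;> rfl

theorem hasDuration_selection {B : MultiBroadcast} {n D : ℕ}
    (hB : ∀ l x, (B.run n D l x).HasDuration (B.time n D)) (l : ℕ) (x : Option Bits) :
    (selection B n D l x).HasDuration (B.time n D + (l * (4 * lg n) + B.time n D)) := by
  rw [selection_eq]
  refine (hB l x).bind fun m => ?_
  cases m with
  | none => exact (Prog.hasDuration_idle _).bind fun _ => Prog.hasDuration_done _
  | some m₀ =>
    exact (hasDuration_findWitnesses n l m₀).bind fun s => (hB l _).bind fun _ =>
      Prog.hasDuration_done _

section Selection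

variable {V : Type} [Fintype V] {G : Digraph V} {B : MultiBroadcast} {n D lmax : ℕ} {ε : ℝ≥0∞}

/-- The frame common to both cases of Selection: the two broadcasts cost `ε` each and the search for
witnesses costs `δ`. In `hW` every source may be taken to start with its own ID; this is why
`Reliable` requires that sources keep their strings. -/
theorem failure_selection_le (hB : Reliable B G n D lmax ε) {l : ℕ} (hl : l ≤ lmax)
    {x : V → Option Bits} (hx : ∀ v, ∀ y ∈ x v, y.length = l) (hne : ∃ v, x v ≠ none)
    {E : (V → Option Bits × Bool) → Prop} {δ : ℝ≥0∞}
    {W : (V → Bits) → (V → Bits × Bool) → Prop}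
    (hW : ∀ m : V → Bits, (∀ v, ∃ u, x u = some (m v)) → (∀ v y, x v = some y → m v = y) →
      failure G (l * (4 * lg n)) (fun v => findWitnesses n l (m v)) (W m) ≤ δ)
    (hWE : ∀ m s p, (∀ v, ∃ u, x u = some (m v)) → W m s → WitnessInvariant m s →
      MultiBroadcast.Correct (fun v => if (s v).2 then some (s v).1 else none) p →
      E fun v => (p v).elim (some (s v).1, true) fun q => (some q, false)) :
    failure G (B.time n D + (l * (4 * lg n) + B.time n D)) (fun v => selection B n D l (x v)) E ≤
      ε + (δ + ε) := by
  simp only [selection_eq]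
  refine failure_bind G (fun v => hB.hasDuration l (x v)) (hB.failure_le l hl x hx) ?_
  rintro m' ⟨⟨-, hc⟩, hown⟩
  have hm : ∀ v, ∃ y, m' v = some y ∧ ∃ u, x u = some y := fun v => by
    obtain ⟨u, hu, hmv⟩ := hc hne v
    obtain ⟨y, hy⟩ := Option.ne_none_iff_exists'.1 hu
    exact ⟨y, hmv.trans hy, u, hy⟩
  choose m hm' hmx using hm
  obtain rfl : m' = fun v => some (m v) := funext hm'
  simp only [selectionTail]
  refine failure_bind G (fun v => hasDuration_findWitnesses n l (m v))
    (A := fun s => W m s ∧ WitnessInvariant m s) ?_ ?_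
  · refine (failure_and G).trans ?_
    rw [failure_findWitnesses_invariant, add_zero]
    refine hW m hmx fun v y hy => ?_
    have := hown v (by simp [hy])
    rw [hy] at this
    exact Option.some_injective _ this
  · rintro s ⟨hs, hinv⟩
    rw [failure_map]
    refine (failure_mono G fun p hp => hWE m s p hmx hs hinv hp.1).trans
      (hB.failure_le l hl (fun v => if (s v).2 then some (s v).1 else none) fun v y hy => ?_)
    split_ifs at hy
    · obtain rfl := Option.some_injective _ hy
      obtain ⟨u, hu⟩ := hinv.1 v
      obtain ⟨w, hw⟩ := hmx u
      rw [hu]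
      exact hx w _ hw
    · cases hy

/-- A witness would hold a string strictly larger than an initial one, but all of them equal `z`. So
the second broadcast has no sources. -/
theorem failure_selection_single (hB : Reliable B G n D lmax ε) {l : ℕ} (hl : l ≤ lmax)
    {x : V → Option Bits} {z : Bits} (hx : ∀ v, ∀ y ∈ x v, y.length = l) (hne : ∃ v, x v ≠ none)
    (hz : ∀ v y, x v = some y → y = z) :
    failure G (B.time n D + (l * (4 * lg n) + B.time n D)) (fun v => selection B n D l (x v))
      (fun o => ∀ v, o v = (some z, true)) ≤ 2 * ε := by
  refine (failure_selection_le hB hl hx hne (δ := 0) (W := WitnessInvariant)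
    (fun m _ _ => (failure_findWitnesses_invariant G n l m).le) ?_).trans
    (by rw [zero_add, two_mul])
  intro m s p hmx hinv _ hp v
  have hm : ∀ v, m v = z := fun v => by
    obtain ⟨u, hu⟩ := hmx v
    exact hz u _ hu
  have hfalse : ∀ v, (s v).2 = false := fun v => by
    by_contra hc
    obtain ⟨u, hu⟩ := hinv.2.2 v (by simpa using hc)
    obtain ⟨w, hw⟩ := hinv.1 v
    rw [hw, hm, hm] at hu
    exact lt_irrefl _ hu
  dsimp only
  rw [hp.1 (fun v => by simp [hfalse v]) v]
  simp [hinv.2.1 v (hfalse v), hm v]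

/-- Once there is a witness, the second broadcast gives every node the string of some witness.
Different nodes may learn different strings; it only matters that each is an ID in use and larger
than another ID in use. -/
theorem failure_selection_multi (hB : Reliable B G n D lmax ε) {l : ℕ} (hl : l ≤ lmax)
    (hn : Fintype.card V = n) (hG : ∀ u v, ∃ k, ReachIn G k u v)
    {x : V → Option Bits} (hx : ∀ v, ∀ y ∈ x v, y.length = l) {u₁ u₂ : V} {y₁ y₂ : Bits}
    (h₁ : x u₁ = some y₁) (h₂ : x u₂ = some y₂) :
    failure G (B.time n D + (l * (4 * lg n) + B.time n D)) (fun v => selection B n D l (x v))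
      (fun o => ∀ v, ∃ q, o v = (some q, false) ∧ (∃ u, x u = some q) ∧
        ∃ u y, x u = some y ∧ y < q) ≤ 2 * ε + missWeight l y₁ y₂ := by
  refine (failure_selection_le hB hl hx ⟨u₁, by simp [h₁]⟩ (δ := missWeight l y₁ y₂)
    (W := fun _ s => ∃ v, (s v).2 = true) (fun m _ hown => ?_) ?_).trans
    (le_of_eq (by ring))
  · rw [← hown _ _ h₁, ← hown _ _ h₂]
    exact failure_findWitnesses_witness G n l hn hG m u₁ u₂
  · rintro m s p hmx ⟨w, hw⟩ hinv hp v
    obtain ⟨u, hu, hpv⟩ := hp.2 ⟨w, by simp [hw]⟩ v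
    have hu' : (s u).2 = true := by
      by_contra hc
      simp [hc] at hu
    dsimp only at hpv
    rw [if_pos hu'] at hpv
    refine ⟨(s u).1, by simp [hpv], ?_, ?_⟩
    · obtain ⟨w, hw⟩ := hinv.1 u
      rw [hw]
      exact hmx w
    · obtain ⟨w, hw⟩ := hinv.2.2 u hu'
      obtain ⟨w', hw'⟩ := hmx w
      exact ⟨w', _, hw', hw⟩

/-! ### Search -/

/-- The determination of bit `i` in Search. -/
noncomputable def searchStep (B : MultiBroadcast) (n D : ℕ) (id : Option Bits) (m : Bits)
    (i : ℕ) : Prog Bits :=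
  (B.run n D 1 (if (id.any fun x => decide (x.take i = m) && x.getD i false) then some [true]
    else none)).bind fun p => Prog.done (m ++ [p.isSome])

theorem search_eq (B : MultiBroadcast) (n D k : ℕ) (id : Option Bits) :
    search B n D k id = (List.range k).foldlM (searchStep B n D id) [] := rfl

theorem search_succ (B : MultiBroadcast) (n D k : ℕ) (id : Option Bits) :
    search B n D (k + 1) id =
      (search B n D k id).bind fun m => searchStep B n D id m k := by
  rw [search_eq, List.range_succ, List.foldlM_append, ← search_eq]
  rw [Prog.monad_bind_eq]
  congr 1
  funext m
  simp

theorem hasDuration_search {B : MultiBroadcast} {n D : ℕ}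
    (hB : ∀ l x, (B.run n D l x).HasDuration (B.time n D)) (k : ℕ) (id : Option Bits) :
    (search B n D k id).HasDuration (k * B.time n D) := by
  simpa [search_eq] using Prog.hasDuration_foldlM (searchStep B n D id) (List.range k)
    (d := B.time n D) (fun m i => (hB 1 _).bind fun _ => Prog.hasDuration_done _) []

/-- Once the prefix found is that of the largest ID `z`, the broadcast for the next bit has a source
exactly if this bit of `z` is 1: then the owner of `z` is one, and otherwise any source would have
an ID larger than `z`. -/
theorem failure_search_le (hB : Reliable B G n D lmax ε) (hl1 : 1 ≤ lmax) {l : ℕ}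
    {id : V → Option Bits} (hid : ∀ v y, id v = some y → y.length = l) {v₀ : V} {z : Bits}
    (hz : id v₀ = some z) (hmax : ∀ v y, id v = some y → y ≤ z) :
    ∀ k ≤ l, failure G (k * B.time n D) (fun v => search B n D k (id v))
      (fun m => ∀ v, m v = z.take k) ≤ k * ε
  | 0, _ => by
    simp only [search_eq, List.range_zero, List.foldlM_nil, Prog.monad_pure_eq]
    rw [failure_done G (fun _ => by simp)]
    exact bot_le
  | k + 1, hk => by
    simp only [search_succ]
    rw [Nat.succ_mul]
    refine (failure_bind G (fun v => hasDuration_search hB.hasDuration k (id v))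
      (failure_search_le hB hl1 hid hz hmax k (by omega)) ?_).trans
      (le_of_eq (by push_cast; ring : (k : ℝ≥0∞) * ε + ε = ((k + 1 : ℕ) : ℝ≥0∞) * ε))
    intro m hm
    obtain rfl : m = fun _ => z.take k := funext hm
    have hzl : k < z.length := by rw [hid v₀ z hz]; omega
    simp only [searchStep]
    rw [failure_map]
    refine le_trans (failure_mono G fun p hp => ?_) (hB.failure_le 1 hl1
      (fun v => if ((id v).any fun x => decide (x.take k = z.take k) && x.getD k false)
        then some [true] else none) fun v y hy => ?_)
    · obtain ⟨⟨h1, h2⟩, -⟩ := hp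
      intro v
      dsimp only
      rw [take_succ_eq hzl]
      cases hzk : z.getD k false with
      | true =>
        obtain ⟨s, hs, hps⟩ := h2 ⟨v₀, by simp only [hz, Option.any_some, hzk]; simp⟩ v
        obtain ⟨y, hy⟩ := Option.ne_none_iff_exists'.1 hs
        rw [hps, hy]
        rfl
      | false =>
        rw [h1 _ v]
        · rfl
        · intro w
          dsimp only
          rw [if_neg]
          intro hany
          cases hw : id w with
          | none => simp [hw] at hany
          | some y =>
            simp only [hw, Option.any_some, Bool.and_eq_true, decide_eq_true_eq] at hany
            have hyl : k < y.length := by rw [hid w y hw]; omega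
            exact absurd (hmax w y hw) (not_le.2 (lt_of_take_eq hyl hzl hany.1 hany.2 hzk))
    · split_ifs at hy
      · obtain rfl := Option.some_injective _ hy
        rfl
      · cases hy

end Selection

/-! ### The loop of Selections -/

theorem selectionLoop_succ (B : MultiBroadcast) (n D l : ℕ) (id : Option Bits) (k : ℕ)
    (inC : Bool) :
    selectionLoop B n D l id (k + 1) inC =
      (selection B n D l (if inC then id else none)).bind fun o =>
        if o.2 then Prog.done (o.1, List.replicate (k + 2) inC)
        else (selectionLoop B n D l id k
            (inC && !(id.any fun x => o.1.any fun y => decide (x < y)))).bind fun a =>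
          Prog.done (a.1, inC :: a.2) := rfl

theorem stepsLE_selectionLoop {B : MultiBroadcast} {n D : ℕ}
    (hB : ∀ l x, (B.run n D l x).HasDuration (B.time n D)) (l : ℕ) (id : Option Bits) :
    ∀ (k : ℕ) (inC : Bool), (selectionLoop B n D l id k inC).StepsLE
      (k * (B.time n D + (l * (4 * lg n) + B.time n D)))
  | 0, inC => trivial
  | k + 1, inC => by
    rw [selectionLoop_succ, Nat.succ_mul, add_comm (k * _)]
    refine (hasDuration_selection hB l _).stepsLE.bind fun o => ?_
    split_ifs
    · trivial
    · exact (stepsLE_selectionLoop hB l id k _).bind (t := 0) fun _ => trivial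

section Loop

variable {V : Type}

/-- The nodes whose `j`-th recorded membership bit is set. -/
def recorded (o : V → Option Bits × List Bool) (j : ℕ) : Set V :=
  {v | (o v).2.getD j false = true}

/-- What the loop achieves from the candidate set `C` on, with `k` iterations. -/
def LoopSucceeds (id : V → Option Bits) (k : ℕ) (C : V → Bool)
    (o : V → Option Bits × List Bool) : Prop :=
  (∃ v z, id v = some z ∧ ∀ w, (o w).1 = some z) ∧
  recorded o 0 = {v | C v = true} ∧
  ∀ j < k, 1 < (recorded o j).ncard →
    (recorded o (j + 1)).Nonempty ∧ recorded o (j + 1) ⊆ recorded o j ∧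
    ∀ v ∈ recorded o j, (∀ u ∈ recorded o j, ∀ x ∈ id v, ∀ y ∈ id u, x ≤ y) →
      v ∉ recorded o (j + 1)

variable [Fintype V] {G : Digraph V} {B : MultiBroadcast} {n D lmax : ℕ} {ε : ℝ≥0∞}

/-- Induction on `k`. With several candidates, a minimum ID is below the answer at its node and a
maximum ID is not, whichever answers the nodes have received; so the number of candidates drops but
stays positive, and `k` iterations suffice for the rest. With one candidate, Selection stops at all
nodes at once. -/
theorem failure_selectionLoop_le (hB : Reliable B G n D lmax ε) {l : ℕ} (hl : l ≤ lmax)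
    (hn : Fintype.card V = n) (hG : ∀ u v, ∃ k, ReachIn G k u v) {id : V → Option Bits}
    (hid : ∀ v y, id v = some y → y.length = l) {δ : ℝ≥0∞}
    (hδ : ∀ u v x y, u ≠ v → id u = some x → id v = some y → missWeight l x y ≤ δ) :
    ∀ (k : ℕ) (C : V → Bool), (∀ v, C v = true → ∃ y, id v = some y) →
      0 < {v | C v = true}.ncard → {v | C v = true}.ncard ≤ k →
      failure G (k * (B.time n D + (l * (4 * lg n) + B.time n D)))
        (fun v => selectionLoop B n D l (id v) k (C v)) (LoopSucceeds id k C) ≤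
      k * (2 * ε + δ)
  | 0, C, _, h0, hk => by omega
  | k + 1, C, hC, h0, hk => by
    simp only [selectionLoop_succ]
    rw [Nat.succ_mul, add_comm]
    have hx : ∀ v, ∀ y ∈ (if C v then id v else none), y.length = l := fun v y hy => by
      split_ifs at hy
      · exact hid v y hy
      · cases hy
    have hx' : ∀ {v y}, (if C v then id v else none) = some y ↔ C v = true ∧ id v = some y := by
      intro v y
      split_ifs with h <;> simp [h]
    rcases Nat.lt_or_ge 1 {v | C v = true}.ncard with hcard | hcard
    · obtain ⟨u₁, hu₁, u₂, hu₂, hne⟩ := (Set.one_lt_ncard (Set.toFinite _)).1 hcard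
      obtain ⟨y₁, hy₁⟩ := hC u₁ hu₁
      obtain ⟨y₂, hy₂⟩ := hC u₂ hu₂
      have hsel := (failure_selection_multi hB hl hn hG (x := fun v => if C v then id v else none)
        hx (hx'.2 ⟨hu₁, hy₁⟩) (hx'.2 ⟨hu₂, hy₂⟩)).trans
          (add_le_add_right (hδ _ _ _ _ hne hy₁ hy₂) _)
      refine (failure_bind G (fun v => hasDuration_selection hB.hasDuration l _) hsel
        (ε' := k * (2 * ε + δ)) ?_).trans
        (le_of_eq (by push_cast; ring))
      intro o ho
      choose q hq hqx hqlt using ho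
      obtain rfl : o = fun v => (some (q v), false) := funext hq
      simp only [hx'] at hqx hqlt
      set C' : V → Bool := fun v =>
        C v && !((id v).any fun x => (some (q v)).any fun y => decide (x < y)) with hC'
      have hC'iff : ∀ v, C' v = true ↔ C v = true ∧ ∀ x, id v = some x → q v ≤ x := by
        intro v
        cases h : id v <;> simp [hC', h]
      have hsub : {v | C' v = true} ⊆ {v | C v = true} := fun v hv => ((hC'iff v).1 hv).1
      have hmin : ∀ v, C v = true →
          (∀ u, C u = true → ∀ x ∈ id v, ∀ y ∈ id u, x ≤ y) → ¬ C' v = true := by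
        intro v hv hle hc
        obtain ⟨u, y, ⟨hu, hy⟩, hlt⟩ := hqlt v
        obtain ⟨x, hx⟩ := hC v hv
        have h1 := ((hC'iff v).1 hc).2 x hx
        exact absurd (h1.trans (hle u hu x hx y hy)) (not_le.2 hlt)
      have hCne : (Finset.univ.filter fun v => C v = true).Nonempty := ⟨u₁, by simpa using hu₁⟩
      have hne' : ∃ v, C' v = true := by
        obtain ⟨v, hv, hmax⟩ := Finset.exists_max_image _ (fun v => (id v).getD []) hCne
        simp only [Finset.mem_filter, Finset.mem_univ, true_and] at hv hmax
        refine ⟨v, (hC'iff v).2 ⟨hv, fun x hx => ?_⟩⟩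
        obtain ⟨u, hu, huq⟩ := hqx v
        have := hmax u hu
        rwa [huq, hx] at this
      have hlt : {v | C' v = true}.ncard < {v | C v = true}.ncard := by
        refine Set.ncard_lt_ncard ⟨hsub, fun hsup => ?_⟩ (Set.toFinite _)
        obtain ⟨v, hv, hmin'⟩ := Finset.exists_min_image _ (fun v => (id v).getD []) hCne
        simp only [Finset.mem_filter, Finset.mem_univ, true_and] at hv hmin'
        refine hmin v hv (fun u hu x hx y hy => ?_) (hsup hv)
        rw [Option.mem_def] at hx hy
        have := hmin' u hu
        rwa [hx, hy] at this
      have ih := failure_selectionLoop_le hB hl hn hG hid hδ k C'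
        (fun v hv => hC v (hsub hv)) ((Set.ncard_pos (Set.toFinite _)).2 hne') (by omega)
      simp only [Bool.false_eq_true, if_false]
      rw [failure_map]
      refine (failure_mono G fun a ha => ?_).trans ih
      obtain ⟨hlead, hzero, hstep⟩ := ha
      have hr0 : recorded (fun v => ((a v).1, C v :: (a v).2)) 0 = {v | C v = true} := by
        ext v; simp [recorded]
      have hrs : ∀ j, recorded (fun v => ((a v).1, C v :: (a v).2)) (j + 1) = recorded a j :=
        fun j => by ext v; simp [recorded]
      refine ⟨hlead, hr0, fun j hj hcardj => ?_⟩
      cases j with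
      | zero =>
        rw [hrs, hzero, hr0]
        exact ⟨hne', hsub, fun v hv hle => hmin v hv hle⟩
      | succ j =>
        rw [hrs] at hcardj
        rw [hrs, hrs]
        exact hstep j (by omega) hcardj
    · obtain ⟨v₀, hv₀⟩ := Set.ncard_eq_one.1 (by omega : {v | C v = true}.ncard = 1)
      have hv₀' : C v₀ = true := by
        have : v₀ ∈ {v | C v = true} := by rw [hv₀]; rfl
        exact this
      obtain ⟨z, hz⟩ := hC v₀ hv₀'
      have hsel := failure_selection_single hB hl (x := fun v => if C v then id v else none)
        (z := z) hx ⟨v₀, by simp [hv₀', hz]⟩ (fun v y hy => by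
          obtain ⟨h1, h2⟩ := hx'.1 hy
          have : v ∈ {v | C v = true} := h1
          rw [hv₀] at this
          obtain rfl := this
          rw [hz] at h2
          exact (Option.some_injective _ h2).symm)
      refine (failure_bind G (fun v => hasDuration_selection hB.hasDuration l _) hsel
        (ε' := 0) ?_).trans ?_
      · intro o ho
        obtain rfl : o = fun v => (some z, true) := funext ho
        simp only [if_true]
        rw [failure_done G]
        -- The record of a node that stops is padded to `k + 2` entries, so no entry that is read
        -- falls back on the default `false`.
        have hr : ∀ j < k + 2, recorded (fun v => (some z, List.replicate (k + 2) (C v))) j =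
            {v | C v = true} := by
          intro j hj
          ext v
          simp [recorded, List.getD_eq_getElem?_getD, hj]
        refine ⟨⟨v₀, z, hz, fun _ => rfl⟩, hr 0 (by omega), fun j hj hcj => ?_⟩
        rw [hr j (by omega)] at hcj
        omega
      · rw [add_zero]
        push_cast
        rw [add_mul, one_mul]
        exact le_add_left le_self_add

end Loop

/-! ### Leader election from given IDs -/

/-- The part of the algorithm after the choice of the IDs. -/
noncomputable def electFrom (κ : Constants) (B : MultiBroadcast) (n D : ℕ) (id : Option Bits) :
    Prog Outcome :=
  (search B n D (sqrtLg n) id).bind fun m =>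
    (selectionLoop B n D (κ.bits * lg n) id (κ.rounds * sqrtLg n)
      (id.any fun x => decide (x.take (sqrtLg n) = m))).bind fun a => Prog.done ⟨id, a.1, a.2⟩

/-- The choice of the ID of a node. -/
noncomputable def chooseId (κ : Constants) (n : ℕ) : Prog (Option Bits) :=
  (Prog.flip ((κ.cand * lg n : ℝ≥0) / n)).bind fun c =>
    if c then (randomBits (κ.bits * lg n)).bind fun x => Prog.done (some x) else Prog.done none

theorem leaderElection_eq (κ : Constants) (B : MultiBroadcast) (n D : ℕ) :
    leaderElection κ B n D = (chooseId κ n).bind (electFrom κ B n D) := by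
  unfold leaderElection chooseId
  simp only [Prog.monad_bind_eq, Prog.bind_assoc]
  congr 1
  funext c
  cases c
  · rfl
  · simp only [if_true]
    rfl

/-- The time bound of the algorithm. -/
noncomputable def electionTime (κ : Constants) (B : MultiBroadcast) (n D : ℕ) : ℕ :=
  sqrtLg n * B.time n D + κ.rounds * sqrtLg n *
    (B.time n D + (κ.bits * lg n * (4 * lg n) + B.time n D))

/-- The IDs are suitable for the algorithm: there is a candidate, at most `N` candidates share the
same first `s` bits, and any two IDs of `l` bits differ in many positions. -/
structure GoodIds {V : Type} (l s N : ℕ) (δ : ℝ≥0∞) (id : V → Option Bits) : Prop where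
  length_eq : ∀ v y, id v = some y → y.length = l
  exists_candidate : ∃ v, id v ≠ none
  sharing_le : ∀ w : Bits, {v | ∃ y, id v = some y ∧ y.take s = w}.ncard ≤ N
  missWeight_le : ∀ u v x y, u ≠ v → id u = some x → id v = some y → missWeight l x y ≤ δ

theorem sqrtLg_le_lg (n : ℕ) : sqrtLg n ≤ lg n := by
  rw [sqrtLg, Nat.ceil_le]
  rcases Nat.eq_zero_or_pos (lg n) with h | h
  · simp [h]
  · have : (1 : ℝ) ≤ lg n := by exact_mod_cast h
    rw [Real.sqrt_le_left (by linarith)]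
    nlinarith

/-- The remaining candidates are those that share the first bits of the largest ID, so there is at
least one and `sharing_le` bounds their number. The condition `δ < 1` makes the leader unique, since
equal IDs have `missWeight` equal to 1. -/
theorem failure_electFrom_le {V : Type} [Fintype V] {G : Digraph V} {κ : Constants}
    {B : MultiBroadcast} {n D : ℕ} {ε δ : ℝ≥0∞} (hB : Reliable B G n D (κ.bits * lg n) ε)
    (hbits : 1 ≤ κ.bits) (hn2 : 2 ≤ n)
    (hn : Fintype.card V = n) (hG : ∀ u v, ∃ k, ReachIn G k u v) {id : V → Option Bits}
    (hδ1 : δ < 1)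
    (hid : GoodIds (κ.bits * lg n) (sqrtLg n) (κ.rounds * sqrtLg n) δ id) :
    failure G (electionTime κ B n D) (fun v => electFrom κ B n D (id v)) (fun ω =>
      LeaderElected ω ∧ SearchNarrows (κ.rounds * sqrtLg n) ω ∧
      SelectionEliminates (κ.rounds * sqrtLg n) ω) ≤
    sqrtLg n * ε + (κ.rounds * sqrtLg n : ℕ) * (2 * ε + δ) := by
  set s := sqrtLg n
  set N := κ.rounds * s
  set l := κ.bits * lg n with hl
  have hlg : 1 ≤ lg n := Nat.clog_pos (by norm_num) hn2
  have hsl : s ≤ l := (sqrtLg_le_lg n).trans (Nat.le_mul_of_pos_left _ hbits)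
  have hl1 : 1 ≤ l := Nat.mul_pos hbits hlg
  obtain ⟨v₁, hv₁⟩ := hid.exists_candidate
  obtain ⟨v₀, hv₀, hmax⟩ := Finset.exists_max_image (Finset.univ.filter fun v => (id v).isSome)
    (fun v => (id v).getD []) ⟨v₁, by simpa [Option.isSome_iff_ne_none] using hv₁⟩
  simp only [Finset.mem_filter, Finset.mem_univ, true_and] at hv₀ hmax
  obtain ⟨z, hz⟩ := Option.isSome_iff_exists.1 hv₀
  have hmax' : ∀ v y, id v = some y → y ≤ z := fun v y hy => by
    have := hmax v (by simp [hy])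
    rwa [hy, hz] at this
  refine failure_bind G (fun v => hasDuration_search hB.hasDuration _ _)
    (failure_search_le hB hl1 hid.length_eq hz hmax' s hsl) ?_
  intro m hm
  obtain rfl : m = fun _ => z.take s := funext hm
  rw [failure_map]
  set C : V → Bool := fun v => (id v).any fun x => decide (x.take s = z.take s) with hCdef
  have hCiff : ∀ v, C v = true ↔ ∃ y, id v = some y ∧ y.take s = z.take s := by
    intro v
    cases h : id v <;> simp [hCdef, h]
  have hCset : {v | C v = true} = {v | ∃ y, id v = some y ∧ y.take s = z.take s} := by
    ext v; exact hCiff v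
  have hpos : 0 < {v | C v = true}.ncard :=
    (Set.ncard_pos (Set.toFinite _)).2 ⟨v₀, (hCiff v₀).2 ⟨z, hz, rfl⟩⟩
  have hle : {v | C v = true}.ncard ≤ N := by rw [hCset]; exact hid.sharing_le _
  refine (failure_mono G fun a ha => ?_).trans (failure_selectionLoop_le hB le_rfl hn hG
    hid.length_eq hid.missWeight_le N C (fun v hv => by
      obtain ⟨y, hy, -⟩ := (hCiff v).1 hv; exact ⟨y, hy⟩) hpos hle)
  obtain ⟨⟨v, x, hx, hlead⟩, hzero, hstep⟩ := ha
  refine ⟨⟨x, hlead, v, hx, fun w hw => ?_⟩, ?_, hstep⟩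
  · by_contra hne
    have := hid.missWeight_le w v x x hne hw hx
    rw [missWeight_self] at this
    exact absurd this (not_le.2 hδ1)
  · have : candidates (fun v => (⟨id v, (a v).1, (a v).2⟩ : Outcome)) 0 = {v | C v = true} := hzero
    rw [SearchNarrows, this]
    exact ⟨hpos, hle⟩

/-! ### The law of the IDs -/

/-- The uniform law on the strings of `l` bits. -/
noncomputable def bitsLaw : ℕ → PMF Bits
  | 0 => PMF.pure []
  | l + 1 => (coinPMF (min 1 2⁻¹) (min_le_left _ _)).bind fun b => (bitsLaw l).map (b :: ·)

/-- The law of the ID of a node, which is a candidate with probability `q`. -/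
noncomputable def idLaw (q : ℝ≥0) (hq : q ≤ 1) (l : ℕ) : PMF (Option Bits) :=
  (coinPMF q hq).bind fun c => if c then (bitsLaw l).map some else PMF.pure none

theorem settle_bind_of_law {α β : Type} {P : Prog α} {p : PMF α} (h : P.settle = p.map Prog.done)
    (F : α → Prog β) : (P.bind F).settle = p.bind fun a => (F a).settle := by
  rw [Prog.settle_bind, h, PMF.bind_map]
  rfl

theorem settle_flip (p : ℝ≥0) :
    (Prog.flip p).settle = (coinPMF (min 1 p) (min_le_left _ _)).map Prog.done := by
  rw [← PMF.bind_pure_comp]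
  rfl

theorem settle_randomBits : ∀ l, (randomBits l).settle = (bitsLaw l).map Prog.done
  | 0 => by simp [randomBits, bitsLaw, Prog.monad_pure_eq, Prog.settle, PMF.pure_map]
  | l + 1 => by
    change ((Prog.flip 2⁻¹).bind fun b => (randomBits l).bind fun x =>
      Prog.done (b :: x)).settle = _
    rw [settle_bind_of_law (settle_flip _), bitsLaw, PMF.map_bind]
    congr 1
    funext b
    rw [settle_bind_of_law (settle_randomBits l), PMF.map_comp, ← PMF.bind_pure_comp]
    rfl

theorem settle_chooseId (κ : Constants) (n : ℕ) :
    (chooseId κ n).settle =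
      (idLaw (min 1 ((κ.cand * lg n : ℝ≥0) / n)) (min_le_left _ _) (κ.bits * lg n)).map
        Prog.done := by
  rw [chooseId, settle_bind_of_law (settle_flip _), idLaw, PMF.map_bind]
  congr 1
  funext c
  cases c
  · simp [Prog.settle, PMF.pure_map]
  · simp only [if_true]
    rw [settle_bind_of_law (settle_randomBits _), PMF.map_comp, ← PMF.bind_pure_comp]
    rfl

theorem hasDuration_randomBits : ∀ l, (randomBits l).HasDuration 0
  | 0 => rfl
  | l + 1 => (Prog.hasDuration_flip _).bind (t := 0) fun _ =>
      (hasDuration_randomBits l).bind (t := 0) fun _ => rfl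

theorem hasDuration_chooseId (κ : Constants) (n : ℕ) : (chooseId κ n).HasDuration 0 :=
  (Prog.hasDuration_flip _).bind (t := 0) fun c => by
    cases c
    · rfl
    · exact (hasDuration_randomBits _).bind (t := 0) fun _ => rfl

theorem expect_of_law {V α : Type} [Fintype V] (G : Digraph V) {P : Prog α} {p : PMF α}
    (h : P.settle = p.map Prog.done) (φ : (V → α) → ℝ≥0∞) :
    expect G 0 (fun _ : V => P) φ = mean (indep fun _ => p) φ := by
  rw [expect, exec, h, indep_map, mean_map]
  congr 1
  funext a
  exact outcomeValue_eq φ fun v => rfl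

theorem mean_idLaw (q : ℝ≥0) (hq : q ≤ 1) (l : ℕ) (φ : Option Bits → ℝ≥0∞) :
    mean (idLaw q hq l) φ =
      q * mean (bitsLaw l) (fun x => φ (some x)) + ((1 - q : ℝ≥0) : ℝ≥0∞) * φ none := by
  rw [idLaw, mean_bind, mean_coin]
  simp [mean_map, mean_pure]

theorem mean_bitsLaw_succ (l : ℕ) (φ : Bits → ℝ≥0∞) :
    mean (bitsLaw (l + 1)) φ = 2⁻¹ * mean (bitsLaw l) (fun x => φ (true :: x)) +
      2⁻¹ * mean (bitsLaw l) (fun x => φ (false :: x)) := by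
  rw [bitsLaw, mean_bind, mean_coin]
  have h1 : min 1 (2 : ℝ≥0)⁻¹ = 2⁻¹ := min_eq_right (by norm_num)
  have h2 : (1 : ℝ≥0) - 2⁻¹ = 2⁻¹ := by
    rw [← NNReal.coe_inj, NNReal.coe_sub (by norm_num)]; norm_num
  have h3 : ((2⁻¹ : ℝ≥0) : ℝ≥0∞) = 2⁻¹ := by rw [ENNReal.coe_inv (by norm_num)]; rfl
  rw [h1, h2, h3]
  simp [mean_map]

theorem length_of_mem_support_bitsLaw : ∀ {l : ℕ} {x : Bits}, x ∈ (bitsLaw l).support →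
    x.length = l
  | 0, x, h => by
    simp only [bitsLaw, PMF.support_pure, Set.mem_singleton_iff] at h
    simp [h]
  | l + 1, x, h => by
    obtain ⟨b, -, hx⟩ := (PMF.mem_support_bind_iff _ _ _).1 h
    obtain ⟨y, hy, rfl⟩ := (PMF.mem_support_map_iff _ _ _).1 hx
    simp [length_of_mem_support_bitsLaw hy]

theorem length_of_mem_support_idLaw {q : ℝ≥0} {hq : q ≤ 1} {l : ℕ} {x : Bits}
    (h : some x ∈ (idLaw q hq l).support) : x.length = l := by
  obtain ⟨c, -, hx⟩ := (PMF.mem_support_bind_iff _ _ _).1 h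
  cases c
  · simp at hx
  · simp only [if_true] at hx
    obtain ⟨y, hy, hyx⟩ := (PMF.mem_support_map_iff _ _ _).1 hx
    obtain rfl := Option.some_injective _ hyx
    exact length_of_mem_support_bitsLaw hy

theorem missWeight_cons_succ (l : ℕ) (b : Bool) (x y : Bits) :
    missWeight (l + 1) (b :: x) y =
      (if b = y.getD 0 false then 1 else (7 / 8) ^ 4) * missWeight l x y.tail := by
  rw [missWeight, Finset.prod_range_succ', mul_comm]
  congr 1
  refine Finset.prod_congr rfl fun i _ => ?_
  cases y <;> simp

theorem missWeight_comm (l : ℕ) (x y : Bits) : missWeight l x y = missWeight l y x := by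
  simp only [missWeight, eq_comm]

/-- Whatever `y` is, a uniform bit agrees with the one of `y` with probability 1/2, so all positions
contribute the same factor. -/
theorem mean_bitsLaw_missWeight : ∀ (l : ℕ) (y : Bits),
    mean (bitsLaw l) (fun x => missWeight l x y) = (2⁻¹ + 2⁻¹ * (7 / 8) ^ 4) ^ l
  | 0, y => by simp [bitsLaw, mean_pure, missWeight]
  | l + 1, y => by
    rw [mean_bitsLaw_succ]
    simp only [missWeight_cons_succ, mean_const_mul, mean_bitsLaw_missWeight l]
    cases y.getD 0 false <;> simp <;> ring

theorem mean_bitsLaw_take_le : ∀ (s l : ℕ), s ≤ l → ∀ w : Bits,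
    mean (bitsLaw l) (fun x => if x.take s = w then 1 else 0) ≤ 2⁻¹ ^ s
  | 0, l, _, w => by
    simp only [pow_zero]
    exact mean_le_of_le fun x => by split_ifs <;> simp
  | s + 1, 0, h, w => by omega
  | s + 1, l + 1, h, w => by
    rw [mean_bitsLaw_succ]
    have ih := mean_bitsLaw_take_le s l (by omega)
    cases w with
    | nil => simp [mean]
    | cons c w =>
      have hc : ∀ b : Bool, mean (bitsLaw l)
          (fun x => if (b :: x).take (s + 1) = c :: w then (1 : ℝ≥0∞) else 0) ≤
            if b = c then 2⁻¹ ^ s else 0 := by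
        intro b
        split_ifs with hbc
        · simpa [hbc] using ih w
        · simp [hbc, mean]
      calc _ ≤ 2⁻¹ * (if true = c then (2⁻¹ : ℝ≥0∞) ^ s else 0) +
            2⁻¹ * (if false = c then (2⁻¹ : ℝ≥0∞) ^ s else 0) := by
            gcongr <;> exact hc _
        _ = 2⁻¹ ^ (s + 1) := by cases c <;> simp [pow_succ']

/-! ### Expected badness of the IDs -/

section Ids

variable {V : Type} [Fintype V]

/-- Summing over the value `x` of coordinate `u` turns `f` into a sum of products with one factor
per coordinate, to which independence applies. -/
theorem mean_indep_pair {β : Type} (p : PMF β) {u v : V} (huv : u ≠ v) (f : β → β → ℝ≥0∞) :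
    mean (indep fun _ : V => p) (fun a => f (a u) (a v)) =
      mean p fun x => mean p fun y => f x y := by
  classical
  have h1 : ∀ a : V → β, f (a u) (a v) = ∑' x, ∏ w ∈ ({u, v} : Finset V),
      (if w = u then (if a w = x then 1 else 0) else f x (a w)) := by
    intro a
    simp only [Finset.prod_pair huv, if_true, if_neg huv.symm]
    rw [tsum_eq_single (a u)]
    · simp
    · intro x hx; simp [Ne.symm hx]
  simp only [h1]
  rw [mean_tsum]
  conv_rhs => rw [mean]
  refine tsum_congr fun x => ?_
  rw [mean_indep_prod_finset {u, v} (fun _ => p)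
    (fun w b => if w = u then (if b = x then 1 else 0) else f x b), Finset.prod_pair huv]
  simp only [if_true, if_neg huv.symm]
  congr 1
  rw [mean, tsum_eq_single x]
  · simp
  · intro y hy; simp [hy]

/-- Whether the ID begins with `w`, a string of `s` bits. -/
noncomputable def initialIndicator (s : ℕ) (w : Bits) : Option Bits → ℝ≥0∞
  | none => 0
  | some x => if x.take s = w then 1 else 0

/-- The risk of not telling two IDs apart. -/
noncomputable def pairRisk (l : ℕ) : Option Bits → Option Bits → ℝ≥0∞
  | some x, some y => missWeight l x y
  | _, _ => 0

open Classical in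
/-- An upper bound for the failure probability of the algorithm with the given IDs. -/
noncomputable def idsRisk (l s N : ℕ) (ε : ℝ≥0∞) (id : V → Option Bits) : ℝ≥0∞ :=
  (∏ v, if id v = none then 1 else 0) +
    (∑ A ∈ Finset.powersetCard (N + 1) Finset.univ, ∑' w, ∏ v ∈ A, initialIndicator s w (id v)) +
    ((s + 2 * N) * ε + N * ∑ e ∈ (Finset.univ : Finset V).offDiag, pairRisk l (id e.1) (id e.2))

/-- Each defect of the IDs makes one summand of `idsRisk` at least 1, so the trivial bound is enough
there. Without defects `failure_electFrom_le` applies, with the total risk over all pairs as `δ`. -/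
theorem failure_electFrom_le_idsRisk {G : Digraph V} {κ : Constants}
    {B : MultiBroadcast} {n D : ℕ} {ε : ℝ≥0∞} (hB : Reliable B G n D (κ.bits * lg n) ε)
    (hbits : 1 ≤ κ.bits) (hrounds : 1 ≤ κ.rounds) (hn2 : 2 ≤ n)
    (hn : Fintype.card V = n) (hG : ∀ u v, ∃ k, ReachIn G k u v) {id : V → Option Bits}
    (hid : ∀ v y, id v = some y → y.length = κ.bits * lg n) :
    failure G (electionTime κ B n D) (fun v => electFrom κ B n D (id v)) (fun ω =>
      LeaderElected ω ∧ SearchNarrows (κ.rounds * sqrtLg n) ω ∧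
      SelectionEliminates (κ.rounds * sqrtLg n) ω) ≤
    idsRisk (κ.bits * lg n) (sqrtLg n) (κ.rounds * sqrtLg n) ε id := by
  classical
  have hlg : 1 ≤ lg n := Nat.clog_pos (by norm_num) hn2
  have hs : 1 ≤ sqrtLg n := by
    rw [sqrtLg, Nat.one_le_ceil_iff, Real.sqrt_pos]
    exact_mod_cast hlg
  have hN : 1 ≤ κ.rounds * sqrtLg n := Nat.mul_pos hrounds hs
  set N := κ.rounds * sqrtLg n with hNdef
  set l := κ.bits * lg n
  by_cases h1 : ∃ v, id v ≠ none
  swap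
  · push Not at h1
    refine (failure_le_one G _ _ _).trans ?_
    unfold idsRisk
    simp only [h1, if_true, Finset.prod_const_one, add_assoc]
    exact le_self_add
  by_cases h2 : ∀ w : Bits, {v | ∃ y, id v = some y ∧ y.take (sqrtLg n) = w}.ncard ≤ N
  swap
  · push Not at h2
    obtain ⟨w, hw⟩ := h2
    refine (failure_le_one G _ _ _).trans ?_
    rw [Set.ncard_eq_toFinset_card'] at hw
    obtain ⟨A, hA, hAc⟩ := Finset.exists_subset_card_eq (Nat.succ_le_of_lt hw)
    unfold idsRisk
    refine le_trans ?_ (le_trans le_add_self (le_self_add))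
    refine le_trans ?_ (Finset.single_le_sum (fun _ _ => bot_le)
      (Finset.mem_powersetCard.2 ⟨Finset.subset_univ A, hAc⟩))
    refine le_trans ?_ (ENNReal.le_tsum w)
    rw [Finset.prod_eq_one]
    intro v hv
    have := hA hv
    simp only [Set.mem_toFinset, Set.mem_ofPred_eq] at this
    obtain ⟨y, hy, hyw⟩ := this
    simp [hy, initialIndicator, hyw]
  set δ := ∑ e ∈ (Finset.univ : Finset V).offDiag, pairRisk l (id e.1) (id e.2) with hδ
  by_cases h3 : δ < 1
  swap
  · refine (failure_le_one G _ _ _).trans ?_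
    unfold idsRisk
    refine le_trans ?_ le_add_self
    refine le_trans ?_ le_add_self
    calc (1 : ℝ≥0∞) = 1 * 1 := by ring
      _ ≤ N * δ := mul_le_mul' (by exact_mod_cast hN) (not_lt.1 h3)
  refine (failure_electFrom_le hB hbits hn2 hn hG h3 ⟨hid, h1, h2, ?_⟩).trans ?_
  · intro u v x y huv hu hv
    have := Finset.single_le_sum (f := fun e : V × V => pairRisk l (id e.1) (id e.2))
      (fun _ _ => bot_le) (a := (u, v))
      (Finset.mem_offDiag.2 ⟨Finset.mem_univ u, Finset.mem_univ v, huv⟩)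
    simp only [hu, hv] at this
    exact this
  · unfold idsRisk
    refine le_trans (le_of_eq ?_) le_add_self
    ring

/-- For `N + 1` nodes that share a prefix `w`, independence gives `N + 1` equal factors. `N` of them
are bounded by `2⁻¹ ^ s`; the last one is kept and gives 1 when summed over `w`. If `n ≤ N` there
are no such sets of nodes. -/
theorem mean_idsRisk_le {n : ℕ} (hn : Fintype.card V = n) {q : ℝ≥0} (hq : q ≤ 1) {l s N : ℕ}
    (hsl : s ≤ l) (ε : ℝ≥0∞) :
    mean (indep fun _ : V => idLaw q hq l) (idsRisk l s N ε) ≤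
      ((1 - q : ℝ≥0) : ℝ≥0∞) ^ n +
      (if n ≤ N then 0 else ((n : ℝ≥0∞) * q) ^ (N + 1) * (2⁻¹ ^ s) ^ N) +
      ((s + 2 * N) * ε + N * (((n : ℝ≥0∞) * q) ^ 2 * (2⁻¹ + 2⁻¹ * (7 / 8) ^ 4) ^ l)) := by
  classical
  unfold idsRisk
  rw [mean_add, mean_add, mean_add, mean_const, mean_const_mul, mean_finset_sum, mean_finset_sum]
  refine add_le_add (add_le_add ?_ ?_) (add_le_add le_rfl (mul_le_mul_right ?_ _))
  · rw [mean_indep_prod (fun _ => idLaw q hq l) (fun _ a => if a = none then 1 else 0)]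
    simp only [mean_idLaw]
    simp [mean, hn]
  · split_ifs with hnN
    · rw [Finset.powersetCard_eq_empty.2 (by rw [Finset.card_univ]; omega)]
      simp
    · have hterm : ∀ A ∈ Finset.powersetCard (N + 1) (Finset.univ : Finset V),
          mean (indep fun _ : V => idLaw q hq l)
            (fun id => ∑' w, ∏ v ∈ A, initialIndicator s w (id v)) ≤
          q ^ (N + 1) * (2⁻¹ ^ s) ^ N := by
        intro A hA
        have hAc : A.card = N + 1 := (Finset.mem_powersetCard.1 hA).2
        rw [mean_tsum]
        have hw : ∀ w, mean (indep fun _ : V => idLaw q hq l)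
            (fun id => ∏ v ∈ A, initialIndicator s w (id v)) ≤
            q ^ (N + 1) * (2⁻¹ ^ s) ^ N *
              mean (bitsLaw l) (fun x => if x.take s = w then 1 else 0) := by
          intro w
          rw [mean_indep_prod_finset A (fun _ => idLaw q hq l) (fun _ => initialIndicator s w),
            Finset.prod_const, hAc, mean_idLaw]
          simp only [initialIndicator, mul_zero, add_zero]
          rw [mul_pow, pow_succ (mean _ _)]
          have := mean_bitsLaw_take_le s l hsl w
          rw [mul_assoc]
          gcongr
        refine (ENNReal.tsum_le_tsum hw).trans (le_of_eq ?_)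
        rw [ENNReal.tsum_mul_left, ← mean_tsum]
        have : ∀ x : Bits, (∑' w, if x.take s = w then (1 : ℝ≥0∞) else 0) = 1 := by
          intro x
          rw [tsum_eq_single (x.take s)]
          · simp
          · intro w hw; simp [Ne.symm hw]
        simp only [this, mean_const, mul_one]
      refine (Finset.sum_le_sum hterm).trans ?_
      rw [Finset.sum_const, Finset.card_powersetCard, Finset.card_univ, hn, nsmul_eq_mul]
      have hch : ((n.choose (N + 1) : ℕ) : ℝ≥0∞) ≤ (n : ℝ≥0∞) ^ (N + 1) := by
        exact_mod_cast Nat.choose_le_pow n (N + 1)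
      exact (mul_le_mul' hch le_rfl).trans (le_of_eq (by ring))
  · have hterm : ∀ e ∈ (Finset.univ : Finset V).offDiag,
        mean (indep fun _ : V => idLaw q hq l) (fun id => pairRisk l (id e.1) (id e.2)) =
          q ^ 2 * (2⁻¹ + 2⁻¹ * (7 / 8) ^ 4) ^ l := by
      intro e he
      rw [mean_indep_pair _ (Finset.mem_offDiag.1 he).2.2]
      have hin : ∀ x, mean (idLaw q hq l) (fun y => pairRisk l (some x) y) =
          q * (2⁻¹ + 2⁻¹ * (7 / 8) ^ 4) ^ l := by
        intro x
        rw [mean_idLaw]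
        simp only [pairRisk, missWeight_comm l x, mean_bitsLaw_missWeight, mul_zero, add_zero]
      rw [mean_idLaw]
      simp only [hin, mean_const]
      simp [pairRisk, mean]
      ring
    rw [Finset.sum_congr rfl hterm, Finset.sum_const, Finset.offDiag_card, Finset.card_univ, hn,
      nsmul_eq_mul, mul_pow, ← mul_assoc]
    gcongr
    exact_mod_cast (Nat.sub_le _ _).trans (by rw [sq])

/-- From 1 - x ≤ exp(-x) and e ≥ 2. The cap at 1 is harmless: there the first power vanishes, and
the expected number of candidates only decreases. -/
theorem candidate_bounds {n : ℕ} (hn : 1 ≤ n) (a : ℕ) :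
    ((1 - min 1 ((a : ℝ≥0) / n) : ℝ≥0) : ℝ≥0∞) ^ n ≤ 2⁻¹ ^ a ∧
      (n : ℝ≥0∞) * (min 1 ((a : ℝ≥0) / n) : ℝ≥0) ≤ a := by
  have hn0 : (0 : ℝ) < n := by exact_mod_cast hn
  have hn0' : (n : ℝ≥0) ≠ 0 := by exact_mod_cast hn0.ne'
  constructor
  · suffices h : (1 - min 1 ((a : ℝ≥0) / n) : ℝ≥0) ^ n ≤ 2⁻¹ ^ a by
      have h2 : ((2⁻¹ : ℝ≥0) : ℝ≥0∞) = 2⁻¹ := by rw [ENNReal.coe_inv (by norm_num)]; rfl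
      rw [← h2]
      exact_mod_cast h
    rcases le_total (1 : ℝ≥0) ((a : ℝ≥0) / n) with h | h
    · rw [min_eq_left h, tsub_self, zero_pow (by omega)]
      exact bot_le
    · rw [min_eq_right h, ← NNReal.coe_le_coe]
      push_cast [NNReal.coe_sub h]
      have h' : (a : ℝ) / n ≤ 1 := by simpa using NNReal.coe_le_coe.2 h
      calc (1 - (a : ℝ) / n) ^ n ≤ (Real.exp (-((a : ℝ) / n))) ^ n :=
            pow_le_pow_left₀ (by linarith) (Real.one_sub_le_exp_neg _) n
        _ = (Real.exp (-1)) ^ a := by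
            rw [← Real.exp_nat_mul, ← Real.exp_nat_mul]
            congr 1
            field_simp
        _ ≤ 2⁻¹ ^ a := by
            refine pow_le_pow_left₀ (Real.exp_pos _).le ?_ a
            rw [Real.exp_neg]
            exact inv_anti₀ (by norm_num) (by have := Real.add_one_le_exp (1 : ℝ); linarith)
  · have : (n : ℝ≥0) * min 1 ((a : ℝ≥0) / n) ≤ a := by
      calc (n : ℝ≥0) * min 1 ((a : ℝ≥0) / n) ≤ n * ((a : ℝ≥0) / n) := by
            gcongr; exact min_le_right _ _
        _ = a := mul_div_cancel₀ _ hn0'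
    exact_mod_cast this

/-- The IDs are drawn before the first time step, so the risk for given IDs is averaged over their
law. -/
theorem failure_leaderElection_le {G : Digraph V} {κ : Constants}
    {B : MultiBroadcast} {n D : ℕ} {ε : ℝ≥0∞} (hB : Reliable B G n D (κ.bits * lg n) ε)
    (hbits : 1 ≤ κ.bits) (hrounds : 1 ≤ κ.rounds) (hn2 : 2 ≤ n)
    (hn : Fintype.card V = n) (hG : ∀ u v, ∃ k, ReachIn G k u v) :
    failure G (electionTime κ B n D) (fun _ => leaderElection κ B n D) (fun ω =>
      LeaderElected ω ∧ SearchNarrows (κ.rounds * sqrtLg n) ω ∧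
      SelectionEliminates (κ.rounds * sqrtLg n) ω) ≤
    2⁻¹ ^ (κ.cand * lg n) +
      (if n ≤ κ.rounds * sqrtLg n then 0 else
        ((κ.cand * lg n : ℕ) : ℝ≥0∞) ^ (κ.rounds * sqrtLg n + 1) *
          (2⁻¹ ^ sqrtLg n) ^ (κ.rounds * sqrtLg n)) +
      ((sqrtLg n + 2 * (κ.rounds * sqrtLg n : ℕ)) * ε + (κ.rounds * sqrtLg n : ℕ) *
        (((κ.cand * lg n : ℕ) : ℝ≥0∞) ^ 2 *
          (2⁻¹ + 2⁻¹ * (7 / 8) ^ 4) ^ (κ.bits * lg n))) := by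
  simp only [leaderElection_eq]
  rw [← zero_add (electionTime κ B n D), failure,
    expect_bind G (fun _ => electFrom κ B n D) (fun _ => hasDuration_chooseId κ n),
    expect_of_law G (settle_chooseId κ n)]
  refine (mean_mono_support fun id hid => failure_electFrom_le_idsRisk hB hbits hrounds hn2 hn hG
    fun v y hy => length_of_mem_support_idLaw (hy ▸ mem_support_of_indep hid v)).trans ?_
  refine (mean_idsRisk_le hn (min_le_left _ _)
    ((sqrtLg_le_lg n).trans (Nat.le_mul_of_pos_left _ hbits)) ε).trans ?_
  obtain ⟨h1, h2⟩ := candidate_bounds (by omega : 1 ≤ n) (κ.cand * lg n)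
  push_cast at h1 h2
  refine add_le_add (add_le_add ?_ ?_) (add_le_add le_rfl ?_)
  · push_cast
    exact h1
  · split_ifs
    · exact le_rfl
    · push_cast
      gcongr
  · push_cast
    gcongr

end Ids

/-! ### Broadcasting along a schedule -/

/-- The state of a node in a broadcast: once it is informed, the number of time steps after which
this happened, and its string. -/
abbrev BcastState := Option (ℕ × Bits)

/-- The string of a node that was informed within the first `a` time steps. -/
def BcastState.activeAt (a : ℕ) : BcastState → Option Bits
  | some (τ, y) => if τ ≤ a then some y else none
  | none => none

/-- The state after the time step `t`, in which `r` arrives. -/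
def BcastState.update (t : ℕ) (r : Option Bits) : BcastState → BcastState
  | some p => some p
  | none => r.map fun y => (t + 1, y)

/-- The `k` time steps from time `t` on: in time step `t` the nodes that were informed within the
first `start t` steps transmit with probability `2 ^ (- level t)`. -/
noncomputable def bcastSteps (level start : ℕ → ℕ) : ℕ → ℕ → BcastState → Prog BcastState
  | 0, _, σ => Prog.done σ
  | k + 1, t, σ => Prog.coin (2⁻¹ ^ level t) (pow_le_one₀ (by simp) (by norm_num)) fun b =>
      Prog.step (if b then σ.activeAt (start t) else none) fun r =>
        bcastSteps level start k (t + 1) (σ.update t r)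

theorem hasDuration_bcastSteps (level start : ℕ → ℕ) : ∀ (k t : ℕ) (σ : BcastState),
    (bcastSteps level start k t σ).HasDuration k
  | 0, _, _ => rfl
  | k + 1, t, _ => fun _ => ⟨k, rfl, fun _ => hasDuration_bcastSteps level start k (t + 1) _⟩

theorem bounded_bcastSteps (level start : ℕ → ℕ) (M : ℕ) : ∀ (k t : ℕ) (σ : BcastState),
    (∀ p ∈ σ, p.2.length ≤ M) →
      (bcastSteps level start k t σ).Bounded M fun σ => ∀ p ∈ σ, p.2.length ≤ M
  | 0, _, _, h => h
  | k + 1, t, σ, h => fun b => by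
    refine ⟨fun y hy => ?_, fun r hr => bounded_bcastSteps level start M k (t + 1) _ ?_⟩
    · split_ifs at hy
      · cases σ with
        | none => cases hy
        | some p =>
          simp only [BcastState.activeAt] at hy
          split_ifs at hy
          · obtain rfl := Option.some_injective _ hy
            exact h p rfl
          · cases hy
      · cases hy
    · intro p hp
      cases σ with
      | some q => exact h p hp
      | none =>
        simp only [BcastState.update, Option.mem_def, Option.map_eq_some_iff] at hp
        obtain ⟨y, hy, rfl⟩ := hp
        exact hr y hy

/-! ### The joint law of the broadcast states -/

section Run

variable {V : Type} (G : Digraph V) (level start : ℕ → ℕ)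

/-- The states after the time step `t` in which the nodes have coins `b`. -/
noncomputable def bcastNext (t : ℕ) (σ : V → BcastState) (b : V → Bool) (v : V) : BcastState :=
  (σ v).update t (received G (fun u => if b u then (σ u).activeAt (start t) else none) v)

/-- The second states may be reached from the first ones between the two times. -/
structure Extends {V : Type} (t t' : ℕ) (σ σ' : V → BcastState) : Prop where
  keep : ∀ v p, σ v = some p → σ' v = some p
  new : ∀ v τ y, σ v = none → σ' v = some (τ, y) →
    t < τ ∧ τ ≤ t' ∧ ∃ u τ', σ u = some (τ', y)

theorem extends_next (t : ℕ) (σ : V → BcastState) (b : V → Bool) :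
    Extends t (t + 1) σ (bcastNext G start t σ b) where
  keep v p h := by simp [bcastNext, h, BcastState.update]
  new v τ y h h' := by
    simp only [bcastNext, h, BcastState.update, Option.map_eq_some_iff, Prod.mk.injEq] at h'
    obtain ⟨y', hy', rfl, rfl⟩ := h'
    refine ⟨by omega, by omega, ?_⟩
    obtain ⟨u, -, hu⟩ := exists_of_received G hy'
    refine ⟨u, ?_⟩
    split_ifs at hu
    cases hσ : σ u with
    | none => rw [hσ] at hu; cases hu
    | some p =>
      obtain ⟨τ', y⟩ := p
      rw [hσ] at hu
      simp only [BcastState.activeAt] at hu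
      split_ifs at hu
      obtain rfl := Option.some_injective _ hu
      exact ⟨τ', rfl⟩

theorem Extends.trans {V : Type} {t t' t'' : ℕ} {σ σ' σ'' : V → BcastState}
    (h : Extends t t' σ σ') (h' : Extends t' t'' σ' σ'') (htt : t ≤ t') (htt' : t' ≤ t'') :
    Extends t t'' σ σ'' where
  keep v p hp := h'.keep v p (h.keep v p hp)
  new v τ y hn hs := by
    cases hσ : σ' v with
    | some p =>
      have := h'.keep v p hσ
      rw [hs] at this
      obtain rfl := Option.some_injective _ this
      obtain ⟨h1, h2, h3⟩ := h.new v τ y hn hσ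
      exact ⟨h1, h2.trans htt', h3⟩
    | none =>
      obtain ⟨h1, h2, u, τ', hu⟩ := h'.new v τ y hσ hs
      refine ⟨htt.trans_lt h1, h2, ?_⟩
      cases hσu : σ u with
      | some p =>
        have := h.keep u p hσu
        rw [hu] at this
        obtain rfl := Option.some_injective _ this
        exact ⟨u, τ', hσu⟩
      | none => exact (h.new u τ' y hσu hu).2.2

variable [Fintype V]

/-- The law of the states after the `k` time steps from time `t` on. -/
noncomputable def bcastRun : ℕ → ℕ → (V → BcastState) → PMF (V → BcastState)
  | 0, _, σ => PMF.pure σ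
  | k + 1, t, σ => (indep fun _ : V => coinPMF (2⁻¹ ^ level t)
      (pow_le_one₀ (by simp) (by norm_num))).bind fun b =>
        bcastRun k (t + 1) (bcastNext G start t σ b)

theorem expect_bcastSteps (φ : (V → BcastState) → ℝ≥0∞) : ∀ (k t : ℕ) (σ : V → BcastState),
    expect G k (fun v => bcastSteps level start k t (σ v)) φ =
      mean (bcastRun G level start k t σ) φ
  | 0, t, σ => by
    simp only [bcastSteps, bcastRun]
    rw [expect_done, mean_pure]
  | k + 1, t, σ => by
    simp only [bcastSteps, bcastRun]
    rw [expect_coin, mean_bind]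
    congr 1
    funext b
    rw [expect_step]
    exact expect_bcastSteps φ k (t + 1) _

theorem bcastRun_add (k' : ℕ) : ∀ (k t : ℕ) (σ : V → BcastState),
    bcastRun G level start (k + k') t σ =
      (bcastRun G level start k t σ).bind fun σ' => bcastRun G level start k' (t + k) σ'
  | 0, t, σ => by simp [bcastRun]
  | k + 1, t, σ => by
    rw [show k + 1 + k' = (k + k') + 1 by omega]
    simp only [bcastRun, PMF.bind_bind]
    congr 1
    funext b
    rw [bcastRun_add k' k (t + 1)]
    congr 1
    funext σ'
    congr 1
    omega

theorem extends_of_mem_support : ∀ {k t : ℕ} {σ σ' : V → BcastState},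
    σ' ∈ (bcastRun G level start k t σ).support → Extends t (t + k) σ σ'
  | 0, t, σ, σ', h => by
    simp only [bcastRun, PMF.support_pure, Set.mem_singleton_iff] at h
    subst h
    exact ⟨fun _ _ h => h, fun v τ y h h' => by rw [h] at h'; cases h'⟩
  | k + 1, t, σ, σ', h => by
    obtain ⟨b, -, hb⟩ := (PMF.mem_support_bind_iff _ _ _).1 h
    have := (extends_next G start t σ b).trans (extends_of_mem_support hb) (by omega) (by omega)
    rwa [show t + (k + 1) = t + 1 + k by omega]

theorem mean_bcastRun_add_le {k k' t : ℕ} {σ : V → BcastState} {φ : (V → BcastState) → ℝ≥0∞}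
    {c : ℝ≥0∞}
    (h : ∀ σ', Extends t (t + k) σ σ' → mean (bcastRun G level start k' (t + k) σ') φ ≤ c) :
    mean (bcastRun G level start (k + k') t σ) φ ≤ c := by
  rw [bcastRun_add, mean_bind]
  exact (mean_mono_support fun σ' hσ' =>
    h σ' (extends_of_mem_support G level start hσ')).trans (mean_const _ _).le

end Run

/-! ### Progress along a walk -/

/-- A walk `π 1, …, π L` towards `target`, in which every node is ranked by the last node of the
walk to which it has an edge. -/
structure RankedWalk {V : Type} (G : Digraph V) (target : V) (L : ℕ) where
  π : ℕ → V
  rank : V → ℕ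
  lt_rank : ∀ i, 1 ≤ i → i ≤ L → i < rank (π i)
  adj_of_rank_eq : ∀ u i, 1 ≤ i → i ≤ L → rank u = i → G.Adj u (π i)
  le_rank_of_adj : ∀ u i, 1 ≤ i → i ≤ L → G.Adj u (π i) → i ≤ rank u
  eq_target : ∀ u, L < rank u → u = target

theorem exists_walk {V : Type} (G : Digraph V) {s : V} : ∀ {k : ℕ} {v : V}, ReachIn G k s v →
    ∃ π : ℕ → V, π 0 = s ∧ π k = v ∧ ∀ i < k, G.Adj (π i) (π (i + 1))
  | 0, v, h => ⟨fun _ => s, rfl, h, fun i hi => by omega⟩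
  | k + 1, v, ⟨w, hw, hwv⟩ => by
    obtain ⟨π, h0, hk, hadj⟩ := exists_walk G hw
    refine ⟨fun i => if i ≤ k then π i else v, by simp [h0], by simp, fun i hi => ?_⟩
    rcases Nat.lt_or_ge i k with h | h
    · simp only [if_pos h.le, if_pos (Nat.succ_le_of_lt h)]
      exact hadj i h
    · obtain rfl : i = k := by omega
      simpa [hk] using hwv

/-- The target receives rank `k + 1` by decree; any other node has as rank the last index in `1, …,
k` of a walk node to which it has an edge, or 0. The start has rank at least 1 through its edge to
`π 1`, or because it is the target. -/
theorem exists_rankedWalk {V : Type} (G : Digraph V) {s v : V} {k : ℕ} (h : ReachIn G k s v) :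
    ∃ R : RankedWalk G v k, 1 ≤ R.rank s := by
  classical
  obtain ⟨π, h0, hk, hadj⟩ := exists_walk G h
  let rank : V → ℕ := fun u => if u = v then k + 1
    else ((Finset.Icc 1 k).filter fun i => G.Adj u (π i)).sup id
  have hle : ∀ u i, 1 ≤ i → i ≤ k → G.Adj u (π i) → i ≤ rank u := by
    intro u i h1 h2 h3
    by_cases hu : u = v
    · simp only [rank, if_pos hu]; omega
    · simp only [rank, if_neg hu]
      exact Finset.le_sup (f := id) (by simp [h1, h2, h3])
  have hlt : ∀ i, i ≤ k → i < rank (π i) := by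
    intro i hi
    rcases Nat.lt_or_ge i k with h | h
    · exact hle (π i) (i + 1) (by omega) (by omega) (hadj i h)
    · obtain rfl : i = k := by omega
      simp [rank, hk]
  refine ⟨⟨π, rank, fun i _ => hlt i, ?_, hle, ?_⟩, ?_⟩
  · intro u i h1 h2 h3
    by_cases hu : u = v
    · simp only [rank, if_pos hu] at h3; omega
    · simp only [rank, if_neg hu] at h3
      rcases Finset.eq_empty_or_nonempty ((Finset.Icc 1 k).filter fun i => G.Adj u (π i)) with
        he | hne
      · rw [he] at h3; simp at h3; omega
      · obtain ⟨j, hj, hj'⟩ := Finset.exists_mem_eq_sup _ hne id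
        rw [hj'] at h3
        simp only [id] at h3
        subst h3
        exact (Finset.mem_filter.1 hj).2
  · intro u hu
    by_contra hne
    simp only [rank, if_neg hne] at hu
    refine absurd hu (not_lt.2 (Finset.sup_le fun i hi => ?_))
    exact (Finset.mem_Icc.1 (Finset.mem_filter.1 hi).1).2
  · have := hlt 0 (by omega)
    rw [h0] at this
    exact this

/-- Every stretch of `w` time steps contains a time `a` and, after it, for each `j ≤ r` a time step
of level `j` for those informed by time `a`. -/
def Schedules (level start : ℕ → ℕ) (r w : ℕ) : Prop :=
  ∀ a₀, ∃ a ≥ a₀, ∀ j ≤ r, ∃ t, a ≤ t ∧ t < a₀ + w ∧ level t = j ∧ start t = a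

section Progress

variable {V : Type} {G : Digraph V} {level start : ℕ → ℕ} {target : V} {L : ℕ}

/-- Some informed node has rank at least `i`. -/
def RankedWalk.Reached (R : RankedWalk G target L) (i : ℕ) (σ : V → BcastState) : Prop :=
  ∃ u, σ u ≠ none ∧ i ≤ R.rank u

theorem RankedWalk.Reached.extends {R : RankedWalk G target L} {i t t' : ℕ}
    {σ σ' : V → BcastState} (h : R.Reached i σ) (h' : Extends t t' σ σ') : R.Reached i σ' := by
  obtain ⟨u, hu, hi⟩ := h
  obtain ⟨p, hp⟩ := Option.ne_none_iff_exists'.1 hu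
  exact ⟨u, by simp [h'.keep u p hp], hi⟩

theorem timely_of_extends {t t' : ℕ} {σ σ' : V → BcastState} (htt : t ≤ t')
    (h : ∀ v p, σ v = some p → p.1 ≤ t) (h' : Extends t t' σ σ') :
    ∀ v p, σ' v = some p → p.1 ≤ t' := by
  intro v p hp
  cases hσ : σ v with
  | some q =>
    have := h'.keep v q hσ
    rw [hp] at this
    obtain rfl := Option.some_injective _ this
    exact (h v p hσ).trans htt
  | none => exact (h'.new v p.1 p.2 hσ hp).2.1

variable [Fintype V]

open Classical in
theorem RankedWalk.mean_reached_eq_zero {R : RankedWalk G target L} {i k t : ℕ}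
    {σ : V → BcastState} (h : R.Reached i σ) :
    mean (bcastRun G level start k t σ) (fun σ' => if R.Reached i σ' then 0 else 1) = 0 := by
  refine le_antisymm ((mean_mono_support fun σ' hσ' => ?_).trans (mean_const _ 0).le) bot_le
  rw [if_pos (h.extends (extends_of_mem_support G level start hσ'))]

open Classical in
-- As no informed node has rank above `i`, every informed in-neighbour of `π i` has rank exactly
-- `i`, and those allowed to transmit are the ones informed by time `a`. The level fits their
-- number. The node `π i` has rank above `i`, so it is uninformed and listens; a unique transmission
-- informs it.
theorem RankedWalk.mean_step_le (R : RankedWalk G target L) {i a t : ℕ}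
    (hi1 : 1 ≤ i) (hiL : i ≤ L) {σa σ : V → BcastState} (hext : Extends a t σa σ)
    (htime : ∀ v p, σa v = some p → p.1 ≤ a) (hnot : ¬ R.Reached (i + 1) σ)
    (hne : R.Reached i σa) (hstart : start t = a)
    (hlevel : level t =
      Nat.clog 2 (Finset.univ.filter fun u => R.rank u = i ∧ σa u ≠ none).card) :
    mean (bcastRun G level start 1 t σ) (fun σ' => if R.Reached (i + 1) σ' then 0 else 1) ≤
      7 / 8 := by
  set A := Finset.univ.filter fun u => R.rank u = i ∧ σa u ≠ none with hA
  have hrank : ∀ u, σ u ≠ none → R.rank u ≤ i := fun u hu => by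
    by_contra hc
    exact hnot ⟨u, hu, by omega⟩
  have hApos : 0 < A.card := by
    obtain ⟨u, hu, hui⟩ := hne
    obtain ⟨p, hp⟩ := Option.ne_none_iff_exists'.1 hu
    have := hrank u (by simp [hext.keep u p hp])
    exact Finset.card_pos.2 ⟨u, by simp [hA, hu]; omega⟩
  obtain ⟨h1, h2⟩ := half_le_card_mul hApos (Or.inl hlevel)
  simp only [bcastRun]
  rw [mean_bind]
  simp only [mean_pure]
  refine le_trans (mean_mono fun b => ?_) (mean_not_existsUnique_le A
    (pow_le_one₀ (by simp) (by norm_num)) h1 h2)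
  by_cases hex : ∃! u, u ∈ A ∧ b u = true
  swap
  · rw [if_neg hex]; split_ifs <;> simp
  rw [if_pos hex, if_pos]
  obtain ⟨u, ⟨huA, hub⟩, huu⟩ := hex
  simp only [hA, Finset.mem_filter, Finset.mem_univ, true_and] at huA huu
  have hnone : σ (R.π i) = none := by
    by_contra hc
    have := hrank _ hc
    have := R.lt_rank i hi1 hiL
    omega
  obtain ⟨⟨τ, y⟩, hσau⟩ := Option.ne_none_iff_exists'.1 huA.2
  have hact : (σ u).activeAt (start t) = some y := by
    rw [hext.keep u _ hσau, hstart, BcastState.activeAt, if_pos (htime u _ hσau)]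
  have hheard : heard G (fun u => if b u then (σ u).activeAt (start t) else none) (R.π i) =
      some y := by
    have := heard_eq_of_unique G (x := fun u => if b u then (σ u).activeAt (start t) else none)
      (R.adj_of_rank_eq u i hi1 hiL huA.1) (by simp [hub, hact]) fun w hw hwx => huu w (by
        by_cases hb : b w = true
        swap
        · simp [hb] at hwx
        simp only [hb, if_true] at hwx
        cases hσw : σ w with
        | none => simp [hσw, BcastState.activeAt] at hwx
        | some p =>
          obtain ⟨τ', y'⟩ := p
          have hle : τ' ≤ a := by
            by_contra hc
            simp [hσw, BcastState.activeAt, hstart, hc] at hwx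
          have hw1 : R.rank w = i := le_antisymm (hrank w (by simp [hσw]))
            (R.le_rank_of_adj w i hi1 hiL hw)
          refine ⟨⟨hw1, fun hc => ?_⟩, hb⟩
          have := (hext.new w τ' y' hc hσw).1
          omega)
    rw [this]
    simp [hub, hact]
  refine ⟨R.π i, ?_, R.lt_rank i hi1 hiL⟩
  have hrec : received G (fun u => if b u then (σ u).activeAt (start t) else none) (R.π i) =
      some y := by
    rw [received, if_pos, hheard]
    simp [hnone, BcastState.activeAt]
  simp [bcastNext, hrec, hnone, BcastState.update]

open Classical in
-- The nodes do not know how many of rank `i` are informed, so the window offers every level up to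
-- the one for the whole layer. Participation is frozen at time `a`, hence this number cannot change
-- before the fitting level comes up.
theorem RankedWalk.mean_window_le (R : RankedWalk G target L) {i r w t : ℕ}
    (hi1 : 1 ≤ i) (hiL : i ≤ L)
    (hr : Nat.clog 2 (Finset.univ.filter fun u => R.rank u = i).card ≤ r)
    (hw : Schedules level start r w) {σ : V → BcastState}
    (htime : ∀ v p, σ v = some p → p.1 ≤ t) (hreach : R.Reached i σ) :
    mean (bcastRun G level start w t σ) (fun σ' => if R.Reached (i + 1) σ' then 0 else 1) ≤
      7 / 8 := by
  obtain ⟨a, hat, hsch⟩ := hw t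
  have haw : a < t + w := by
    obtain ⟨t', h1, h2, -⟩ := hsch 0 (Nat.zero_le _)
    omega
  rw [show w = (a - t) + (t + w - a) by omega]
  refine mean_bcastRun_add_le G level start fun σa hσa => ?_
  rw [show t + (a - t) = a by omega] at hσa ⊢
  by_cases hra : R.Reached (i + 1) σa
  · rw [R.mean_reached_eq_zero hra]; exact bot_le
  have hcard : (Finset.univ.filter fun u => R.rank u = i ∧ σa u ≠ none).card ≤
      (Finset.univ.filter fun u => R.rank u = i).card :=
    Finset.card_le_card fun u hu => by
      simp only [Finset.mem_filter, Finset.mem_univ, true_and] at hu ⊢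
      exact hu.1
  obtain ⟨t', h1, h2, hlevel, hstart⟩ := hsch _ ((Nat.clog_mono_right 2 hcard).trans hr)
  rw [show t + w - a = (t' - a) + (1 + (t + w - t' - 1)) by omega]
  refine mean_bcastRun_add_le G level start fun σ' hσ' => ?_
  rw [show a + (t' - a) = t' by omega] at hσ' ⊢
  by_cases hr' : R.Reached (i + 1) σ'
  · rw [R.mean_reached_eq_zero hr']; exact bot_le
  rw [bcastRun_add, mean_bind]
  refine (mean_mono fun σ'' => ?_).trans (R.mean_step_le hi1 hiL hσ'
    (timely_of_extends hat htime hσa) hr' (hreach.extends hσa) hstart hlevel)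
  by_cases hr'' : R.Reached (i + 1) σ''
  · rw [R.mean_reached_eq_zero hr'']; exact bot_le
  · rw [if_neg hr'']
    exact mean_le_of_le fun _ => by split_ifs <;> simp

/-- The left side is a weighted mean of 1 and `y ≤ 1`, so it is largest when the weight `p₀` of 1
has its largest value 7/8. -/
theorem add_mul_le_of_le {p₀ p₁ y z : ℝ≥0∞} (h : p₀ + p₁ = 1) (h₀ : p₀ ≤ 7 / 8) (hy : y ≤ 1)
    (hz : 7 / 8 + 1 / 8 * y ≤ z) : p₀ + p₁ * y ≤ z := by
  refine le_trans ?_ hz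
  have h78 : (7 / 8 : ℝ≥0∞) + 1 / 8 = 1 := by
    rw [ENNReal.div_add_div_same]
    norm_num
    exact ENNReal.div_self (by norm_num) (by norm_num)
  have hp₀ : p₀ ≠ ∞ := ne_top_of_le_ne_top (by finiteness) h₀
  obtain ⟨d, hd⟩ := exists_add_of_le h₀
  have hp₁ : p₁ = d + 1 / 8 := by
    refine (ENNReal.add_right_inj hp₀).1 ((h.trans h78.symm).trans ?_)
    rw [hd, add_assoc]
  calc p₀ + p₁ * y = p₀ + d * y + 1 / 8 * y := by rw [hp₁]; ring
    _ ≤ p₀ + d * 1 + 1 / 8 * y := by gcongr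
    _ = _ := by rw [hd, mul_one]

open Classical in
-- An exponential moment bound for a sum of geometric waiting times. In layer `i` every window of `w
-- i` steps succeeds with probability at least 1/8. By `hxw`, the number M = x^(-16 w_i) satisfies
-- x^(-w_i) (7/8 M + 1/8) ≤ M, so it dominates the moment of the time spent in the layer. The
-- conclusion is Markov's inequality, multiplied out so that no inverses occur.
theorem RankedWalk.mean_uninformed_mul_le (R : RankedWalk G target L) {w : ℕ → ℕ} {x : ℝ≥0∞}
    (hx : x ≤ 1)
    (hw : ∀ i, 1 ≤ i → i ≤ L → Schedules level start
      (Nat.clog 2 (Finset.univ.filter fun u => R.rank u = i).card) (w i))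
    (hxw : ∀ i, 1 ≤ i → i ≤ L → 7 / 8 + 1 / 8 * x ^ (16 * w i) ≤ x ^ w i) :
    ∀ (k i t : ℕ) (σ : V → BcastState), 1 ≤ i → i ≤ L + 1 →
      (∀ v p, σ v = some p → p.1 ≤ t) → R.Reached i σ →
      mean (bcastRun G level start k t σ) (fun σ' => if σ' target = none then 1 else 0) *
        x ^ (16 * ∑ j ∈ Finset.Ico i (L + 1), w j) ≤ x ^ k := by
  intro k
  induction k using Nat.strong_induction_on with
  | _ k ih =>
  intro i t σ hi1 hiL htime hreach
  have hle1 : mean (bcastRun G level start k t σ) (fun σ' => if σ' target = none then 1 else 0) ≤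
      1 := mean_le_of_le fun _ => by split_ifs <;> simp
  rcases Nat.lt_or_ge L i with hi | hi
  · have h0 : mean (bcastRun G level start k t σ)
        (fun σ' => if σ' target = none then 1 else 0) = 0 := by
      refine le_antisymm ((mean_mono_support fun σ' hσ' => ?_).trans (mean_const _ 0).le) bot_le
      obtain ⟨u, hu, hui⟩ := hreach.extends (extends_of_mem_support G level start hσ')
      obtain rfl := R.eq_target u (by omega)
      rw [if_neg hu]
    rw [h0, zero_mul]
    exact bot_le
  have hsum : ∑ j ∈ Finset.Ico i (L + 1), w j = w i + ∑ j ∈ Finset.Ico (i + 1) (L + 1), w j :=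
    Finset.sum_eq_sum_Ico_succ_bot (by omega) w
  rcases Nat.lt_or_ge k (w i) with hk | hk
  -- Less than one window is left; the bound is then trivial because `k < w i` and `w i` is part of
  -- the sum in the exponent.
  · calc _ ≤ 1 * x ^ (16 * ∑ j ∈ Finset.Ico i (L + 1), w j) := by gcongr
      _ ≤ x ^ k := by
        rw [one_mul]
        exact pow_le_pow_of_le_one bot_le hx (by rw [hsum]; omega)
  · have hwpos : 0 < w i := by
      obtain ⟨a, ha, hsch⟩ := hw i hi1 hi 0
      obtain ⟨t', h1, h2, -⟩ := hsch 0 (Nat.zero_le _)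
      omega
    obtain ⟨k', rfl⟩ := Nat.exists_eq_add_of_le hk
    set S := ∑ j ∈ Finset.Ico (i + 1) (L + 1), w j
    rw [bcastRun_add, mean_bind, hsum, mul_comm, ← mean_const_mul]
    -- Success moves on to layer `i + 1` and leaves a factor `x ^ (16 * w i)` to spare; failure
    -- repeats layer `i` with fewer steps left.
    have hpt : ∀ σ' ∈ (bcastRun G level start (w i) t σ).support,
        x ^ (16 * (w i + S)) * mean (bcastRun G level start k' (t + w i) σ')
          (fun σ' => if σ' target = none then 1 else 0) ≤
        x ^ k' * ((if R.Reached (i + 1) σ' then 0 else 1) +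
          x ^ (16 * w i) * (if R.Reached (i + 1) σ' then 1 else 0)) := by
      intro σ' hσ'
      have hext := extends_of_mem_support G level start hσ'
      have htime' := timely_of_extends (by omega) htime hext
      split_ifs with hr
      · have := ih k' (by omega) (i + 1) (t + w i) σ' (by omega) (by omega) htime' hr
        rw [zero_add, mul_one, mul_add, pow_add, mul_comm (x ^ k'), mul_assoc]
        refine mul_le_mul_right ?_ _
        rwa [mul_comm]
      · have := ih k' (by omega) i (t + w i) σ' hi1 hiL htime' (hreach.extends hext)
        rw [hsum] at this
        rw [mul_zero, add_zero, mul_one, mul_comm]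
        exact this
    refine (mean_mono_support hpt).trans ?_
    rw [mean_const_mul, mean_add, mean_const_mul, pow_add, mul_comm]
    refine mul_le_mul_left ?_ _
    rw [mul_comm (x ^ (16 * w i))]
    refine add_mul_le_of_le ?_ (R.mean_window_le hi1 hi le_rfl (hw i hi1 hi) htime hreach)
      (pow_le_one₀ bot_le hx) (hxw i hi1 hi)
    rw [← mean_add]
    refine Eq.trans ?_ (mean_const (bcastRun G level start (w i) t σ) 1)
    congr 1
    funext σ'
    split_ifs <;> simp

end Progress

/-! ### The schedule -/

/-- The level of time step `t`: the even steps repeat the levels `0, …, Λ - 1`; the odd steps have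
the levels `e p, …, e p + p - 1` at a fraction `2 ^ (-e-1)` of the time. -/
def mixedLevel (Λ p t : ℕ) : ℕ :=
  if t % 2 = 0 then t / 2 % Λ
  else padicValNat 2 (t / 2 + 1) * p + (t / 2 + 1) / 2 ^ (padicValNat 2 (t / 2 + 1) + 1) % p

/-- The time by which a node has to be informed in order to take part in time step `t`. -/
def mixedStart (Λ p t : ℕ) : ℕ :=
  if t % 2 = 0 then 2 * Λ * (t / 2 / Λ)
  else 2 * (p * 2 ^ (padicValNat 2 (t / 2 + 1) + 1)) *
    (t / 2 / (p * 2 ^ (padicValNat 2 (t / 2 + 1) + 1)))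

theorem exists_multiple (a P : ℕ) (hP : 0 < P) : ∃ M, a ≤ P * M ∧ P * M ≤ a + P := by
  refine ⟨a / P + 1, ?_, ?_⟩
  · have := Nat.lt_mul_div_succ a hP
    omega
  · have := Nat.mul_div_le a P
    rw [mul_add, mul_one]
    omega

/-- The even steps cycle through all levels in blocks of `2 * Λ` time steps, and a stretch of twice
that length contains a whole block. -/
theorem schedules_even {Λ p r : ℕ} (hr : r < Λ) :
    Schedules (mixedLevel Λ p) (mixedStart Λ p) r (4 * Λ) := by
  intro a₀
  obtain ⟨M, h1, h2⟩ := exists_multiple a₀ (2 * Λ) (by omega)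
  refine ⟨2 * Λ * M, h1, fun j hj => ⟨2 * (Λ * M + j), ?_, ?_, ?_, ?_⟩⟩
  · rw [mul_assoc]; omega
  · rw [mul_assoc] at h2; omega
  · have h3 : 2 * (Λ * M + j) % 2 = 0 := by omega
    have h4 : 2 * (Λ * M + j) / 2 = Λ * M + j := by omega
    rw [mixedLevel, if_pos h3, h4, Nat.mul_add_mod, Nat.mod_eq_of_lt (by omega)]
  · have h3 : 2 * (Λ * M + j) % 2 = 0 := by omega
    have h4 : 2 * (Λ * M + j) / 2 = Λ * M + j := by omega
    rw [mixedStart, if_pos h3, h4, Nat.mul_add_div (by omega), Nat.div_eq_of_lt (by omega),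
      add_zero]

/-- The number `u + 1` has 2-adic valuation `e` once in `2 ^ (e + 1)` odd steps, so one run through
the `p` levels of block `e` takes `p * 2 ^ (e + 1)` odd steps. These periods divide the longest one,
`P`; therefore at time `2 * P * M` a run begins in all blocks up to `r / p` simultaneously. -/
theorem schedules_odd (Λ : ℕ) {p : ℕ} (r : ℕ) (hp : 1 ≤ p) :
    Schedules (mixedLevel Λ p) (mixedStart Λ p) r (4 * (p * 2 ^ (r / p + 1))) := by
  intro a₀
  set E := r / p with hE
  set P := p * 2 ^ (E + 1) with hP
  have hPpos : 0 < P := by positivity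
  obtain ⟨M, h1, h2⟩ := exists_multiple a₀ (2 * P) (by omega)
  refine ⟨2 * P * M, h1, fun j hj => ?_⟩
  set e := j / p with he
  have heE : e ≤ E := Nat.div_le_div_right hj
  -- The step sought for level `j` is the odd step with `u + 1 = 2 ^ e * (2 * ix + 1)`: this has
  -- valuation `e`, and `ix` is congruent to `j` modulo `p`.
  set ix := p * 2 ^ (E - e) * M + j % p with hix
  have hjp : j % p < p := Nat.mod_lt _ (by omega)
  have hPe : p * 2 ^ (e + 1) * 2 ^ (E - e) = P := by
    rw [hP, mul_assoc, ← pow_add]; congr 2; omega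
  have hpe : p * 2 ^ (e + 1) ≤ P := by
    rw [← hPe]; exact Nat.le_mul_of_pos_right _ (by positivity)
  have hkey : 2 ^ e * (2 * ix + 1) = P * M + 2 ^ (e + 1) * (j % p) + 2 ^ e := by
    rw [hix, ← hPe, pow_succ]; ring
  have h2e : 1 ≤ 2 ^ e := Nat.one_le_two_pow
  have hup : 2 ^ (e + 1) * (j % p) + 2 ^ (e + 1) ≤ p * 2 ^ (e + 1) := by
    rw [← Nat.mul_succ, mul_comm]; exact Nat.mul_le_mul_right _ hjp
  have h2e' : 2 ^ (e + 1) = 2 * 2 ^ e := pow_succ' 2 e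
  set u := P * M + 2 ^ (e + 1) * (j % p) + 2 ^ e - 1 with hu
  have hu1 : u + 1 = 2 ^ e * (2 * ix + 1) := by omega
  have hval : padicValNat 2 (u + 1) = e := by
    rw [hu1, padicValNat.mul (by positivity) (by omega), padicValNat.prime_pow,
      padicValNat.eq_zero_of_not_dvd (by omega), add_zero]
  have hdiv : (u + 1) / 2 ^ (e + 1) = ix := by
    rw [hu1, pow_succ, Nat.mul_div_mul_left _ _ (by positivity)]; omega
  have hmod : ix % p = j % p := by
    rw [hix, mul_assoc, Nat.mul_add_mod, Nat.mod_mod]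
  have hPM : 2 * P * M = 2 * (P * M) := mul_assoc _ _ _
  have hdiv' : u / (p * 2 ^ (e + 1)) = 2 ^ (E - e) * M := by
    have hPM' : p * 2 ^ (e + 1) * (2 ^ (E - e) * M) = P * M := by rw [← mul_assoc, hPe]
    refine Nat.div_eq_of_lt_le ?_ ?_
    · rw [mul_comm, hPM']; omega
    · rw [mul_comm, mul_add, mul_one, hPM']; omega
  have hodd : (2 * u + 1) % 2 ≠ 0 := by omega
  have hhalf : (2 * u + 1) / 2 = u := by omega
  refine ⟨2 * u + 1, by omega, by omega, ?_, ?_⟩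
  · rw [mixedLevel, if_neg hodd, hhalf, hval, hdiv, hmod, he]
    exact Nat.div_add_mod' j p
  · rw [mixedStart, if_neg hodd, hhalf, hval, hdiv', mul_assoc, mul_assoc, ← hPe]
    ring

/-- A stretch of time in which a layer of `m` nodes is likely to be passed. -/
def layerTime (Λ p m : ℕ) : ℕ := min (4 * Λ) (4 * (p * 2 ^ (Nat.clog 2 m / p + 1)))

theorem schedules_layerTime {Λ p m : ℕ} (hp : 1 ≤ p) (hm : Nat.clog 2 m < Λ) :
    Schedules (mixedLevel Λ p) (mixedStart Λ p) (Nat.clog 2 m) (layerTime Λ p m) := by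
  rcases min_choice (4 * Λ) (4 * (p * 2 ^ (Nat.clog 2 m / p + 1))) with h | h
  · rw [layerTime, h]; exact schedules_even hm
  · rw [layerTime, h]; exact schedules_odd Λ _ hp

/-- If `r ≥ p`, then `r / p + p ≤ r + 1`, because a product of two positive integers is at least
their sum minus one; and `2 ^ (r - 1) < m`. -/
theorem two_pow_clog_div_mul_le (p m : ℕ) (hp : 1 ≤ p) :
    2 ^ (Nat.clog 2 m / p) * 2 ^ p ≤ 2 ^ p + 4 * m := by
  set r := Nat.clog 2 m with hr
  rcases Nat.lt_or_ge r p with h | h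
  · rw [Nat.div_eq_of_lt h]; omega
  · have hm : 1 < m := by
      by_contra hc
      have : r = 0 := Nat.clog_of_right_le_one (by omega) 2
      omega
    have h1 : 2 ^ (r - 1) < m := by simpa using Nat.pow_pred_clog_lt_self (by norm_num) hm
    have h2 : r / p + p ≤ r + 1 := by
      have h3 := Nat.div_add_mod r p
      have h4 : 1 ≤ r / p := (Nat.one_le_div_iff (by omega)).2 h
      obtain ⟨d, hd⟩ := Nat.exists_eq_add_of_le h4
      obtain ⟨q, rfl⟩ := Nat.exists_eq_add_of_le hp
      rw [hd] at h3 ⊢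
      nlinarith [Nat.zero_le (q * d), Nat.zero_le (r % (1 + q))]
    calc 2 ^ (r / p) * 2 ^ p = 2 ^ (r / p + p) := (pow_add _ _ _).symm
      _ ≤ 2 ^ (r - 1 + 2) := Nat.pow_le_pow_right (by norm_num) (by omega)
      _ = 4 * 2 ^ (r - 1) := by rw [pow_add]; ring
      _ ≤ 2 ^ p + 4 * m := (Nat.mul_le_mul_left 4 h1.le).trans (Nat.le_add_left _ _)

/-- The layers are disjoint, so their sizes add up to at most `n ≤ 2 ^ p * D`. Summing
`two_pow_clog_div_mul_le` over at most `D` layers bounds the sum of the factors `2 ^ (r / p)` by `5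
* D`, and every window is at most `8 * p` times its factor. -/
theorem sum_layerTime_le {V : Type} [Fintype V] {n D L Λ p : ℕ} (hn : Fintype.card V = n)
    (hp : 1 ≤ p) (hnD : n ≤ 2 ^ p * D) (hL : L ≤ D) (rank : V → ℕ) [DecidableEq V] :
    ∑ i ∈ Finset.Ico 1 (L + 1), layerTime Λ p (Finset.univ.filter fun u => rank u = i).card ≤
      40 * (p * D) := by
  set m : ℕ → ℕ := fun i => (Finset.univ.filter fun u => rank u = i).card
  have hsum : ∑ i ∈ Finset.Ico 1 (L + 1), m i ≤ n := by
    rw [← hn, ← Finset.card_univ (α := V), ← Finset.card_biUnion]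
    · exact Finset.card_le_card (Finset.subset_univ _)
    · intro i _ j _ hij
      refine Finset.disjoint_left.2 fun u hu hu' => hij ?_
      simp only [Finset.mem_filter, Finset.mem_univ, true_and] at hu hu'
      exact hu.symm.trans hu'
  have hpow : (∑ i ∈ Finset.Ico 1 (L + 1), 2 ^ (Nat.clog 2 (m i) / p)) ≤ 5 * D := by
    refine Nat.le_of_mul_le_mul_right ?_ (Nat.two_pow_pos p)
    rw [Finset.sum_mul]
    calc _ ≤ ∑ i ∈ Finset.Ico 1 (L + 1), (2 ^ p + 4 * m i) :=
          Finset.sum_le_sum fun i _ => two_pow_clog_div_mul_le p (m i) hp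
      _ = L * 2 ^ p + 4 * ∑ i ∈ Finset.Ico 1 (L + 1), m i := by
          rw [Finset.sum_add_distrib, Finset.mul_sum]; simp
      _ ≤ D * 2 ^ p + 4 * (2 ^ p * D) := by gcongr; exact hsum.trans hnD
      _ = 5 * D * 2 ^ p := by ring
  calc _ ≤ ∑ i ∈ Finset.Ico 1 (L + 1), 8 * p * 2 ^ (Nat.clog 2 (m i) / p) := by
        refine Finset.sum_le_sum fun i _ => (min_le_right _ _).trans (le_of_eq ?_)
        rw [pow_succ]; ring
    _ = 8 * p * ∑ i ∈ Finset.Ico 1 (L + 1), 2 ^ (Nat.clog 2 (m i) / p) := by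
        rw [Finset.mul_sum]
    _ ≤ 8 * p * (5 * D) := by gcongr
    _ = 40 * (p * D) := by ring

/-! ### The rate of progress -/

/-- The base of the exponential bound, for windows of length at most `W`. -/
noncomputable def decayRate (W : ℕ) : ℝ := 1 - 1 / (28 * W)

theorem decayRate_pos {W : ℕ} (hW : 1 ≤ W) : 0 < decayRate W ∧ decayRate W ≤ 1 := by
  have hW' : (1 : ℝ) ≤ W := by exact_mod_cast hW
  have : (1 : ℝ) / (28 * W) ≤ 1 / 28 := by
    apply one_div_le_one_div_of_le <;> linarith
  have h0 : (0 : ℝ) ≤ 1 / (28 * W) := by positivity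
  constructor <;> unfold decayRate <;> linarith

theorem decayRate_pow_le_half {W : ℕ} (hW : 1 ≤ W) : decayRate W ^ (28 * W) ≤ 1 / 2 := by
  have hW' : (1 : ℝ) ≤ W := by exact_mod_cast hW
  calc decayRate W ^ (28 * W) ≤ (Real.exp (-(1 / (28 * W)))) ^ (28 * W) :=
        pow_le_pow_left₀ (decayRate_pos hW).1.le (Real.one_sub_le_exp_neg _) _
    _ = Real.exp (-1) := by
        rw [← Real.exp_nat_mul]
        congr 1
        push_cast
        field_simp
    _ ≤ 1 / 2 := by
        rw [Real.exp_neg, one_div]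
        exact inv_anti₀ (by norm_num) (by have := Real.add_one_le_exp (1 : ℝ); linarith)

/-- Write 1 - η for the rate to the power `w`. Bernoulli's inequality gives η ≤ 1/28, which is small
enough for four squarings to yield 1 - 8η as a bound for the 16th power; this is exactly what is
needed. To first order the exponent 8 would do, and 16 absorbs the quadratic terms. -/
theorem decayRate_window {W w : ℕ} (hW : 1 ≤ W) (hw : w ≤ W) :
    7 / 8 + 1 / 8 * decayRate W ^ (16 * w) ≤ decayRate W ^ w := by
  have hW' : (1 : ℝ) ≤ W := by exact_mod_cast hW
  obtain ⟨h0, h1⟩ := decayRate_pos hW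
  set z := decayRate W ^ w with hz
  have hz1 : z ≤ 1 := pow_le_one₀ h0.le h1
  have hz0 : 27 / 28 ≤ z := by
    have hb := one_add_mul_le_pow (a := -(1 / (28 * (W : ℝ)))) (by
      have : (1 : ℝ) / (28 * W) ≤ 1 / 28 := by apply one_div_le_one_div_of_le <;> linarith
      linarith) W
    have he : (1 : ℝ) + W * -(1 / (28 * (W : ℝ))) = 27 / 28 := by
      field_simp; norm_num
    rw [he, ← sub_eq_add_neg] at hb
    exact hb.trans (pow_le_pow_of_le_one h0.le h1 hw)
  rw [mul_comm 16 w, pow_mul, ← hz]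
  obtain ⟨η, hη⟩ : ∃ η, z = 1 - η := ⟨1 - z, by ring⟩
  have hη0 : 0 ≤ η := by linarith
  have hη1 : η ≤ 1 / 28 := by linarith
  have h2 : z ^ 2 ≤ 1 - 19 / 10 * η := by rw [hη]; nlinarith
  have h4 : (z ^ 2) ^ 2 ≤ 1 - 7 / 2 * η := by
    have : (z ^ 2) ^ 2 ≤ (1 - 19 / 10 * η) ^ 2 := pow_le_pow_left₀ (by positivity) h2 2
    nlinarith
  have h8 : ((z ^ 2) ^ 2) ^ 2 ≤ 1 - 6 * η := by
    have : ((z ^ 2) ^ 2) ^ 2 ≤ (1 - 7 / 2 * η) ^ 2 := pow_le_pow_left₀ (by positivity) h4 2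
    nlinarith
  have h16 : (((z ^ 2) ^ 2) ^ 2) ^ 2 ≤ 1 - 8 * η := by
    have : (((z ^ 2) ^ 2) ^ 2) ^ 2 ≤ (1 - 6 * η) ^ 2 := pow_le_pow_left₀ (by positivity) h8 2
    nlinarith
  have : z ^ 16 = (((z ^ 2) ^ 2) ^ 2) ^ 2 := by ring
  rw [this, hη] at *
  linarith

/-! ### The broadcast procedure -/

/-- The number of levels that are sufficient for most layers of a network. -/
def shortLevels (n D : ℕ) : ℕ := Nat.log 2 (n / D) + 1

/-- A Partial Multi-Broadcast procedure with error probability at most `2 ^ (-c log n)`. -/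
noncomputable def layeredBroadcast (c : ℕ) : MultiBroadcast where
  -- The first term pays for 16 times the sum of all windows, as demanded by the moment bound. In
  -- the second, every stretch of `28 * W` steps, with windows of length at most `W = 4 * (lg n +
  -- 1)`, halves the error.
  time n D := 16 * (40 * (shortLevels n D * D)) + 28 * (4 * (lg n + 1)) * ((c + 1) * lg n)
  run n D _ x := (bcastSteps (mixedLevel (lg n + 1) (shortLevels n D))
    (mixedStart (lg n + 1) (shortLevels n D))
    (16 * (40 * (shortLevels n D * D)) + 28 * (4 * (lg n + 1)) * ((c + 1) * lg n)) 0
    (x.map fun y => (0, y))).bind fun σ => Prog.done (σ.map Prod.snd)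

theorem hasDuration_layeredBroadcast (c n D l : ℕ) (x : Option Bits) :
    ((layeredBroadcast c).run n D l x).HasDuration ((layeredBroadcast c).time n D) :=
  (hasDuration_bcastSteps _ _ _ _ _).bind (t := 0) fun _ => rfl

theorem bounded_layeredBroadcast (c n D l M : ℕ) (x : Option Bits)
    (hx : ∀ y ∈ x, y.length ≤ M) :
    ((layeredBroadcast c).run n D l x).Bounded M fun m => ∀ y ∈ m, y.length ≤ M := by
  refine (bounded_bcastSteps _ _ M _ _ _ fun p hp => ?_).bind fun σ hσ y hy => ?_
  · rw [Option.mem_def, Option.map_eq_some_iff] at hp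
    obtain ⟨y, hy, rfl⟩ := hp
    exact hx y hy
  · rw [Option.mem_def, Option.map_eq_some_iff] at hy
    obtain ⟨p, hp, rfl⟩ := hy
    exact hσ p hp

open Classical in
-- The even steps cap all windows at `W`, which fixes the rate `x`, and the odd steps keep the sum
-- of the windows small. The factor on the left of the moment bound cancels against the first part
-- of the running time.
theorem mean_uninformed_le {V : Type} [Fintype V] {G : Digraph V} {n D L : ℕ}
    (hn : Fintype.card V = n) (hD : 1 ≤ D) (hL : L ≤ D) (c : ℕ) {s v : V}
    (hsv : ReachIn G L s v) {f : V → Option Bits} (hs : f s ≠ none) :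
    mean (bcastRun G (mixedLevel (lg n + 1) (shortLevels n D))
        (mixedStart (lg n + 1) (shortLevels n D)) ((layeredBroadcast c).time n D) 0
        fun v => (f v).map fun y => (0, y))
      (fun σ => if σ v = none then 1 else 0) ≤ 2⁻¹ ^ ((c + 1) * lg n) := by
  obtain ⟨R, hR⟩ := exists_rankedWalk G hsv
  set W := 4 * (lg n + 1) with hW
  have hW1 : 1 ≤ W := by omega
  set p := shortLevels n D with hp
  have hp1 : 1 ≤ p := by rw [hp, shortLevels]; omega
  have hnD : n ≤ 2 ^ p * D := by
    have : n / D < 2 ^ p := Nat.lt_pow_succ_log_self (by norm_num) _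
    exact ((Nat.div_lt_iff_lt_mul hD).1 this).le
  set x := ENNReal.ofReal (decayRate W) with hx
  obtain ⟨hd0, hd1⟩ := decayRate_pos hW1
  have hx1 : x ≤ 1 := by rw [hx, ← ENNReal.ofReal_one]; exact ENNReal.ofReal_le_ofReal hd1
  have hx0 : x ≠ 0 := by rw [hx]; simpa using hd0
  have hpow : ∀ k, x ^ k = ENNReal.ofReal (decayRate W ^ k) := fun k =>
    (ENNReal.ofReal_pow hd0.le k).symm
  have hcardn : ∀ i, (Finset.univ.filter fun u => R.rank u = i).card ≤ n := fun i =>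
    hn ▸ Finset.card_le_univ _
  set w : ℕ → ℕ := fun i =>
    layerTime (lg n + 1) p (Finset.univ.filter fun u => R.rank u = i).card with hw
  have h78 : (7 / 8 : ℝ≥0∞) = ENNReal.ofReal (7 / 8) := by
    rw [ENNReal.ofReal_div_of_pos (by norm_num)]; norm_num
  have h18 : (1 / 8 : ℝ≥0∞) = ENNReal.ofReal (1 / 8) := by
    rw [ENNReal.ofReal_div_of_pos (by norm_num)]; norm_num
  have key := R.mean_uninformed_mul_le (level := mixedLevel (lg n + 1) p)
    (start := mixedStart (lg n + 1) p) (w := w) hx1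
    (fun i _ _ => schedules_layerTime hp1
      (Nat.lt_succ_of_le (Nat.clog_mono_right 2 (hcardn i))))
    (fun i _ _ => by
      rw [hpow, hpow, h78, h18, ← ENNReal.ofReal_mul (by norm_num),
        ← ENNReal.ofReal_add (by norm_num) (by positivity)]
      exact ENNReal.ofReal_le_ofReal (decayRate_window hW1 (min_le_left _ _)))
    ((layeredBroadcast c).time n D) 1 0 (fun v => (f v).map fun y => (0, y)) le_rfl (by omega)
    (fun v q hq => by
      rw [Option.map_eq_some_iff] at hq
      obtain ⟨y, -, rfl⟩ := hq
      exact le_rfl)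
    ⟨s, by simpa using hs, hR⟩
  have hS : ∑ j ∈ Finset.Ico 1 (L + 1), w j ≤ 40 * (p * D) :=
    sum_layerTime_le hn hp1 hnD hL R.rank
  set S := ∑ j ∈ Finset.Ico 1 (L + 1), w j
  have htime : x ^ (layeredBroadcast c).time n D ≤ 2⁻¹ ^ ((c + 1) * lg n) * x ^ (16 * S) := by
    have : (layeredBroadcast c).time n D = 16 * (40 * (p * D)) + 28 * W * ((c + 1) * lg n) := rfl
    rw [this, pow_add, mul_comm, pow_mul x (28 * W)]
    refine mul_le_mul' (pow_le_pow_left₀ bot_le ?_ _)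
      (pow_le_pow_of_le_one bot_le hx1 (by omega))
    rw [hpow]
    refine (ENNReal.ofReal_le_ofReal (decayRate_pow_le_half hW1)).trans (le_of_eq ?_)
    rw [one_div, ENNReal.ofReal_inv_of_pos (by norm_num)]
    norm_num
  exact (ENNReal.mul_le_mul_iff_left (pow_ne_zero _ hx0)
    (ENNReal.pow_ne_top ENNReal.ofReal_ne_top)).1 (key.trans htime)

theorem le_two_pow_lg (n : ℕ) : n ≤ 2 ^ lg n := Nat.le_pow_clog (by norm_num) n

/-- The union bound over the `n` targets uses up one `lg n` in the exponent. The rest is certain: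
strings stem from sources only, no node ever replaces its string, and without sources nothing is
sent. -/
theorem reliable_layeredBroadcast {V : Type} [Fintype V] {G : Digraph V} {n D : ℕ}
    (hn : Fintype.card V = n) (hD : 1 ≤ D) (hG : ∀ u v, ∃ k ≤ D, ReachIn G k u v) (c lmax : ℕ) :
    Reliable (layeredBroadcast c) G n D lmax (2⁻¹ ^ (c * lg n)) where
  hasDuration l x := hasDuration_layeredBroadcast c n D l x
  failure_le l _ f _ := by
    classical
    set level := mixedLevel (lg n + 1) (shortLevels n D) with hlevel
    set start := mixedStart (lg n + 1) (shortLevels n D) with hstart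
    set T := (layeredBroadcast c).time n D with hT
    change failure G T (fun v => (bcastSteps level start T 0
      ((f v).map fun y => (0, y))).bind fun σ => Prog.done (σ.map Prod.snd)) _ ≤ _
    rw [failure_map, failure, expect_bcastSteps G level start _ T 0
      (fun v => (f v).map fun y => (0, y))]
    set σ₀ : V → BcastState := fun v => (f v).map fun y => (0, y) with hσ₀
    have hsource : ∀ {u : V} {τ : ℕ} {y : Bits}, σ₀ u = some (τ, y) → f u = some y := by
      intro u τ y h
      simp only [hσ₀, Option.map_eq_some_iff, Prod.mk.injEq] at h
      obtain ⟨y', hy', -, rfl⟩ := h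
      exact hy'
    have hfrom : ∀ {σ : V → BcastState}, Extends 0 (0 + T) σ₀ σ → ∀ {v : V} {q : ℕ × Bits},
        σ v = some q → ∃ u, f u = some q.2 := by
      intro σ hext v q hq
      cases h0 : σ₀ v with
      | some q' =>
        have := hext.keep v q' h0
        rw [hq] at this
        obtain rfl := Option.some_injective _ this
        exact ⟨v, hsource h0⟩
      | none =>
        obtain ⟨-, -, u, τ', hu⟩ := hext.new v q.1 q.2 h0 hq
        exact ⟨u, hsource hu⟩
    have hown : ∀ {σ : V → BcastState}, Extends 0 (0 + T) σ₀ σ → ∀ v, f v ≠ none →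
        (σ v).map Prod.snd = f v := by
      intro σ hext v hv
      obtain ⟨y, hy⟩ := Option.ne_none_iff_exists'.1 hv
      rw [hext.keep v (0, y) (by simp [hσ₀, hy]), hy]
      rfl
    by_cases hs : ∃ s, f s ≠ none
    · obtain ⟨s, hs⟩ := hs
      refine (mean_mono_support (ψ := fun σ => ∑ v, if σ v = none then 1 else 0)
        fun σ hσ => ?_).trans ?_
      · have hext := extends_of_mem_support G level start hσ
        by_cases hall : ∀ v, σ v ≠ none
        · rw [if_pos]
          · exact bot_le
          · refine ⟨⟨fun h => (hs (h s)).elim, fun _ v => ?_⟩, hown hext⟩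
            obtain ⟨q, hq⟩ := Option.ne_none_iff_exists'.1 (hall v)
            obtain ⟨u, hu⟩ := hfrom hext hq
            exact ⟨u, by simp [hu], by simp [hq, hu]⟩
        · push Not at hall
          obtain ⟨v, hv⟩ := hall
          refine le_trans ?_ (Finset.single_le_sum (fun _ _ => bot_le) (Finset.mem_univ v))
          rw [if_pos hv]
          split_ifs <;> simp
      rw [mean_finset_sum]
      have hterm : ∀ v ∈ (Finset.univ : Finset V), mean (bcastRun G level start T 0 σ₀)
          (fun σ => if σ v = none then 1 else 0) ≤ 2⁻¹ ^ ((c + 1) * lg n) := by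
        intro v _
        obtain ⟨L, hL, hLr⟩ := hG s v
        exact mean_uninformed_le hn hD hL c hLr hs
      refine (Finset.sum_le_sum hterm).trans ?_
      rw [Finset.sum_const, Finset.card_univ, hn, nsmul_eq_mul, add_mul, one_mul, pow_add,
        mul_comm, mul_assoc]
      refine mul_le_of_le_one_right bot_le ?_
      rw [← ENNReal.inv_pow, mul_comm, ← div_eq_mul_inv]
      refine ENNReal.div_le_of_le_mul ?_
      rw [one_mul]
      exact_mod_cast le_two_pow_lg n
    · push Not at hs
      refine (mean_mono_support fun σ hσ => ?_).trans ((mean_const _ 0).le.trans bot_le)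
      have hext := extends_of_mem_support G level start hσ
      rw [if_pos]
      refine ⟨⟨fun _ v => ?_, fun ⟨s, h⟩ => (h (hs s)).elim⟩, hown hext⟩
      dsimp only
      cases hv : σ v with
      | none => rfl
      | some q =>
        obtain ⟨u, hu⟩ := hfrom hext hv
        rw [hs u] at hu
        cases hu

/-! ### Message lengths -/

section Messages

variable {M : ℕ}

theorem bounded_randomBits : ∀ l, (randomBits l).Bounded M fun x => x.length = l
  | 0 => rfl
  | l + 1 => fun _ => (bounded_randomBits l).bind fun x hx => by
      change (_ :: x).length = l + 1
      simp [hx]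

theorem bounded_decay (n : ℕ) {x : Option Bits} (hx : ∀ y ∈ x, y.length ≤ M) :
    (decay n x).Bounded M fun got => ∀ y ∈ got, y.length ≤ M := by
  rw [decay_eq]
  refine Prog.bounded_foldlM _ _ (fun got i hgot b => ⟨?_, fun r hr y hy => ?_⟩) _ (by simp)
  · intro y hy
    split_ifs at hy
    · exact hx y hy
    · cases hy
  · rcases List.mem_append.1 hy with hy | hy
    · exact hgot y hy
    · exact hr y (by simpa using hy)

theorem bounded_decay4 (n : ℕ) {x : Option Bits} (hx : ∀ y ∈ x, y.length ≤ M) :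
    (decay4 n x).Bounded M fun got => ∀ y ∈ got, y.length ≤ M :=
  (bounded_decay n hx).bind fun _ h₁ => (bounded_decay n hx).bind fun _ h₂ =>
    (bounded_decay n hx).bind fun _ h₃ => (bounded_decay n hx).bind fun _ h₄ y hy => by
      simp only [List.mem_append] at hy
      rcases hy with ((hy | hy) | hy) | hy
      exacts [h₁ y hy, h₂ y hy, h₃ y hy, h₄ y hy]

theorem bounded_findWitnesses (n l : ℕ) {m : Bits} (hm : m.length ≤ M) :
    (findWitnesses n l m).Bounded M fun s => s.1.length ≤ M := by
  rw [findWitnesses_eq]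
  refine Prog.bounded_foldlM _ _ (fun s i hs => ?_) _ hm
  refine (bounded_decay4 n fun y hy => ?_).bind fun got hgot => ?_
  · split_ifs at hy
    · obtain rfl := Option.some_injective _ hy
      exact hs
    · cases hy
  · change (ite _ _ _ : Bits × Bool).1.length ≤ M
    split_ifs
    · rcases foldl_max_mem got s.1 with h | h
      · dsimp only; rw [h]; exact hs
      · exact hgot _ h
    · exact hs

/-- The procedure sends and outputs only strings of at most `M` bits. -/
def MultiBroadcast.BoundedBy (B : MultiBroadcast) (n D M : ℕ) : Prop :=
  ∀ l x, (∀ y ∈ x, y.length ≤ M) → (B.run n D l x).Bounded M fun m => ∀ y ∈ m, y.length ≤ M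

variable {B : MultiBroadcast} {n D : ℕ}

theorem bounded_selection (hB : B.BoundedBy n D M) (l : ℕ) {x : Option Bits}
    (hx : ∀ y ∈ x, y.length ≤ M) :
    (selection B n D l x).Bounded M fun _ => True := by
  have hidle : ∀ t, (Prog.idle t).Bounded M fun _ => True := by
    intro t
    induction t with
    | zero => trivial
    | succ t ih => exact ⟨fun y hy => (by cases hy), fun _ _ => ih⟩
  rw [selection_eq]
  refine (hB l x hx).bind fun m hm => ?_
  cases m with
  | none => exact (hidle _).bind fun _ _ => trivial
  | some m₀ =>
    refine (bounded_findWitnesses n l (hm m₀ rfl)).bind fun s hs =>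
      (hB l _ fun y hy => ?_).bind fun _ _ => trivial
    split_ifs at hy
    · obtain rfl := Option.some_injective _ hy
      exact hs
    · cases hy

theorem bounded_search (hB : B.BoundedBy n D M) (hM : 1 ≤ M) (k : ℕ) (id : Option Bits) :
    (search B n D k id).Bounded M fun _ => True := by
  rw [search_eq]
  refine Prog.bounded_foldlM _ _ (fun m i _ => ?_) _ trivial
  refine (hB 1 _ fun y hy => ?_).bind fun _ _ => trivial
  split_ifs at hy
  · obtain rfl := Option.some_injective _ hy
    exact hM
  · cases hy

theorem bounded_selectionLoop (hB : B.BoundedBy n D M) (l : ℕ) {id : Option Bits}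
    (hid : ∀ y ∈ id, y.length ≤ M) :
    ∀ k inC, (selectionLoop B n D l id k inC).Bounded M fun _ => True
  | 0, _ => trivial
  | k + 1, inC => by
    rw [selectionLoop_succ]
    refine (bounded_selection hB l fun y hy => ?_).bind fun o _ => ?_
    · split_ifs at hy
      · exact hid y hy
      · cases hy
    · split_ifs
      · trivial
      · exact (bounded_selectionLoop hB l hid k _).bind fun _ _ => trivial

theorem msgLE_leaderElection {κ : Constants} (hB : B.BoundedBy n D M) (hM : 1 ≤ M)
    (hbits : κ.bits * lg n ≤ M) :
    (leaderElection κ B n D).MsgLE M := by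
  rw [leaderElection_eq]
  refine Prog.Bounded.msgLE (A := fun _ => True) (Prog.Bounded.bind
    (A := fun id : Option Bits => ∀ y ∈ id, y.length ≤ M) ?_ fun id hid => ?_)
  · intro c
    cases c
    · exact fun y hy => by cases hy
    · refine (bounded_randomBits _).bind fun x hx y hy => ?_
      obtain rfl := Option.some_injective _ hy
      exact hx.le.trans hbits
  · exact (bounded_search hB hM _ id).bind fun m _ =>
      (bounded_selectionLoop hB _ hid _ _).bind fun _ _ => trivial

end Messages

theorem stepsLE_leaderElection {κ : Constants} {B : MultiBroadcast} {n D : ℕ}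
    (hB : ∀ l x, (B.run n D l x).HasDuration (B.time n D)) :
    (leaderElection κ B n D).StepsLE (electionTime κ B n D) := by
  rw [leaderElection_eq, ← zero_add (electionTime κ B n D)]
  exact (hasDuration_chooseId κ n).stepsLE.bind fun id =>
    (hasDuration_search hB _ id).stepsLE.bind fun m =>
      (stepsLE_selectionLoop hB _ id _ _).bind (t := 0) fun _ => trivial

/-! ### Eccentricity -/

/-- Balls around `u` of radius less than `D` miss the far node `v`, so some edge leaves them, and
each further unit of radius adds a node. -/
theorem eccentricity_bounds {V : Type} [Fintype V] {G : Digraph V} {n D : ℕ} (hn2 : 2 ≤ n)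
    (hn : Fintype.card V = n) (hD : HasEccentricity G D) : 1 ≤ D ∧ D ≤ n := by
  classical
  obtain ⟨hall, u, v, hfar⟩ := hD
  constructor
  · by_contra hc
    obtain rfl : D = 0 := by omega
    rw [← hn] at hn2
    obtain ⟨a, b, hab⟩ := Fintype.one_lt_card_iff.1 hn2
    obtain ⟨k, hk, hr⟩ := hall a b
    obtain rfl : k = 0 := by omega
    exact hab hr
  · let S : ℕ → Finset V := fun k => Finset.univ.filter fun w => ∃ j ≤ k, ReachIn G j u w
    have hS : ∀ k w, w ∈ S k ↔ ∃ j ≤ k, ReachIn G j u w := fun k w => by simp [S]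
    have hcard : ∀ k ≤ D, k ≤ (S k).card := by
      intro k
      induction k with
      | zero => simp
      | succ k ih =>
        intro hk
        obtain ⟨m, -, hm⟩ := hall u v
        obtain ⟨a, b, ha, hb, hab⟩ := exists_edge_of_reachIn G (P := fun w => w ∈ S k)
          ((hS k u).2 ⟨0, by omega, rfl⟩) hm (fun hv => by
            obtain ⟨j, hj, hr⟩ := (hS k v).1 hv
            exact hfar j (by omega) hr)
        refine Nat.succ_le_of_lt ((ih (by omega)).trans_lt (Finset.card_lt_card
          ((Finset.ssubset_iff_of_subset fun w hw => ?_).2 ⟨b, ?_, hb⟩)))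
        · obtain ⟨j, hj, hr⟩ := (hS k w).1 hw
          exact (hS _ _).2 ⟨j, by omega, hr⟩
        · obtain ⟨j, hj, hr⟩ := (hS k a).1 ha
          exact (hS _ _).2 ⟨j + 1, by omega, a, hr, hab⟩
    exact (hcard D le_rfl).trans (hn ▸ Finset.card_le_univ _)

/-! ### Time bounds -/

theorem one_le_logb {n : ℕ} (hn : 2 ≤ n) : 1 ≤ Real.logb 2 n := by
  rw [Real.le_logb_iff_rpow_le (by norm_num) (by positivity), Real.rpow_one]
  exact_mod_cast hn

/-- Rounding up adds less than 1, which is at most the logarithm itself since `n ≥ 2`. -/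
theorem lg_le_two_mul_logb {n : ℕ} (hn : 2 ≤ n) : (lg n : ℝ) ≤ 2 * Real.logb 2 n := by
  have h := one_le_logb hn
  have h2 : (lg n : ℝ) < Real.logb 2 n + 1 := by
    have := Nat.ceil_lt_add_one (a := Real.logb 2 n) (by linarith)
    have h3 : ⌈Real.logb 2 n⌉₊ = lg n := by
      have := Real.natCeil_logb_natCast 2 n
      simpa [lg] using this
    rwa [h3] at this
  linarith

theorem lg_le_sqrtLg_sq (n : ℕ) : lg n ≤ sqrtLg n ^ 2 := by
  have h : Real.sqrt (lg n) ≤ sqrtLg n := Nat.le_ceil _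
  have h2 : (lg n : ℝ) ≤ (sqrtLg n : ℝ) ^ 2 := by
    rw [← Real.sq_sqrt (Nat.cast_nonneg (lg n))]
    exact pow_le_pow_left₀ (Real.sqrt_nonneg _) h 2
  exact_mod_cast h2

theorem sqrtLg_le {n : ℕ} (hn : 2 ≤ n) : (sqrtLg n : ℝ) ≤ 3 * Real.sqrt (Real.logb 2 n) := by
  have h := one_le_logb hn
  have h1 : (sqrtLg n : ℝ) < Real.sqrt (lg n) + 1 := Nat.ceil_lt_add_one (Real.sqrt_nonneg _)
  have h2 : Real.sqrt (lg n) ≤ 2 * Real.sqrt (Real.logb 2 n) := by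
    refine Real.sqrt_le_iff.2 ⟨by positivity, ?_⟩
    rw [mul_pow, Real.sq_sqrt (by linarith)]
    linarith [lg_le_two_mul_logb hn]
  have h3 : 1 ≤ Real.sqrt (Real.logb 2 n) := Real.one_le_sqrt.2 h
  linarith

/-- The additional level turns log (n/D) into log (2n/D); this is the purpose of the 2 in
`bcastTime`, which keeps the logarithm at least 1 even when `D` is close to `n`. -/
theorem shortLevels_mul_le {n D : ℕ} (hD : 1 ≤ D) (hDn : D ≤ n) :
    ((shortLevels n D * D : ℕ) : ℝ) ≤ D * Real.logb 2 (2 * n / D) := by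
  have hD0 : (0 : ℝ) < D := by exact_mod_cast hD
  have hn0 : (0 : ℝ) < n := by exact_mod_cast (by omega : 0 < n)
  have hdiv : 0 < n / D := Nat.div_pos hDn hD
  have h1 : (Nat.log 2 (n / D) : ℝ) ≤ Real.logb 2 (n / D) := by
    rw [Real.le_logb_iff_rpow_le (by norm_num) (by positivity), Real.rpow_natCast]
    calc ((2 : ℝ) ^ Nat.log 2 (n / D)) ≤ ((n / D : ℕ) : ℝ) := by
          exact_mod_cast Nat.pow_log_le_self 2 hdiv.ne'
      _ ≤ n / D := Nat.cast_div_le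
  have h2 : Real.logb 2 (2 * n / D) = 1 + Real.logb 2 (n / D) := by
    rw [mul_div_assoc, Real.logb_mul (by norm_num) (by positivity), Real.logb_self_eq_one]
    norm_num
  rw [h2, shortLevels, mul_comm]
  push_cast
  exact mul_le_mul_of_nonneg_left (by linarith) hD0.le

theorem time_layeredBroadcast_le {n D : ℕ} (hn : 2 ≤ n) (hD : 1 ≤ D) (hDn : D ≤ n) (c : ℕ) :
    ((layeredBroadcast c).time n D : ℝ) ≤ (640 + 672 * (c + 1)) * bcastTime n D ∧
      Real.logb 2 n ^ 2 ≤ bcastTime n D := by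
  have h1 := shortLevels_mul_le hD hDn
  have h2 := lg_le_two_mul_logb hn
  have h3 := one_le_logb hn
  have hX : 0 ≤ D * Real.logb 2 (2 * n / D) := le_trans (Nat.cast_nonneg _) h1
  set X := D * Real.logb 2 (2 * n / D)
  set y := Real.logb 2 n
  have hbc : bcastTime n D = X + y ^ 2 := rfl
  refine ⟨?_, by rw [hbc]; linarith⟩
  have htime : ((layeredBroadcast c).time n D : ℝ) =
      640 * ((shortLevels n D * D : ℕ) : ℝ) + 112 * ((c : ℝ) + 1) * ((lg n + 1) * lg n) := by
    simp only [layeredBroadcast]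
    push_cast
    ring
  have h4 : ((lg n : ℝ) + 1) * lg n ≤ 6 * y ^ 2 := by
    have h0 : (0 : ℝ) ≤ lg n := Nat.cast_nonneg _
    nlinarith
  have hc : (0 : ℝ) ≤ c := Nat.cast_nonneg c
  have h5 : 112 * ((c : ℝ) + 1) * ((lg n + 1) * lg n) ≤ 112 * ((c : ℝ) + 1) * (6 * y ^ 2) := by
    gcongr
  rw [htime, hbc]
  nlinarith [mul_nonneg hc hX, sq_nonneg y]

theorem electionTime_le {κ : Constants} {n D : ℕ} (hn : 2 ≤ n) (hD : 1 ≤ D) (hDn : D ≤ n) (c : ℕ) :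
    (electionTime κ (layeredBroadcast c) n D : ℝ) ≤
      3 * ((1 + 2 * κ.rounds) * (640 + 672 * (c + 1)) + 16 * κ.rounds * κ.bits) *
        (bcastTime n D * Real.sqrt (Real.logb 2 n)) := by
  obtain ⟨h1, h2⟩ := time_layeredBroadcast_le hn hD hDn c
  have h3 := lg_le_two_mul_logb hn
  have h4 := sqrtLg_le hn
  set b := bcastTime n D
  set t : ℝ := (((layeredBroadcast c).time n D : ℕ) : ℝ)
  set K : ℝ := 640 + 672 * (c + 1)
  have hL : (lg n : ℝ) * lg n ≤ 4 * b := by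
    have h0 : (0 : ℝ) ≤ lg n := Nat.cast_nonneg _
    nlinarith
  have htime : (electionTime κ (layeredBroadcast c) n D : ℝ) =
      sqrtLg n * ((1 + 2 * κ.rounds) * t + 4 * κ.rounds * κ.bits * (lg n * lg n)) := by
    simp only [electionTime, t]
    push_cast
    ring
  have hb0 : 0 ≤ b := (sq_nonneg _).trans h2
  have hin : (1 + 2 * κ.rounds) * t + 4 * κ.rounds * κ.bits * (lg n * lg n) ≤
      (1 + 2 * κ.rounds) * (K * b) + 4 * κ.rounds * κ.bits * (4 * b) := by gcongr
  have hin0 : 0 ≤ (1 + 2 * κ.rounds) * t + 4 * κ.rounds * κ.bits * (lg n * lg n) := by positivity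
  rw [htime]
  calc _ ≤ 3 * Real.sqrt (Real.logb 2 n) *
        ((1 + 2 * κ.rounds) * (K * b) + 4 * κ.rounds * κ.bits * (4 * b)) :=
        mul_le_mul h4 hin hin0 (by positivity)
    _ = _ := by ring

/-! ### Error bounds -/

/-- Since `lg n` is rounded up, `2 ^ (-lg n)` is at most `1 / n`. -/
theorem half_pow_le_ofReal {n c₀ : ℕ} {c : ℝ} (hn : 2 ≤ n) (hc : c ≤ c₀) :
    (2⁻¹ : ℝ≥0∞) ^ (c₀ * lg n) ≤ ENNReal.ofReal ((n : ℝ) ^ (-c)) := by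
  have h2 : (2⁻¹ : ℝ≥0∞) = ENNReal.ofReal 2⁻¹ := by
    rw [ENNReal.ofReal_inv_of_pos (by norm_num)]; norm_num
  rw [h2, ← ENNReal.ofReal_pow (by norm_num)]
  refine ENNReal.ofReal_le_ofReal ?_
  have hn1 : (1 : ℝ) ≤ n := by exact_mod_cast (by omega : 1 ≤ n)
  calc ((2 : ℝ)⁻¹) ^ (c₀ * lg n) = (((2 : ℝ) ^ lg n) ^ c₀)⁻¹ := by
        rw [← pow_mul, mul_comm, inv_pow]
    _ ≤ ((n : ℝ) ^ c₀)⁻¹ := by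
        refine inv_anti₀ (by positivity) (pow_le_pow_left₀ (by positivity) ?_ _)
        exact_mod_cast le_two_pow_lg n
    _ = (n : ℝ) ^ (-(c₀ : ℝ)) := by rw [Real.rpow_neg (by positivity), Real.rpow_natCast]
    _ ≤ (n : ℝ) ^ (-c) := Real.rpow_le_rpow_of_exponent_le hn1 (by linarith)

/-- The bound for the failure probability of the algorithm with a broadcast procedure whose error
probability is at most `2 ^ (-c' log n)`. -/
noncomputable def electionRisk (κ : Constants) (c' n : ℕ) : ℝ≥0∞ :=
  2⁻¹ ^ (κ.cand * lg n) +
    (if n ≤ κ.rounds * sqrtLg n then 0 else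
      ((κ.cand * lg n : ℕ) : ℝ≥0∞) ^ (κ.rounds * sqrtLg n + 1) *
        (2⁻¹ ^ sqrtLg n) ^ (κ.rounds * sqrtLg n)) +
    ((sqrtLg n + 2 * (κ.rounds * sqrtLg n : ℕ)) * 2⁻¹ ^ (c' * lg n) + (κ.rounds * sqrtLg n : ℕ) *
      (((κ.cand * lg n : ℕ) : ℝ≥0∞) ^ 2 * (2⁻¹ + 2⁻¹ * (7 / 8) ^ 4) ^ (κ.bits * lg n)))

theorem electsLeader_of_electionRisk_le {κ : Constants} {c₀ c' n₀ : ℕ} {c : ℝ}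
    (hbits : 1 ≤ κ.bits) (hrounds : 1 ≤ κ.rounds) (hc : c ≤ c₀) (hc' : c₀ ≤ c') (hn₀ : 2 ≤ n₀)
    (hrisk : ∀ n, n₀ ≤ n → electionRisk κ c' n ≤ 2⁻¹ ^ (c₀ * lg n)) :
    ElectsLeader κ c n₀ := by
  set K₁ : ℝ := 640 + 672 * (c' + 1) with hK₁
  set K₂ : ℝ := 3 * ((1 + 2 * κ.rounds) * K₁ + 16 * κ.rounds * κ.bits) with hK₂
  have hK₁0 : 0 ≤ K₁ := by positivity
  have hK₂0 : 0 ≤ K₂ := by positivity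
  -- One constant serves all bounds: `K₁` for the broadcast time, `K₂` for the election time, and `2
  -- * κ.bits + 1` to make room in a message for an ID and for the single bit used by Search.
  refine ⟨layeredBroadcast c', electionTime κ (layeredBroadcast c'), K₁ + K₂ + 2 * κ.bits + 1, ?_⟩
  intro n D hn V _ G hV hG
  have hn2 : 2 ≤ n := hn₀.trans hn
  obtain ⟨hD1, hDn⟩ := eccentricity_bounds hn2 hV hG
  obtain ⟨ht, hlog⟩ := time_layeredBroadcast_le hn2 hD1 hDn c'
  have hb0 : 0 ≤ bcastTime n D := (sq_nonneg _).trans hlog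
  have hl1 := one_le_logb hn2
  have hrel := reliable_layeredBroadcast hV hD1 hG.1 c' (κ.bits * lg n)
  set M := ⌊(K₁ + K₂ + 2 * κ.bits + 1) * Real.logb 2 n⌋₊ with hM
  have hbits0 : (0 : ℝ) ≤ κ.bits := Nat.cast_nonneg _
  have hM1 : 1 ≤ M := by
    rw [hM, Nat.one_le_floor_iff]
    nlinarith
  have hMl : κ.bits * lg n ≤ M := by
    rw [hM, Nat.le_floor_iff (by positivity)]
    push_cast
    calc (κ.bits : ℝ) * lg n ≤ κ.bits * (2 * Real.logb 2 n) := by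
          gcongr; exact lg_le_two_mul_logb hn2
      _ ≤ (K₁ + K₂ + 2 * κ.bits + 1) * Real.logb 2 n := by nlinarith
  have hpow_nonneg : 0 ≤ (n : ℝ) ^ (-c) := by positivity
  refine ⟨⟨ht.trans ?_, fun l hl => ⟨fun x => hasDuration_layeredBroadcast c' n D l x,
    fun x hx => ?_, fun f hf => ?_⟩⟩, ?_, ?_, ?_, ?_⟩
  · exact mul_le_mul_of_nonneg_right (by linarith) hb0
  · exact (bounded_layeredBroadcast c' n D l M x fun y hy =>
      ((hx y hy).le.trans hl).trans hMl).msgLE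
  · refine le_prob_of_failure_le G hpow_nonneg ?_
    exact (failure_mono G fun m hm => hm.1).trans ((hrel.failure_le l hl f hf).trans
      (half_pow_le_ofReal hn2 (hc.trans (by exact_mod_cast hc'))))
  · refine (electionTime_le hn2 hD1 hDn c').trans ?_
    exact mul_le_mul_of_nonneg_right (by linarith) (by positivity)
  · exact stepsLE_leaderElection hrel.hasDuration
  · exact msgLE_leaderElection (fun l x hx => bounded_layeredBroadcast c' n D l M x hx) hM1 hMl
  · refine le_prob_of_failure_le G hpow_nonneg ?_
    exact ((failure_leaderElection_le hrel hbits hrounds hn2 hV fun u v =>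
      (hG.1 u v).imp fun k hk => hk.2).trans (hrisk n hn)).trans (half_pow_le_ofReal hn2 hc)

/-! ### Numerical estimates and the choice of the constants -/

theorem natCast_mul_half_pow_le {A e f : ℕ} (h : A * 2 ^ f ≤ 2 ^ e) :
    (A : ℝ≥0∞) * 2⁻¹ ^ e ≤ 2⁻¹ ^ f := by
  rw [← ENNReal.inv_pow, ← ENNReal.inv_pow, ← div_eq_mul_inv]
  refine ENNReal.div_le_of_le_mul ?_
  rw [mul_comm, ← div_eq_mul_inv, ENNReal.le_div_iff_mul_le (by simp) (by simp)]
  exact_mod_cast h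

/-- One random bit contributes a factor of about 0.793, so 16 bits contribute about 2^(-5.35). -/
theorem missFactor_pow_le : (2⁻¹ + 2⁻¹ * (7 / 8) ^ 4 : ℝ≥0∞) ^ 16 ≤ 2⁻¹ ^ 5 := by
  have h2 : (2⁻¹ : ℝ≥0∞) = ENNReal.ofReal 2⁻¹ := by
    rw [ENNReal.ofReal_inv_of_pos (by norm_num)]; norm_num
  have h78 : (7 / 8 : ℝ≥0∞) = ENNReal.ofReal (7 / 8) := by
    rw [ENNReal.ofReal_div_of_pos (by norm_num)]; norm_num
  rw [h2, h78, ← ENNReal.ofReal_pow (by norm_num), ← ENNReal.ofReal_pow (by norm_num),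
    ← ENNReal.ofReal_mul (by norm_num), ← ENNReal.ofReal_add (by norm_num) (by norm_num),
    ← ENNReal.ofReal_pow (by norm_num)]
  exact ENNReal.ofReal_le_ofReal (by norm_num)

/-- Each of the four summands is at most a quarter of the target. For shared prefixes, `α * L` is at
most 2^(s/2), so about half of the exponent `γ * s ^ 2` survives, and `γ` has to be slightly larger
than `2 * c₀`. For pairs of IDs, the exponent `5 * β * L` has to cover `c₀ * L` and another `3 * L`
for the factor `s * L ^ 2`. -/
theorem electionRisk_le {α β γ c₀ n : ℕ} (hn : 2 ≤ n) (hα : c₀ + 2 ≤ α)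
    (hβ : 4 * γ * α ^ 2 * 2 ^ ((3 + c₀) * lg n) ≤ 2 ^ (5 * β * lg n))
    (hγ : n ≤ γ * sqrtLg n ∨ (α * sqrtLg n ^ 2) ^ 2 ≤ 2 ^ sqrtLg n ∧
      2 * c₀ * sqrtLg n ^ 2 + 4 + sqrtLg n ≤ γ * sqrtLg n ^ 2) :
    electionRisk ⟨α, 16 * β, γ⟩ (c₀ + 1 + 4 * (1 + 2 * γ)) n ≤ 2⁻¹ ^ (c₀ * lg n) := by
  have hL1 : 1 ≤ lg n := Nat.clog_pos (by norm_num) hn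
  have hsL : sqrtLg n ≤ lg n := sqrtLg_le_lg n
  have hLs : lg n ≤ sqrtLg n ^ 2 := lg_le_sqrtLg_sq n
  have hLpow : lg n ≤ 2 ^ lg n := Nat.lt_two_pow_self.le
  unfold electionRisk
  dsimp only
  set L := lg n
  set s := sqrtLg n
  have t1 : (2⁻¹ : ℝ≥0∞) ^ (α * L) ≤ 2⁻¹ ^ (c₀ * L + 2) := by
    refine pow_le_pow_of_le_one bot_le (by simp) ?_
    nlinarith
  have t2 : (if n ≤ γ * s then (0 : ℝ≥0∞) else
      ((α * L : ℕ) : ℝ≥0∞) ^ (γ * s + 1) * (2⁻¹ ^ s) ^ (γ * s)) ≤ 2⁻¹ ^ (c₀ * L + 2) := by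
    split_ifs with h
    · exact bot_le
    · obtain ⟨h1, h2⟩ := hγ.resolve_left h
      rw [← pow_mul, ← Nat.cast_pow]
      refine natCast_mul_half_pow_le ?_
      -- Squaring replaces the half-integral exponent in `α * L ≤ 2 ^ (s / 2)`.
      refine (Nat.pow_le_pow_iff_left (n := 2) (by norm_num)).1 ?_
      calc ((α * L) ^ (γ * s + 1) * 2 ^ (c₀ * L + 2)) ^ 2
          = ((α * L) ^ 2) ^ (γ * s + 1) * 2 ^ (2 * (c₀ * L + 2)) := by
            rw [mul_pow, ← pow_mul, ← pow_mul, ← pow_mul, mul_comm 2 (γ * s + 1),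
              mul_comm 2 (c₀ * L + 2)]
        _ ≤ ((α * s ^ 2) ^ 2) ^ (γ * s + 1) * 2 ^ (2 * (c₀ * s ^ 2 + 2)) := by
            gcongr
            norm_num
        _ ≤ (2 ^ s) ^ (γ * s + 1) * 2 ^ (2 * (c₀ * s ^ 2 + 2)) := by gcongr
        _ = 2 ^ (s * (γ * s + 1) + 2 * (c₀ * s ^ 2 + 2)) := by rw [← pow_mul, ← pow_add]
        _ ≤ 2 ^ (s * (γ * s) * 2) := by
            refine Nat.pow_le_pow_right (by norm_num) ?_
            nlinarith
        _ = (2 ^ (s * (γ * s))) ^ 2 := by rw [pow_mul]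
  have t3 : ((s : ℝ≥0∞) + 2 * (γ * s : ℕ)) * 2⁻¹ ^ ((c₀ + 1 + 4 * (1 + 2 * γ)) * L) ≤
      2⁻¹ ^ (c₀ * L + 2) := by
    have : ((s : ℝ≥0∞) + 2 * (γ * s : ℕ)) = ((s + 2 * (γ * s) : ℕ) : ℝ≥0∞) := by push_cast; ring
    rw [this]
    refine natCast_mul_half_pow_le ?_
    calc (s + 2 * (γ * s)) * 2 ^ (c₀ * L + 2)
        = 4 * (1 + 2 * γ) * s * 2 ^ (c₀ * L) := by rw [pow_add]; ring
      _ ≤ 2 ^ (4 * (1 + 2 * γ)) * 2 ^ L * 2 ^ (c₀ * L) := by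
          gcongr
          · exact Nat.lt_two_pow_self.le
          · exact hsL.trans hLpow
      _ = 2 ^ (4 * (1 + 2 * γ) + L + c₀ * L) := by rw [← pow_add, ← pow_add]
      _ ≤ _ := by
          refine Nat.pow_le_pow_right (by norm_num) ?_
          nlinarith
  have t4 : ((γ * s : ℕ) : ℝ≥0∞) *
      (((α * L : ℕ) : ℝ≥0∞) ^ 2 * (2⁻¹ + 2⁻¹ * (7 / 8) ^ 4) ^ (16 * β * L)) ≤
      2⁻¹ ^ (c₀ * L + 2) := by
    have hm : (2⁻¹ + 2⁻¹ * (7 / 8) ^ 4 : ℝ≥0∞) ^ (16 * β * L) ≤ 2⁻¹ ^ (5 * β * L) := by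
      rw [mul_assoc, pow_mul, mul_assoc 5, pow_mul 2⁻¹ 5]
      exact pow_le_pow_left₀ bot_le missFactor_pow_le _
    refine le_trans (mul_le_mul_right (mul_le_mul_right hm _) _) ?_
    rw [← mul_assoc, ← Nat.cast_pow, ← Nat.cast_mul]
    refine natCast_mul_half_pow_le ?_
    calc γ * s * (α * L) ^ 2 * 2 ^ (c₀ * L + 2)
        = 4 * γ * α ^ 2 * (s * L * L * 2 ^ (c₀ * L)) := by rw [pow_add]; ring
      _ ≤ 4 * γ * α ^ 2 * (2 ^ L * 2 ^ L * 2 ^ L * 2 ^ (c₀ * L)) := by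
          gcongr
          exact hsL.trans hLpow
      _ = 4 * γ * α ^ 2 * 2 ^ ((3 + c₀) * L) := by
          rw [← pow_add, ← pow_add, ← pow_add]
          congr 2
          ring
      _ ≤ _ := hβ
  have h4 : (2⁻¹ : ℝ≥0∞) ^ (c₀ * L + 2) * 4 = 2⁻¹ ^ (c₀ * L) := by
    rw [pow_add, mul_assoc]
    have : (2⁻¹ : ℝ≥0∞) ^ 2 * 4 = 1 := by
      rw [show (4 : ℝ≥0∞) = 2 ^ 2 by norm_num, ← mul_pow,
        ENNReal.inv_mul_cancel (by norm_num) (by norm_num), one_pow]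
    rw [this, mul_one]
  calc _ ≤ (2⁻¹ : ℝ≥0∞) ^ (c₀ * L + 2) + 2⁻¹ ^ (c₀ * L + 2) +
        (2⁻¹ ^ (c₀ * L + 2) + 2⁻¹ ^ (c₀ * L + 2)) :=
        add_le_add (add_le_add t1 t2) (add_le_add t3 t4)
    _ = (2⁻¹ : ℝ≥0∞) ^ (c₀ * L + 2) * 4 := by ring
    _ = _ := h4

theorem exists_sq_le_two_pow (α : ℕ) : ∃ s₀, ∀ s ≥ s₀, (α * s ^ 2) ^ 2 ≤ 2 ^ s := by
  have h := tendsto_pow_const_div_const_pow_of_one_lt 4 (r := (2 : ℝ)) (by norm_num)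
  have hpos : (0 : ℝ) < 1 / ((α : ℝ) ^ 2 + 1) := by positivity
  have hev := h.eventually (gt_mem_nhds hpos)
  obtain ⟨s₀, hs₀⟩ := Filter.eventually_atTop.1 hev
  refine ⟨s₀, fun s hs => ?_⟩
  have h1 := hs₀ s hs
  rw [div_lt_div_iff₀ (by positivity) (by positivity), one_mul] at h1
  have h2 : ((α * s ^ 2) ^ 2 : ℝ) ≤ 2 ^ s := by
    have : (0 : ℝ) ≤ (s : ℝ) ^ 4 := by positivity
    nlinarith
  exact_mod_cast h2

theorem electsLeader_four_sixteen_three : ∃ n₀ : ℕ, 2 ≤ n₀ ∧ ElectsLeader ⟨4, 16, 3⟩ 1 n₀ := by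
  obtain ⟨s₀, hs₀⟩ := exists_sq_le_two_pow 4
  -- The square forces `sqrtLg n ≥ s₀ + 3`; from 3 on one has 4 + s ≤ s², as `γ = 3` requires. The
  -- summand 8 comes from 4 · 3 · 4² ≤ 2^8 and gives 8 + 4 log n ≤ 5 log n.
  have h2 : 2 ≤ 2 ^ ((s₀ + 3) ^ 2 + 8) := by
    calc 2 = 2 ^ 1 := rfl
      _ ≤ _ := Nat.pow_le_pow_right (by norm_num) (by omega)
  refine ⟨2 ^ ((s₀ + 3) ^ 2 + 8), h2, electsLeader_of_electionRisk_le (c₀ := 1)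
    (c' := 1 + 1 + 4 * (1 + 2 * 3)) (by norm_num) (by norm_num) (by norm_num) (by norm_num) h2
    fun n hn => ?_⟩
  have hL : (s₀ + 3) ^ 2 + 8 ≤ lg n := by
    have := Nat.clog_mono_right 2 hn
    rwa [Nat.clog_pow 2 _ (by norm_num)] at this
  have hs : s₀ + 3 ≤ sqrtLg n := by
    have := lg_le_sqrtLg_sq n
    exact (Nat.pow_le_pow_iff_left (n := 2) (by norm_num)).1 (by omega)
  refine electionRisk_le (β := 1) (h2.trans hn) (by norm_num) ?_
    (Or.inr ⟨hs₀ _ (by omega), by nlinarith⟩)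
  calc 4 * 3 * 4 ^ 2 * 2 ^ ((3 + 1) * lg n) ≤ 2 ^ 8 * 2 ^ ((3 + 1) * lg n) := by
        gcongr; norm_num
    _ = 2 ^ (8 + (3 + 1) * lg n) := by rw [← pow_add]
    _ ≤ _ := Nat.pow_le_pow_right (by norm_num) (by omega)

theorem exists_electsLeader (c : ℝ) : ∃ κ : Constants, ElectsLeader κ c 2 := by
  set c₀ := ⌈c⌉₊ with hc₀
  obtain ⟨s₀, hs₀⟩ := exists_sq_le_two_pow (c₀ + 2)
  set α := c₀ + 2 with hα
  -- The first summand exceeds or equals every `n` with `sqrtLg n < s₀`, so on small networks the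
  -- bound on the number of candidates holds trivially. The second summand is for all other
  -- networks.
  set γ := 2 ^ (s₀ ^ 2) + (2 * c₀ + 5) with hγ
  -- The constant factor `4 * γ * α ^ 2` is absorbed into the exponent, being at most 2 to its own
  -- power, since `lg n ≥ 1`.
  set β := c₀ + 3 + 4 * γ * α ^ 2 with hβ
  refine ⟨⟨α, 16 * β, γ⟩, electsLeader_of_electionRisk_le (c₀ := c₀)
    (c' := c₀ + 1 + 4 * (1 + 2 * γ)) (by dsimp only; omega) (le_add_left (by omega))
    (Nat.le_ceil c) (by omega) le_rfl fun n hn => electionRisk_le hn le_rfl ?_ ?_⟩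
  · have hL1 : 1 ≤ lg n := Nat.clog_pos (by norm_num) hn
    calc 4 * γ * α ^ 2 * 2 ^ ((3 + c₀) * lg n)
        ≤ 2 ^ (4 * γ * α ^ 2) * 2 ^ ((3 + c₀) * lg n) := by
          gcongr; exact Nat.lt_two_pow_self.le
      _ = 2 ^ (4 * γ * α ^ 2 + (3 + c₀) * lg n) := by rw [← pow_add]
      _ ≤ _ := by
          refine Nat.pow_le_pow_right (by norm_num) ?_
          have h1 : 4 * γ * α ^ 2 ≤ 4 * γ * α ^ 2 * lg n := Nat.le_mul_of_pos_right _ hL1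
          have h2 : β * lg n = (3 + c₀) * lg n + 4 * γ * α ^ 2 * lg n := by rw [hβ]; ring
          rw [mul_assoc 5]
          omega
  · have hL1 : 1 ≤ lg n := Nat.clog_pos (by norm_num) hn
    have hs1 : 1 ≤ sqrtLg n := by
      by_contra hc
      have := lg_le_sqrtLg_sq n
      obtain h0 : sqrtLg n = 0 := by omega
      rw [h0] at this
      omega
    rcases Nat.lt_or_ge (sqrtLg n) s₀ with h | h
    · left
      calc n ≤ 2 ^ lg n := le_two_pow_lg n
        _ ≤ 2 ^ (s₀ ^ 2) := Nat.pow_le_pow_right (by norm_num)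
            ((lg_le_sqrtLg_sq n).trans (Nat.pow_le_pow_left h.le 2))
        _ ≤ γ := Nat.le_add_right _ _
        _ ≤ γ * sqrtLg n := Nat.le_mul_of_pos_right _ hs1
    · right
      refine ⟨hs₀ _ h, ?_⟩
      have hγ' : 2 * c₀ + 5 ≤ γ := Nat.le_add_left _ _
      calc 2 * c₀ * sqrtLg n ^ 2 + 4 + sqrtLg n ≤ (2 * c₀ + 5) * sqrtLg n ^ 2 := by nlinarith
        _ ≤ γ * sqrtLg n ^ 2 := Nat.mul_le_mul_right _ hγ'

end RadioNetwork

theorem theorem2 :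
    -- the constants `4`, `16`, `3`, with error probability `1 / n`, on all large enough networks
    (∃ n₀ : ℕ, 2 ≤ n₀ ∧ RadioNetwork.ElectsLeader ⟨4, 16, 3⟩ 1 n₀) ∧
    -- any error exponent `c`, with constants that depend on `c` only, on all networks
    (∀ c : ℝ, 1 ≤ c → ∃ κ : RadioNetwork.Constants, RadioNetwork.ElectsLeader κ c 2) :=
  ⟨RadioNetwork.electsLeader_four_sixteen_three,
    fun c _ => RadioNetwork.exists_electsLeader c⟩
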